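/- **Conventions.** Let $A$ be a finite-dimensional algebra over a field; modules are finitely generated left modules unless stated otherwise. Let $\Omega_A(M)$ be the kernel of a projective cover of $M$, $\Omega_A^0(M)=M$, $\Omega_A^{n+1}(M)=\Omega_A(\Omega_A^n(M))$, and let $A\text{-}\underline{\mathrm{mod}}$ be the category of finitely generated modules modulo the morphisms factoring through projective modules. For a module $M$ let $$\operatorname{del}_A(M)=\inf\{n\ge 0 \mid \Omega_A^n(M)\text{ is a direct summand of }\Omega_A^{n+1}(N)\text{ in }A\text{-}\underline{\mathrm{mod}}\text{ for some module }N\},$$ $$\operatorname{sddel}_A(M)=\inf\{\operatorname{del}_A(N)\mid M\text{ embeds in the module } N\},$$ with $\inf\emptyset=\infty$, and let $\operatorname{del}(A)$ and $\operatorname{sddel}(A)$ be the suprema of $\operatorname{del}_A(S)$ and $\operatorname{sddel}_A(S)$ over all simple $A$-modules $S$. Two algebras $A,A'$ are *derived equivalent* if there is a triangulated equivalence $D^b(A)\simeq D^b(A')$ between the bounded derived categories of all left modules. Let $k$ be a field and let $q\in k^\times$ satisfy $q^n\ne 1$ for all $n\ge 1$. Put $$\Lambda=k\langle x,y,z\rangle/(x^2,\;y^2,\;z^2,\;yz,\;xy+qyx,\;xz-zx,\;zy-zx),$$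 and let $M(q)$ be the left $\Lambda$-module with $k$-basis $v,v',v''$ and action $xv=qv'$, $yv=v'$, $zv=v''$, where $x,y,z$ annihilate $v'$ and $v''$. Let $D=\operatorname{Hom}_k(-,k)$, so that $D(M(q))$ is a right $\Lambda$-module, and put $$B=\begin{pmatrix}k&0\\ M(q)&\Lambda\end{pmatrix},\qquad C=\begin{pmatrix}\Lambda&0\\ D(M(q))&k\end{pmatrix}.$$ **Theorem.** For all such $k$ and $q$, the algebras $B$ and $C$ are finite-dimensional over $k$ and derived equivalent, and $$\operatorname{del}(B)=\operatorname{sddel}(B)=\infty,\qquad \operatorname{del}(C)=\operatorname{sddel}(C)=0.$$ In particular, there exist a field $k$ and derived equivalent finite-dimensional $k$-algebras $B$ and $C$ with these values. Hence, already for finite-dimensional algebras over a field, neither finiteness of $\operatorname{del}$ nor finiteness of $\operatorname{sddel}$ is invariant under derived equivalence. (For $\operatorname{del}$ this disproves the conjecture of Xi and Zhang, which asserted the invariance for Noetherian rings.) -/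

import Mathlib

open CategoryTheory

universe u

namespace DeloopingLevel

/-! ### Lower triangular matrix rings -/

/-- The underlying type of the lower triangular matrix ring with rows `(R, 0)` and `(N, S)`:
an element is a matrix with first row `(fst, 0)` and second row `(corner, snd)`. -/
@[ext]
structure LowerTriangular (R N S : Type u) where
  fst : R
  corner : N
  snd : S

namespace LowerTriangular

variable {R N S : Type u}

section Ring

variable [Ring R] [Ring S] [AddCommGroup N]

instance : Zero (LowerTriangular R N S) := ⟨⟨0, 0, 0⟩⟩
instance : One (LowerTriangular R N S) := ⟨⟨1, 0, 1⟩⟩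
instance : Add (LowerTriangular R N S) :=
  ⟨fun x y => ⟨x.fst + y.fst, x.corner + y.corner, x.snd + y.snd⟩⟩
instance : Neg (LowerTriangular R N S) := ⟨fun x => ⟨-x.fst, -x.corner, -x.snd⟩⟩

@[simp] lemma zero_fst : (0 : LowerTriangular R N S).fst = 0 := rfl
@[simp] lemma zero_corner : (0 : LowerTriangular R N S).corner = 0 := rfl
@[simp] lemma zero_snd : (0 : LowerTriangular R N S).snd = 0 := rfl
@[simp] lemma one_fst : (1 : LowerTriangular R N S).fst = 1 := rfl
@[simp] lemma one_corner : (1 : LowerTriangular R N S).corner = 0 := rfl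
@[simp] lemma one_snd : (1 : LowerTriangular R N S).snd = 1 := rfl
@[simp] lemma add_fst (x y : LowerTriangular R N S) : (x + y).fst = x.fst + y.fst := rfl
@[simp] lemma add_corner (x y : LowerTriangular R N S) :
    (x + y).corner = x.corner + y.corner := rfl
@[simp] lemma add_snd (x y : LowerTriangular R N S) : (x + y).snd = x.snd + y.snd := rfl
@[simp] lemma neg_fst (x : LowerTriangular R N S) : (-x).fst = -x.fst := rfl
@[simp] lemma neg_corner (x : LowerTriangular R N S) : (-x).corner = -x.corner := rfl
@[simp] lemma neg_snd (x : LowerTriangular R N S) : (-x).snd = -x.snd := rfl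

instance : AddCommGroup (LowerTriangular R N S) where
  add_assoc x y z := by ext <;> simp [add_assoc]
  zero_add x := by ext <;> simp
  add_zero x := by ext <;> simp
  add_comm x y := by ext <;> simp [add_comm]
  neg_add_cancel x := by ext <;> simp
  nsmul := nsmulRec
  zsmul := zsmulRec

variable [Module S N] [Module Rᵐᵒᵖ N]

/-- Matrix multiplication; the right action of `r : R` on `n : N` is `MulOpposite.op r • n`. -/
instance : Mul (LowerTriangular R N S) :=
  ⟨fun x y => ⟨x.fst * y.fst, MulOpposite.op y.fst • x.corner + x.snd • y.corner,
    x.snd * y.snd⟩⟩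

@[simp] lemma mul_fst (x y : LowerTriangular R N S) : (x * y).fst = x.fst * y.fst := rfl
@[simp] lemma mul_corner (x y : LowerTriangular R N S) :
    (x * y).corner = MulOpposite.op y.fst • x.corner + x.snd • y.corner := rfl
@[simp] lemma mul_snd (x y : LowerTriangular R N S) : (x * y).snd = x.snd * y.snd := rfl

variable [SMulCommClass S Rᵐᵒᵖ N]

instance : Ring (LowerTriangular R N S) where
  __ := (inferInstance : AddCommGroup (LowerTriangular R N S))
  mul_assoc x y z := by
    ext
    · simp [mul_assoc]
    · simp [mul_smul, smul_comm, add_assoc]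
    · simp [mul_assoc]
  one_mul x := by ext <;> simp
  mul_one x := by ext <;> simp
  zero_mul x := by ext <;> simp
  mul_zero x := by ext <;> simp
  left_distrib x y z := by
    ext
    · simp [mul_add]
    · simp [add_smul, smul_add]; abel
    · simp [mul_add]
  right_distrib x y z := by
    ext
    · simp [add_mul]
    · simp [add_smul, smul_add]; abel
    · simp [add_mul]

end Ring

section Algebra

variable {k : Type u} [Field k] [Ring R] [Ring S] [AddCommGroup N]
  [Algebra k R] [Algebra k S] [Module k N]

instance : SMul k (LowerTriangular R N S) :=
  ⟨fun c x => ⟨c • x.fst, c • x.corner, c • x.snd⟩⟩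

@[simp] lemma smul_fst (c : k) (x : LowerTriangular R N S) : (c • x).fst = c • x.fst := rfl
@[simp] lemma smul_corner (c : k) (x : LowerTriangular R N S) :
    (c • x).corner = c • x.corner := rfl
@[simp] lemma smul_snd (c : k) (x : LowerTriangular R N S) : (c • x).snd = c • x.snd := rfl

instance : Module k (LowerTriangular R N S) where
  one_smul x := by ext <;> simp
  mul_smul a b x := by ext <;> simp [mul_smul]
  smul_zero a := by ext <;> simp
  smul_add a x y := by ext <;> simp
  add_smul a b x := by ext <;> simp [add_smul]
  zero_smul x := by ext <;> simp

variable [Module S N] [Module Rᵐᵒᵖ N] [SMulCommClass S Rᵐᵒᵖ N]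
  [IsScalarTower k S N] [IsScalarTower k Rᵐᵒᵖ N]

/-- `k` acts centrally on the matrices as soon as it acts centrally on the bimodule. -/
instance : Algebra k (LowerTriangular R N S) :=
  Algebra.ofModule
    (fun c x y => by
      ext
      · simp
      · simp [smul_comm c (MulOpposite.op y.fst) x.corner]
      · simp)
    (fun c x y => by
      ext
      · simp
      · simp [smul_comm c x.snd y.corner]
      · simp)

end Algebra

end LowerTriangular

/-! ### The local algebra `Λ` and the modules `M(α)` -/

section Example

variable (k : Type u) [Field k]

/-- The generator `x` of the free algebra `k⟨x, y, z⟩`. -/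
abbrev genX : FreeAlgebra k (Fin 3) := FreeAlgebra.ι k 0
/-- The generator `y` of the free algebra. -/
abbrev genY : FreeAlgebra k (Fin 3) := FreeAlgebra.ι k 1
/-- The generator `z` of the free algebra. -/
abbrev genZ : FreeAlgebra k (Fin 3) := FreeAlgebra.ι k 2

/-- The defining relations
`x², y², z², yz, xy + q yx, xz - zx, zy - zx` of `Λ`. -/
inductive LambdaRel (q : k) : FreeAlgebra k (Fin 3) → FreeAlgebra k (Fin 3) → Prop
  | xx : LambdaRel q (genX k * genX k) 0
  | yy : LambdaRel q (genY k * genY k) 0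
  | zz : LambdaRel q (genZ k * genZ k) 0
  | yz : LambdaRel q (genY k * genZ k) 0
  | xy : LambdaRel q (genX k * genY k + q • (genY k * genX k)) 0
  | xz : LambdaRel q (genX k * genZ k - genZ k * genX k) 0
  | zy : LambdaRel q (genZ k * genY k - genZ k * genX k) 0

/-- `Λ = k⟨x, y, z⟩ / (x², y², z², yz, xy + q yx, xz - zx, zy - zx)`. -/
abbrev Lambda (q : k) : Type u := RingQuot (LambdaRel k q)

/-- The underlying vector space of `M(α)`, with basis `v = e₀`, `v' = e₁`, `v'' = e₂`. -/
def ModM (_α : k) : Type u := Fin 3 → k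

variable {k}

noncomputable instance (α : k) : AddCommGroup (ModM k α) :=
  inferInstanceAs (AddCommGroup (Fin 3 → k))
noncomputable instance (α : k) : Module k (ModM k α) :=
  inferInstanceAs (Module k (Fin 3 → k))
instance (α : k) : Module.Finite k (ModM k α) :=
  inferInstanceAs (Module.Finite k (Fin 3 → k))

/-- The action of the generators on `M(α)`: column `j` of a matrix is the image of `e_j`, so
`x v = α v'`, `y v = v'`, `z v = v''`, and all other products of a generator with a basis
vector are zero. -/
def genMatrix (α : k) : Fin 3 → Matrix (Fin 3) (Fin 3) k :=
  ![!![0, 0, 0; α, 0, 0; 0, 0, 0],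
    !![0, 0, 0; 1, 0, 0; 0, 0, 0],
    !![0, 0, 0; 0, 0, 0; 1, 0, 0]]

lemma genMatrix_mul (α : k) (i j : Fin 3) : genMatrix α i * genMatrix α j = 0 := by
  fin_cases i <;> fin_cases j <;> ext a b <;> fin_cases a <;> fin_cases b <;>
    simp [genMatrix, Matrix.mul_apply, Fin.sum_univ_three]

/-- The matrix representation of `Λ` that defines `M(α)`. -/
noncomputable def matRep (q α : k) : Lambda k q →ₐ[k] Matrix (Fin 3) (Fin 3) k :=
  RingQuot.liftAlgHom k
    ⟨FreeAlgebra.lift k (genMatrix α), by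
      intro a b h
      induction h <;>
        simp only [genX, genY, genZ, map_mul, map_add, map_sub, map_smul, map_zero,
          FreeAlgebra.lift_ι_apply, genMatrix_mul, smul_zero, add_zero, sub_zero]⟩

/-- The representation of `Λ` on `M(α)`: matrices act on column vectors. -/
noncomputable def rep (q α : k) : Lambda k q →ₐ[k] Module.End k (ModM k α) :=
  AlgHom.comp (Matrix.toLinAlgEquiv' : Matrix (Fin 3) (Fin 3) k ≃ₐ[k] _).toAlgHom (matRep q α)

/-- The left `Λ`-module structure of `M(α)`. -/
noncomputable instance (q α : k) : Module (Lambda k q) (ModM k α) :=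
  Module.compHom (ModM k α) (rep q α).toRingHom

lemma lambda_smul_def (q α : k) (a : Lambda k q) (m : ModM k α) : a • m = rep q α a m := rfl

instance (q α : k) : IsScalarTower k (Lambda k q) (ModM k α) where
  smul_assoc c a m := by simp [lambda_smul_def]

/-- The right `k`-action on `M(α)`, which agrees with the left one. -/
noncomputable instance (α : k) : Module kᵐᵒᵖ (ModM k α) :=
  inferInstanceAs (Module kᵐᵒᵖ (Fin 3 → k))

lemma op_smul_modM (α : k) (c : k) (m : ModM k α) : MulOpposite.op c • m = c • m :=
  op_smul_eq_smul c (show Fin 3 → k from m)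

instance (q α : k) : SMulCommClass (Lambda k q) kᵐᵒᵖ (ModM k α) where
  smul_comm a c m := by
    induction c using MulOpposite.rec' with
    | _ c => simp [op_smul_modM, lambda_smul_def]

instance (α : k) : IsScalarTower k kᵐᵒᵖ (ModM k α) where
  smul_assoc c d m := by
    induction d using MulOpposite.rec' with
    | _ d => rw [← MulOpposite.op_smul, op_smul_modM, op_smul_modM, smul_assoc]

variable (k) in
/-- The vector space dual `D(M(α)) = Hom_k(M(α), k)`. -/
def DualM (α : k) : Type u := Module.Dual k (ModM k α)

noncomputable instance (α : k) : AddCommGroup (DualM k α) :=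
  inferInstanceAs (AddCommGroup (Module.Dual k (ModM k α)))
noncomputable instance (α : k) : Module k (DualM k α) :=
  inferInstanceAs (Module k (Module.Dual k (ModM k α)))
instance (α : k) : Module.Finite k (DualM k α) :=
  inferInstanceAs (Module.Finite k (Module.Dual k (ModM k α)))
instance (α : k) : FunLike (DualM k α) (ModM k α) k :=
  inferInstanceAs (FunLike (ModM k α →ₗ[k] k) (ModM k α) k)

/-- The right `Λ`-module structure of `D(M(α))`: `(f · a)(m) = f (a m)`. -/
noncomputable instance (q α : k) : Module (Lambda k q)ᵐᵒᵖ (DualM k α) where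
  smul a f := LinearMap.comp (f : ModM k α →ₗ[k] k) (rep q α a.unop)
  one_smul f := by
    change LinearMap.comp _ _ = _
    rw [MulOpposite.unop_one, map_one]; rfl
  mul_smul a b f := by
    change LinearMap.comp _ _ = LinearMap.comp (LinearMap.comp _ _) _
    rw [MulOpposite.unop_mul, map_mul]; rfl
  smul_zero a := LinearMap.zero_comp _
  smul_add a f g := LinearMap.add_comp _ _ _
  add_smul a b f := by
    change LinearMap.comp _ _ = LinearMap.comp _ _ + LinearMap.comp _ _
    rw [MulOpposite.unop_add, map_add]; exact LinearMap.comp_add _ _ _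
  zero_smul f := by
    change LinearMap.comp _ _ = _
    rw [MulOpposite.unop_zero, map_zero]; exact LinearMap.comp_zero _

lemma op_smul_dualM_apply (q α : k) (a : Lambda k q) (f : DualM k α) (m : ModM k α) :
    (MulOpposite.op a • f) m = f (a • m) := rfl

lemma smul_dualM_apply (α : k) (c : k) (f : DualM k α) (m : ModM k α) :
    (c • f) m = c * f m := rfl

lemma dualM_ext {α : k} {f g : DualM k α} (h : ∀ m, f m = g m) : f = g :=
  LinearMap.ext h

instance (q α : k) : SMulCommClass k (Lambda k q)ᵐᵒᵖ (DualM k α) where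
  smul_comm _ _ _ := rfl

instance (q α : k) : IsScalarTower k (Lambda k q)ᵐᵒᵖ (DualM k α) where
  smul_assoc c a f := by
    induction a using MulOpposite.rec' with
    | _ a =>
      refine dualM_ext fun m => ?_
      rw [← MulOpposite.op_smul, op_smul_dualM_apply, smul_dualM_apply, op_smul_dualM_apply,
        smul_assoc]
      exact LinearMap.map_smul (f : ModM k α →ₗ[k] k) c (a • m)

variable (k) in
/-- The one-point extension `B`: lower triangular matrices with rows `(k, 0)`, `(M(q), Λ)`. -/
abbrev AlgB (q : k) : Type u := LowerTriangular k (ModM k q) (Lambda k q)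

variable (k) in
/-- The one-point coextension `C`: lower triangular matrices with rows `(Λ, 0)`,
`(D(M(q)), k)`. -/
abbrev AlgC (q : k) : Type u := LowerTriangular (Lambda k q) (DualM k q) k

end Example

/-! ### Derived equivalence -/

section Derived

/-- A choice of model of the derived category of all left `A`-modules. -/
noncomputable instance (A : Type u) [Ring A] : HasDerivedCategory.{u + 1} (ModuleCat.{u} A) :=
  HasDerivedCategory.standard _

/-- `A` and `A'` are derived equivalent: there is a triangulated equivalence between the
bounded derived categories of all left modules. -/
def DerivedEquivalent (A A' : Type u) [Ring A] [Ring A'] : Prop :=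
  ∃ (F : DerivedCategory.Bounded (ModuleCat.{u} A) ⥤
      DerivedCategory.Bounded (ModuleCat.{u} A'))
    (_ : F.CommShift ℤ), F.IsTriangulated ∧ F.IsEquivalence

end Derived

/-! ### Syzygies, the stable category and delooping levels -/

section Delooping

variable {A : Type u} [Ring A]

/-- `π : P → M` is a projective cover in the category of finitely generated modules: `P` is
finitely generated projective, `π` is onto and its kernel is superfluous in `P`. -/
def IsProjectiveCover {P M : Type u} [AddCommGroup P] [Module A P] [AddCommGroup M] [Module A M]
    (π : P →ₗ[A] M) : Prop :=
  Module.Finite A P ∧ Module.Projective A P ∧ Function.Surjective π ∧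
    ∀ U : Submodule A P, U ⊔ LinearMap.ker π = ⊤ → U = ⊤

/-- `K` is isomorphic to `Ω_A(M)`, the kernel of a projective cover of `M`. -/
def IsSyzygy (M K : ModuleCat.{u} A) : Prop :=
  ∃ (P : ModuleCat.{u} A) (π : P →ₗ[A] M),
    IsProjectiveCover π ∧ Nonempty (K ≃ₗ[A] LinearMap.ker π)

/-- `K` is isomorphic to `Ω_A^n(M)`, where `Ω^0(M) = M` and `Ω^(n+1)(M) = Ω(Ω^n(M))`. -/
def IsNthSyzygy : ℕ → ModuleCat.{u} A → ModuleCat.{u} A → Prop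
  | 0, M, K => Nonempty (K ≃ₗ[A] M)
  | n + 1, M, K => ∃ L : ModuleCat.{u} A, IsNthSyzygy n M L ∧ IsSyzygy L K

/-- `f` factors through a finitely generated projective module, i.e. it is zero in the stable
module category. -/
def FactorsThroughProjective {X Y : Type u} [AddCommGroup X] [Module A X]
    [AddCommGroup Y] [Module A Y] (f : X →ₗ[A] Y) : Prop :=
  ∃ (P : ModuleCat.{u} A) (g : X →ₗ[A] P) (h : P →ₗ[A] Y),
    Module.Finite A P ∧ Module.Projective A P ∧ f = h ∘ₗ g

/-- `X` and `Y` are isomorphic in the stable module category: there are maps in both directions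
whose composites are the identities modulo maps that factor through projectives. -/
def StablyIsomorphic (A : Type u) [Ring A] (X Y : Type u) [AddCommGroup X] [Module A X]
    [AddCommGroup Y] [Module A Y] : Prop :=
  ∃ (f : X →ₗ[A] Y) (g : Y →ₗ[A] X),
    FactorsThroughProjective (g ∘ₗ f - LinearMap.id) ∧
    FactorsThroughProjective (f ∘ₗ g - LinearMap.id)

/-- `X` is a direct summand of `Y` in the stable category of finitely generated modules. -/
def IsStableSummand (X Y : ModuleCat.{u} A) : Prop :=
  ∃ Z : ModuleCat.{u} A, Module.Finite A Z ∧ StablyIsomorphic A (X × Z) Y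

/-- `Ω^n(M)` is a direct summand of `Ω^(n+1)(N)` in the stable category, for some finitely
generated `N`. -/
def IsDeloopable (n : ℕ) (M : ModuleCat.{u} A) : Prop :=
  ∃ N X Y : ModuleCat.{u} A, Module.Finite A N ∧
    IsNthSyzygy n M X ∧ IsNthSyzygy (n + 1) N Y ∧ IsStableSummand X Y

/-- The delooping level of a finitely generated module (over a ring whose finitely generated
modules have projective covers, such as a finite-dimensional algebra). -/
noncomputable def delModule (M : ModuleCat.{u} A) : ℕ∞ :=
  ⨅ (n : ℕ) (_ : IsDeloopable n M), (n : ℕ∞)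

/-- The sub-derived delooping level of a finitely generated module. -/
noncomputable def sddelModule (M : ModuleCat.{u} A) : ℕ∞ :=
  ⨅ (N : ModuleCat.{u} A) (_ : Module.Finite A N)
    (_ : ∃ f : M →ₗ[A] N, Function.Injective f), delModule N

variable (A)

/-- The delooping level of a ring: the supremum over its simple left modules. -/
noncomputable def del : ℕ∞ :=
  ⨆ (S : ModuleCat.{u} A) (_ : IsSimpleModule A S), delModule S

/-- The sub-derived delooping level of a ring. -/
noncomputable def sddel : ℕ∞ :=
  ⨆ (S : ModuleCat.{u} A) (_ : IsSimpleModule A S), sddelModule S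

end Delooping

end DeloopingLevel

/-! Derived equivalence. A left `B`-module is a triple (V, X, M ⊗ V → X) with V a vector space and X
a Λ-module, and a left `C`-module is a triple (Y, U, Y → M ⊗ U). Send (V, X) to the two-term complex
(M ⊗ V, V) → (X, 0) of `C`-modules, and (Y, U) to the two-term complex (0, Y) → (U, M ⊗ U) of
`B`-modules. All four terms are exact functors, so totalizing preserves exactness; it also commutes
with mapping cones, hence passes to derived categories with no resolutions. Both composites are the
shift by 1, because of the natural exact sequences 0 → (0, M ⊗ V) → (0, X) ⊕ (V, M ⊗ V) → (V, X) → 0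
and 0 → (Y, U) → (M ⊗ U, U) ⊕ (Y, 0) → (M ⊗ U, 0) → 0. These are `tiltCokernel` and `tiltKernel`,
and `derivedEquivalent_of_presentations` turns them into an equivalence. No condition on q enters
here.

The algebra `C`. One simple module is the projective C e₂. The other is the left ideal spanned by yx
∈ Λ: it is simple since yx lies in the socle of Λ and annihilates M, so that DM · yx = 0. It squares
to zero, hence is superfluous in C and is the syzygy of its cokernel. So both simples have delooping
level 0 (`del_algC`), and sddel ≤ del.

The algebra `B`. Let S be the simple module at the vertex of k, and let N be any module containing
S. Put aₙ = x - qⁿy. In Λ one has aₙ₊₁aₙ = 0, the right annihilator of aₙ₊₁ is aₙΛ, and zaₙ = (1 -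
qⁿ)xz. The obstruction is the property `HasLift` n of W: aₙw = 0 implies zw ∈ xW. Call a module
lower if e₁ annihilates it; every syzygy is lower, and lower modules are Λ-modules. The syzygy of a
lower module has `HasLift` 1, since a₁w = 0 forces w ∈ a₀P and za₀ = 0; passing to a further syzygy
raises the index by one. Hence every Ωⁿ⁺²(N') has `HasLift` (n + 1) (`hasLift_of_isNthSyzygy`). On
the other hand Ω(N) contains a copy of the generator v of M(q), with a₁v = 0 and zv = v'' outside
the image of x, so `HasLift` 1 fails; since qⁿ ≠ 1, failure at n for a lower module gives failure at
n + 1 for its syzygy (`not_hasLift_of_isNthSyzygy`). The property is inherited by stable summands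
among the modules that occur, so Ωⁿ⁺¹(N) is not a stable summand of any Ωⁿ⁺²(N'); level 0 is
excluded directly by S (`not_isDeloopable`). As N was arbitrary, sddel is infinite, and with it del.
-/

namespace DeloopingLevel

/-! ### Total complexes of a natural transformation between additive functors -/

noncomputable section TwoTerm

variable {R S : Type u} [Ring R] [Ring S] {F₀ F₁ : ModuleCat.{u} R ⥤ ModuleCat.{u} S}

/-- The differential of the total complex of `η : F₀ K ⟶ F₁ K`. The sign in front of `η` makes
the construction commute with shifts without further signs. -/
def twoTermD (η : F₀ ⟶ F₁) (K : CochainComplex (ModuleCat.{u} R) ℤ) (i j : ℤ) :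
    ModuleCat.of S (F₀.obj (K.X (i + 1)) × F₁.obj (K.X i)) ⟶
      ModuleCat.of S (F₀.obj (K.X (j + 1)) × F₁.obj (K.X j)) :=
  if h : i + 1 = j then
    ModuleCat.ofHom (LinearMap.prod ((F₀.map (K.d (i + 1) (j + 1))).hom ∘ₗ LinearMap.fst _ _ _)
      ((F₁.map (K.d i j)).hom ∘ₗ LinearMap.snd _ _ _ +
        i.negOnePow • ((F₁.map (K.XIsoOfEq h).hom).hom ∘ₗ (η.app _).hom ∘ₗ LinearMap.fst _ _ _)))
  else 0

lemma twoTermD_apply (η : F₀ ⟶ F₁) (K : CochainComplex (ModuleCat.{u} R) ℤ) {i j : ℤ}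
    (h : i + 1 = j) (a : F₀.obj (K.X (i + 1))) (b : F₁.obj (K.X i)) :
    twoTermD η K i j (a, b) = (F₀.map (K.d (i + 1) (j + 1)) a,
      F₁.map (K.d i j) b + i.negOnePow • F₁.map (K.XIsoOfEq h).hom (η.app _ a)) := by
  rw [twoTermD, dif_pos h]; rfl

lemma map_comp_apply' (F : ModuleCat.{u} R ⥤ ModuleCat.{u} S) {X Y Z : ModuleCat.{u} R}
    (f : X ⟶ Y) (g : Y ⟶ Z) (x : F.obj X) : F.map g (F.map f x) = F.map (f ≫ g) x := by
  rw [F.map_comp]; rfl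

lemma map_id_apply' (F : ModuleCat.{u} R ⥤ ModuleCat.{u} S) {X : ModuleCat.{u} R}
    (x : F.obj X) : F.map (𝟙 X) x = x := by
  rw [F.map_id]; rfl

lemma map_zero_apply' (F : ModuleCat.{u} R ⥤ ModuleCat.{u} S) [F.Additive]
    {X Y : ModuleCat.{u} R} (x : F.obj X) : F.map (0 : X ⟶ Y) x = 0 := by
  rw [F.map_zero]; rfl

lemma nat_apply (η : F₀ ⟶ F₁) {X Y : ModuleCat.{u} R} (f : X ⟶ Y) (x : F₀.obj X) :
    η.app Y (F₀.map f x) = F₁.map f (η.app X x) :=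
  ConcreteCategory.congr_hom (η.naturality f) x

variable [F₀.Additive] [F₁.Additive]

/-- The total complex of `η : F₀ K ⟶ F₁ K`. -/
def twoTermObj (η : F₀ ⟶ F₁) (K : CochainComplex (ModuleCat.{u} R) ℤ) :
    CochainComplex (ModuleCat.{u} S) ℤ where
  X n := ModuleCat.of S (F₀.obj (K.X (n + 1)) × F₁.obj (K.X n))
  d := twoTermD η K
  shape i j h := dif_neg h
  d_comp_d' := by
    rintro i _ _ rfl rfl
    ext1
    refine LinearMap.ext fun ⟨a, b⟩ => ?_
    change twoTermD η K _ _ (twoTermD η K _ _ (a, b)) = 0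
    rw [twoTermD_apply η K rfl, twoTermD_apply η K rfl]
    simp only [map_comp_apply', nat_apply, map_add, HomologicalComplex.XIsoOfEq_rfl, Iso.refl_hom,
      F₁.map_id, ModuleCat.id_apply, HomologicalComplex.d_comp_d, map_zero_apply', Int.negOnePow_succ]
    -- What survives are two copies of F₁(d) ∘ η, carrying the opposite signs of consecutive
    -- degrees.
    refine Prod.ext rfl ?_
    change 0 + F₁.map _ (i.negOnePow • _) + _ = 0
    rw [Units.smul_def, map_zsmul, Units.smul_def]
    simp

lemma twoTermObj_d_apply (η : F₀ ⟶ F₁) (K : CochainComplex (ModuleCat.{u} R) ℤ) {i j : ℤ}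
    (h : i + 1 = j) (a : F₀.obj (K.X (i + 1))) (b : F₁.obj (K.X i)) :
    (twoTermObj η K).d i j (a, b) = (F₀.map (K.d (i + 1) (j + 1)) a,
      F₁.map (K.d i j) b + i.negOnePow • F₁.map (K.XIsoOfEq h).hom (η.app _ a)) :=
  twoTermD_apply η K h a b

/-- The functor on cochain complexes sending `K` to the total complex of `η : F₀ K ⟶ F₁ K`. -/
def twoTerm (η : F₀ ⟶ F₁) :
    CochainComplex (ModuleCat.{u} R) ℤ ⥤ CochainComplex (ModuleCat.{u} S) ℤ where
  obj := twoTermObj η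
  map {K L} f :=
    { f n := ModuleCat.ofHom ((F₀.map (f.f (n + 1))).hom.prodMap (F₁.map (f.f n)).hom)
      comm' := by
        rintro i _ rfl
        ext1
        refine LinearMap.ext fun ⟨a, b⟩ => ?_
        change (twoTermObj η L).d _ _ (F₀.map (f.f (i + 1)) a, F₁.map (f.f i) b) =
          Prod.map (F₀.map _) (F₁.map _) ((twoTermObj η K).d _ _ (a, b))
        rw [twoTermObj_d_apply η K rfl, twoTermObj_d_apply η L rfl]
        simp only [map_comp_apply', nat_apply, map_add, Prod.map, Units.smul_def, map_zsmul,
          HomologicalComplex.XIsoOfEq_rfl, Iso.refl_hom, Category.comp_id, Category.id_comp,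
          HomologicalComplex.Hom.comm]
        rfl }
  map_id K := by
    ext n : 2
    refine LinearMap.ext fun ⟨a, b⟩ => ?_
    change (F₀.map (𝟙 _) a, F₁.map (𝟙 _) b) = (a, b)
    rw [F₀.map_id, F₁.map_id]; rfl
  map_comp f g := by
    ext n : 2
    refine LinearMap.ext fun ⟨a, b⟩ => ?_
    change (F₀.map (_ ≫ _) a, F₁.map (_ ≫ _) b) = _
    rw [F₀.map_comp, F₁.map_comp]; rfl

lemma twoTerm_d_apply (η : F₀ ⟶ F₁) (K : CochainComplex (ModuleCat.{u} R) ℤ) {i j : ℤ}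
    (h : i + 1 = j) (a : F₀.obj (K.X (i + 1))) (b : F₁.obj (K.X i)) :
    ((twoTerm η).obj K).d i j (a, b) = (F₀.map (K.d (i + 1) (j + 1)) a,
      F₁.map (K.d i j) b + i.negOnePow • F₁.map (K.XIsoOfEq h).hom (η.app _ a)) :=
  twoTermD_apply η K h a b

end TwoTerm

/-! ### Compatibility of total complexes with shifts and mapping cones -/

noncomputable section TwoTermShift

variable {R S : Type u} [Ring R] [Ring S] {F₀ F₁ : ModuleCat.{u} R ⥤ ModuleCat.{u} S}
  [F₀.Additive] [F₁.Additive] (η : F₀ ⟶ F₁)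

lemma map_smul_apply' (F : ModuleCat.{u} R ⥤ ModuleCat.{u} S) [F.Additive] {X Y : ModuleCat.{u} R}
    (n : ℤˣ) (f : X ⟶ Y) (x : F.obj X) : F.map (n • f) x = n • F.map f x := by
  rw [Units.smul_def, F.map_zsmul]; rfl

/-- The component of the shift isomorphism of `twoTerm η`. -/
def twoTermShiftX (K : CochainComplex (ModuleCat.{u} R) ℤ) (a n : ℤ) :
    ((twoTerm η).obj (K⟦a⟧)).X n ≅ (((twoTerm η).obj K)⟦a⟧).X n :=
  LinearEquiv.toModuleIso (LinearEquiv.prodCongr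
    (F₀.mapIso (K.XIsoOfEq (show n + 1 + a = n + a + 1 by ring))).toLinearEquiv
    (LinearEquiv.refl S (F₁.obj (K.X (n + a)))))

lemma twoTerm_XIsoOfEq_apply (K : CochainComplex (ModuleCat.{u} R) ℤ) {m n : ℤ} (h : m = n)
    (x : F₀.obj (K.X (m + 1))) (y : F₁.obj (K.X m)) :
    (((twoTerm η).obj K).XIsoOfEq h).hom (x, y) =
      (F₀.map (K.XIsoOfEq (congrArg (· + 1) h)).hom x, F₁.map (K.XIsoOfEq h).hom y) := by
  subst h
  simp only [HomologicalComplex.XIsoOfEq_rfl, Iso.refl_hom, map_id_apply']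
  try rfl

/-- The shift multiplies the whole differential by (-1)^a, and (-1)^a (-1)^(i + a) = (-1)^i. So the
identifications of degrees alone, without signs, commute with the differentials. -/
lemma twoTermShiftX_hom_comm (K : CochainComplex (ModuleCat.{u} R) ℤ) (a i j : ℤ) (h : i + 1 = j)
    (x : F₀.obj (K.X (i + 1 + a))) (y : F₁.obj (K.X (i + a))) :
    a.negOnePow • (twoTermObj η K).d (i + a) (j + a)
        (F₀.map (K.XIsoOfEq (show i + 1 + a = i + a + 1 by ring)).hom x, y) =
      (F₀.map (K.XIsoOfEq (show j + 1 + a = j + a + 1 by ring)).hom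
        (F₀.map (a.negOnePow • K.d (i + 1 + a) (j + 1 + a)) x),
      F₁.map (a.negOnePow • K.d (i + a) (j + a)) y +
        i.negOnePow • F₁.map (K.XIsoOfEq (show i + 1 + a = j + a by rw [h])).hom
          (η.app (K.X (i + 1 + a)) x)) := by
  rw [twoTermObj_d_apply η K (show i + a + 1 = j + a by rw [← h]; ring)]
  rw [map_smul_apply', map_smul_apply', map_comp_apply', nat_apply, map_comp_apply',
    Int.negOnePow_add]
  refine Prod.ext ?_ ?_
  · change a.negOnePow • F₀.map _ _ = _
    simp only [Units.smul_def, map_zsmul, map_comp_apply',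
      HomologicalComplex.d_comp_XIsoOfEq_hom, HomologicalComplex.XIsoOfEq_hom_comp_d]
  · refine (smul_add a.negOnePow _ _).trans ?_
    rw [smul_smul, HomologicalComplex.XIsoOfEq_hom_comp_XIsoOfEq_hom,
      mul_comm i.negOnePow, ← mul_assoc, Int.units_mul_self, one_mul]

/-- The shift isomorphism of `twoTerm η` at a complex. -/
def twoTermShiftObj (K : CochainComplex (ModuleCat.{u} R) ℤ) (a : ℤ) :
    (twoTerm η).obj (K⟦a⟧) ≅ ((twoTerm η).obj K)⟦a⟧ :=
  HomologicalComplex.Hom.isoOfComponents (twoTermShiftX η K a) (by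
    rintro i _ rfl
    ext1
    refine LinearMap.ext fun (p : F₀.obj (K.X (i + 1 + a)) × F₁.obj (K.X (i + a))) => ?_
    obtain ⟨x, y⟩ := p
    exact (twoTermShiftX_hom_comm η K a i (i + 1) rfl x y).trans
      (congrArg (fun z => (twoTermShiftX η K a (i + 1)).hom z)
        (twoTermObj_d_apply η (K⟦a⟧) (rfl : i + 1 = i + 1) x y)).symm)

lemma twoTermShiftObj_naturality {K L : CochainComplex (ModuleCat.{u} R) ℤ} (f : K ⟶ L) (a n : ℤ)
    (x : F₀.obj (K.X (n + 1 + a))) :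
    F₀.map (L.XIsoOfEq (show n + 1 + a = n + a + 1 by ring)).hom (F₀.map (f.f (n + 1 + a)) x) =
      F₀.map (f.f (n + a + 1)) (F₀.map (K.XIsoOfEq (show n + 1 + a = n + a + 1 by ring)).hom x) := by
  rw [map_comp_apply', map_comp_apply', HomologicalComplex.XIsoOfEq_hom_naturality]

/-- The shift isomorphism of `twoTerm η`. -/
def twoTermShiftIso (a : ℤ) :
    shiftFunctor (CochainComplex (ModuleCat.{u} R) ℤ) a ⋙ twoTerm η ≅
      twoTerm η ⋙ shiftFunctor (CochainComplex (ModuleCat.{u} S) ℤ) a :=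
  NatIso.ofComponents (fun K => twoTermShiftObj η K a) (by
    intro K L f
    ext n : 2
    refine LinearMap.ext fun (p : F₀.obj (K.X (n + 1 + a)) × F₁.obj (K.X (n + a))) => ?_
    exact Prod.ext (twoTermShiftObj_naturality f a n p.1) rfl)

lemma twoTermShift_zero_apply (K : CochainComplex (ModuleCat.{u} R) ℤ) (n : ℤ)
    (x : F₀.obj (K.X (n + 1 + 0))) (y : F₁.obj (K.X (n + 0))) :
    (F₀.map (K.XIsoOfEq (show n + 1 + 0 = n + 0 + 1 by ring)).hom x, y) =
      (((twoTerm η).obj K).XIsoOfEq (show n = n + 0 by ring)).hom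
        (F₀.map (K.XIsoOfEq (show n + 1 + 0 = n + 1 by ring)).hom x,
          F₁.map (K.XIsoOfEq (show n + 0 = n by ring)).hom y) := by
  rw [twoTerm_XIsoOfEq_apply, map_comp_apply', map_comp_apply',
    HomologicalComplex.XIsoOfEq_hom_comp_XIsoOfEq_hom,
    HomologicalComplex.XIsoOfEq_hom_comp_XIsoOfEq_hom]
  simp only [HomologicalComplex.XIsoOfEq_rfl, Iso.refl_hom, map_id_apply']
  try rfl

lemma twoTermShift_add_apply (K : CochainComplex (ModuleCat.{u} R) ℤ) (a b n : ℤ)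
    (x : F₀.obj (K.X (n + 1 + (a + b)))) (y : F₁.obj (K.X (n + (a + b)))) :
    (F₀.map (K.XIsoOfEq (show n + 1 + (a + b) = n + (a + b) + 1 by ring)).hom x, y) =
      (((twoTerm η).obj K).XIsoOfEq (show n + b + a = n + (a + b) by ring)).hom
        (F₀.map (K.XIsoOfEq (show n + b + 1 + a = n + b + a + 1 by ring)).hom
          (F₀.map (K.XIsoOfEq (show n + 1 + b + a = n + b + 1 + a by ring)).hom
          (F₀.map (K.XIsoOfEq (show n + 1 + (a + b) = n + 1 + b + a by ring)).hom x)),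
          F₁.map (K.XIsoOfEq (show n + (a + b) = n + b + a by ring)).hom y) := by
  rw [twoTerm_XIsoOfEq_apply]
  simp only [map_comp_apply', 
    HomologicalComplex.XIsoOfEq_hom_comp_XIsoOfEq_hom, HomologicalComplex.XIsoOfEq_rfl,
    Iso.refl_hom, map_id_apply']
  try rfl

instance : (twoTerm η).CommShift ℤ where
  commShiftIso := twoTermShiftIso η
  commShiftIso_zero := by
    ext K n : 4
    rw [Functor.CommShift.isoZero_hom_app]
    ext1
    refine LinearMap.ext fun (p : F₀.obj (K.X (n + 1 + 0)) × F₁.obj (K.X (n + 0))) => ?_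
    exact twoTermShift_zero_apply η K n p.1 p.2
  commShiftIso_add a b := by
    ext K n : 4
    rw [Functor.CommShift.isoAdd_hom_app]
    ext1
    refine LinearMap.ext fun
      (p : F₀.obj (K.X (n + 1 + (a + b))) × F₁.obj (K.X (n + (a + b)))) => ?_
    exact twoTermShift_add_apply η K a b n p.1 p.2


section Cone

variable {K L : CochainComplex (ModuleCat.{u} R) ℤ} (f : K ⟶ L)

open CochainComplex CochainComplex.HomComplex

lemma map_add_apply' (F : ModuleCat.{u} R ⥤ ModuleCat.{u} S) [F.Additive] {X Y : ModuleCat.{u} R}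
    (f g : X ⟶ Y) (x : F.obj X) : F.map (f + g) x = F.map f x + F.map g x := by
  rw [F.map_add]; rfl

variable (F₀ F₁) in
/-- The product of the images of two morphisms under `F₀` and `F₁`. -/
def prodMap {A A' B B' : ModuleCat.{u} R} (g : A ⟶ A') (h : B ⟶ B') :
    ModuleCat.of S (F₀.obj A × F₁.obj B) ⟶ ModuleCat.of S (F₀.obj A' × F₁.obj B') :=
  ModuleCat.ofHom ((F₀.map g).hom.prodMap (F₁.map h).hom)

lemma prodMap_comp {A A' A'' B B' B'' : ModuleCat.{u} R} (g : A ⟶ A') (g' : A' ⟶ A'')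
    (h : B ⟶ B') (h' : B' ⟶ B'') :
    prodMap F₀ F₁ g h ≫ prodMap F₀ F₁ g' h' = prodMap F₀ F₁ (g ≫ g') (h ≫ h') := by
  ext1
  refine LinearMap.ext fun c => Prod.ext (map_comp_apply' F₀ g g' c.1) (map_comp_apply' F₁ h h' c.2)

lemma prodMap_add {A A' B B' : ModuleCat.{u} R} (g g' : A ⟶ A') (h h' : B ⟶ B') :
    prodMap F₀ F₁ (g + g') (h + h') = prodMap F₀ F₁ g h + prodMap F₀ F₁ g' h' := by
  ext1
  refine LinearMap.ext fun c => Prod.ext (map_add_apply' F₀ g g' c.1) (map_add_apply' F₁ h h' c.2)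

lemma prodMap_id (A B : ModuleCat.{u} R) : prodMap F₀ F₁ (𝟙 A) (𝟙 B) = 𝟙 _ := by
  ext1
  refine LinearMap.ext fun c => Prod.ext (map_id_apply' F₀ c.1) (map_id_apply' F₁ c.2)

lemma prodMap_zero (A A' B B' : ModuleCat.{u} R) :
    prodMap F₀ F₁ (0 : A ⟶ A') (0 : B ⟶ B') = 0 := by
  ext1
  refine LinearMap.ext fun c => Prod.ext (map_zero_apply' F₀ c.1) (map_zero_apply' F₁ c.2)

/-- The product of two morphisms, in the degrees of complexes in the image of `twoTerm η`. -/
def twoTermMap {K L : CochainComplex (ModuleCat.{u} R) ℤ} {m n : ℤ}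
    (g : K.X (m + 1) ⟶ L.X (n + 1)) (h : K.X m ⟶ L.X n) :
    ((twoTerm η).obj K).X m ⟶ ((twoTerm η).obj L).X n := prodMap F₀ F₁ g h

lemma twoTermMap_comp {K L N : CochainComplex (ModuleCat.{u} R) ℤ} {l m n : ℤ}
    (g : K.X (l + 1) ⟶ L.X (m + 1)) (h : K.X l ⟶ L.X m)
    (g' : L.X (m + 1) ⟶ N.X (n + 1)) (h' : L.X m ⟶ N.X n) :
    twoTermMap η g h ≫ twoTermMap η g' h' = twoTermMap η (g ≫ g') (h ≫ h') :=
  prodMap_comp g g' h h'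

lemma twoTermMap_add {K L : CochainComplex (ModuleCat.{u} R) ℤ} {m n : ℤ}
    (g g' : K.X (m + 1) ⟶ L.X (n + 1)) (h h' : K.X m ⟶ L.X n) :
    twoTermMap η (g + g') (h + h') = twoTermMap η g h + twoTermMap η g' h' :=
  prodMap_add g g' h h'

lemma twoTermMap_id (K : CochainComplex (ModuleCat.{u} R) ℤ) (m : ℤ) :
    twoTermMap η (𝟙 (K.X (m + 1))) (𝟙 (K.X m)) = 𝟙 _ := prodMap_id _ _

lemma twoTermMap_zero (K L : CochainComplex (ModuleCat.{u} R) ℤ) (m n : ℤ) :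
    twoTermMap η (0 : K.X (m + 1) ⟶ L.X (n + 1)) (0 : K.X m ⟶ L.X n) = 0 := prodMap_zero _ _ _ _

lemma twoTerm_map_f {K L : CochainComplex (ModuleCat.{u} R) ℤ} (f : K ⟶ L) (n : ℤ) :
    ((twoTerm η).map f).f n = twoTermMap η (f.f (n + 1)) (f.f n) := rfl

/-- The image under `twoTerm η` of the left inclusion in a mapping cone. -/
def twoTermInl :
    Cochain ((twoTerm η).obj K) ((twoTerm η).obj (mappingCone f)) (-1) :=
  Cochain.mk fun p q hpq => twoTermMap η ((mappingCone.inl f).v (p + 1) (q + 1) (by lia))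
      ((mappingCone.inl f).v p q hpq)

lemma twoTermInl_v_apply (p q : ℤ) (hpq : p + -1 = q)
    (a : F₀.obj (K.X (p + 1))) (b : F₁.obj (K.X p)) :
    (twoTermInl η f).v p q hpq (a, b) =
      (F₀.map ((mappingCone.inl f).v (p + 1) (q + 1) (by lia)) a,
        F₁.map ((mappingCone.inl f).v p q hpq) b) := rfl

lemma inl_v_XIsoOfEq (p q p' q' : ℤ) (hpq : p + -1 = q) (hp : p = p') (hq : q = q') :
    (mappingCone.inl f).v p q hpq ≫ ((mappingCone f).XIsoOfEq hq).hom =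
      (K.XIsoOfEq hp).hom ≫ (mappingCone.inl f).v p' q' (by lia) := by
  subst hp hq
  simp

/-- This is the compatibility required by `mappingCone.desc`. Componentwise it is the corresponding
identity for the cone of `f`, except for two terms involving η. -/
lemma δ_twoTermInl : δ (-1) 0 (twoTermInl η f) =
    Cochain.ofHom ((twoTerm η).map f ≫ (twoTerm η).map (mappingCone.inr f)) := by
  ext p : 1
  rw [δ_v (-1) 0 (by lia) _ p p (by lia) (p - 1) (p + 1) rfl rfl, Cochain.ofHom_v,
    Int.negOnePow_zero, one_smul]
  ext1
  refine LinearMap.ext fun (c : F₀.obj (K.X (p + 1)) × F₁.obj (K.X p)) => ?_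
  obtain ⟨a, b⟩ := c
  change ((twoTerm η).obj (mappingCone f)).d (p - 1) p ((twoTermInl η f).v p (p - 1) _ (a, b)) +
    (twoTermInl η f).v (p + 1) p _ (((twoTerm η).obj K).d p (p + 1) (a, b)) =
      (F₀.map ((mappingCone.inr f).f (p + 1)) (F₀.map (f.f (p + 1)) a),
        F₁.map ((mappingCone.inr f).f p) (F₁.map (f.f p) b))
  rw [twoTermInl_v_apply, twoTerm_d_apply _ _ (by lia), twoTerm_d_apply _ _ rfl,
    twoTermInl_v_apply]
  refine Prod.ext ?_ ?_
  · change F₀.map _ (F₀.map _ a) + F₀.map _ (F₀.map _ a) = _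
    rw [map_comp_apply', map_comp_apply', map_comp_apply', ← map_add_apply',
      mappingCone.inl_v_d f (p + 1) (p - 1 + 1) (p + 1 + 1) (by lia) (by lia)]
    simp
  · change F₁.map _ (F₁.map _ b) + _ • F₁.map _ (η.app _ (F₀.map _ a)) +
      F₁.map _ (F₁.map _ b + _ • F₁.map _ (η.app _ a)) = _
    rw [nat_apply, map_comp_apply', map_comp_apply', map_comp_apply', map_add,
      Units.smul_def p.negOnePow, map_zsmul, map_comp_apply', map_comp_apply',
      inl_v_XIsoOfEq f _ _ (p + 1) p _ rfl (by lia)]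
    simp only [HomologicalComplex.XIsoOfEq_rfl, Iso.refl_hom, Category.id_comp]
    -- The η-terms come from the differentials in degrees p - 1 and p, so their signs are opposite
    -- and they cancel.
    rw [show p.negOnePow = - (p - 1).negOnePow by
      rw [← Int.negOnePow_succ]; congr 1; lia, Units.val_neg, neg_smul, Units.smul_def,
      add_assoc, add_add_neg_cancel'_right]
    rw [← map_add_apply', mappingCone.inl_v_d f p (p - 1) (p + 1) (by lia) (by lia)]
    simp

/-- The comparison of the mapping cone of `twoTerm η` of a morphism with `twoTerm η` of
its mapping cone. -/
def twoTermCone : mappingCone ((twoTerm η).map f) ⟶ (twoTerm η).obj (mappingCone f) :=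
  mappingCone.desc _ (twoTermInl η f) ((twoTerm η).map (mappingCone.inr f)) (δ_twoTermInl η f)

lemma inl_v_twoTermCone_f (p q : ℤ) (hpq : p + -1 = q) :
    (mappingCone.inl ((twoTerm η).map f)).v p q hpq ≫ (twoTermCone η f).f q =
      twoTermMap η ((mappingCone.inl f).v (p + 1) (q + 1) (by lia))
        ((mappingCone.inl f).v p q hpq) :=
  mappingCone.inl_v_desc_f _ _ _ _ _ _ hpq

lemma inr_f_twoTermCone_f (p : ℤ) :
    (mappingCone.inr ((twoTerm η).map f)).f p ≫ (twoTermCone η f).f p =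
      twoTermMap η ((mappingCone.inr f).f (p + 1)) ((mappingCone.inr f).f p) :=
  mappingCone.inr_f_desc_f _ _ _ _ _

/-- The inverse of `twoTermCone` in a given degree. -/
def twoTermConeInv (p q : ℤ) (hpq : p + 1 = q) :
    ((twoTerm η).obj (mappingCone f)).X p ⟶ (mappingCone ((twoTerm η).map f)).X p :=
  twoTermMap η ((mappingCone.fst f).1.v (p + 1) (q + 1) (by lia)) ((mappingCone.fst f).1.v p q hpq) ≫
      (mappingCone.inl ((twoTerm η).map f)).v q p (by lia) +
    twoTermMap η ((mappingCone.snd f).v (p + 1) (p + 1) (by lia))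
      ((mappingCone.snd f).v p p (by lia)) ≫ (mappingCone.inr ((twoTerm η).map f)).f p

lemma twoTermConeInv_comp (p q : ℤ) (hpq : p + 1 = q) :
    twoTermConeInv η f p q hpq ≫ (twoTermCone η f).f p = 𝟙 _ := by
  unfold twoTermConeInv
  rw [Preadditive.add_comp, Category.assoc, Category.assoc, inl_v_twoTermCone_f,
    inr_f_twoTermCone_f]
  rw [twoTermMap_comp, twoTermMap_comp, ← twoTermMap_add, mappingCone.id_X, mappingCone.id_X,
    twoTermMap_id]

lemma twoTermCone_f_comp (p q : ℤ) (hpq : p + 1 = q) :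
    (twoTermCone η f).f p ≫ twoTermConeInv η f p q hpq = 𝟙 _ := by
  apply mappingCone.ext_from _ q p hpq
  · rw [← Category.assoc, inl_v_twoTermCone_f, Category.comp_id]
    unfold twoTermConeInv
    rw [Preadditive.comp_add, ← Category.assoc, ← Category.assoc, twoTermMap_comp,
      twoTermMap_comp, mappingCone.inl_v_fst_v, mappingCone.inl_v_fst_v, mappingCone.inl_v_snd_v,
      mappingCone.inl_v_snd_v, twoTermMap_zero, twoTermMap_id, Limits.zero_comp, add_zero,
      Category.id_comp]
  · rw [← Category.assoc, inr_f_twoTermCone_f, Category.comp_id]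
    unfold twoTermConeInv
    rw [Preadditive.comp_add, ← Category.assoc, ← Category.assoc, twoTermMap_comp,
      twoTermMap_comp, mappingCone.inr_f_fst_v, mappingCone.inr_f_fst_v, mappingCone.inr_f_snd_v,
      mappingCone.inr_f_snd_v, twoTermMap_zero, twoTermMap_id, Limits.zero_comp, zero_add,
      Category.id_comp]

instance : IsIso (twoTermCone η f) := by
  have : ∀ n, IsIso ((twoTermCone η f).f n) := fun n =>
    ⟨twoTermConeInv η f n _ rfl, twoTermCone_f_comp η f n _ rfl, twoTermConeInv_comp η f n _ rfl⟩
  exact HomologicalComplex.Hom.isIso_of_components _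

lemma twoTermMap_comp_shift_one (K : CochainComplex (ModuleCat.{u} R) ℤ) (n : ℤ) :
    twoTermMap η (K := K) (L := K⟦(1 : ℤ)⟧) (m := n + 1) (n := n)
      (-(K.XIsoOfEq (rfl : n + 1 + 1 = n + 1 + 1)).inv) (-(K.XIsoOfEq (rfl : n + 1 = n + 1)).inv) ≫
      (((twoTerm η).commShiftIso (1 : ℤ)).hom.app K).f n =
    -(((twoTerm η).obj K).XIsoOfEq (rfl : n + 1 = n + 1)).inv := by
  ext1
  refine LinearMap.ext fun (c : F₀.obj (K.X (n + 1 + 1)) × F₁.obj (K.X (n + 1))) => ?_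
  refine Prod.ext ?_ ?_
  · change F₀.map (𝟙 (K.X (n + 1 + 1))) (F₀.map (-𝟙 (K.X (n + 1 + 1))) c.1) = -c.1
    rw [F₀.map_neg, map_id_apply']
    exact congrArg Neg.neg (map_id_apply' F₀ c.1)
  · change F₁.map (-𝟙 (K.X (n + 1))) c.2 = -c.2
    rw [F₁.map_neg]
    exact congrArg Neg.neg (map_id_apply' F₁ c.2)

/-- The comparison of mapping cones as an isomorphism. -/
def twoTermConeIso : mappingCone ((twoTerm η).map f) ≅ (twoTerm η).obj (mappingCone f) :=
  asIso (twoTermCone η f)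

/-- A map out of a cone is determined by its restrictions along `inl` and `inr`. The connecting maps
therefore stay abstract, and only these restrictions are assumed. -/
lemma twoTermCone_comp_eq (δ : mappingCone f ⟶ K⟦(1 : ℤ)⟧)
    (δ' : mappingCone ((twoTerm η).map f) ⟶ ((twoTerm η).obj K)⟦(1 : ℤ)⟧)
    (h₁ : ∀ n, (mappingCone.inl f).v (n + 1) n (by lia) ≫ δ.f n =
      -(K.XIsoOfEq (rfl : n + 1 = n + 1)).inv)
    (h₂ : ∀ n, (mappingCone.inr f).f n ≫ δ.f n = 0)
    (h₁' : ∀ n, (mappingCone.inl ((twoTerm η).map f)).v (n + 1) n (by lia) ≫ δ'.f n =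
      -(((twoTerm η).obj K).XIsoOfEq (rfl : n + 1 = n + 1)).inv)
    (h₂' : ∀ n, (mappingCone.inr ((twoTerm η).map f)).f n ≫ δ'.f n = 0) :
    twoTermCone η f ≫ (twoTerm η).map δ ≫ ((twoTerm η).commShiftIso (1 : ℤ)).hom.app K = δ' := by
  ext n : 1
  apply mappingCone.ext_from _ (n + 1) n rfl
  · rw [HomologicalComplex.comp_f, ← Category.assoc, inl_v_twoTermCone_f,
      HomologicalComplex.comp_f, ← Category.assoc, twoTerm_map_f, twoTermMap_comp, h₁, h₁', h₁]
    exact twoTermMap_comp_shift_one η K n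
  · rw [HomologicalComplex.comp_f, ← Category.assoc, inr_f_twoTermCone_f,
      HomologicalComplex.comp_f, ← Category.assoc, twoTerm_map_f, twoTermMap_comp, h₂, h₂', h₂,
      twoTermMap_zero, Limits.zero_comp]

lemma twoTermCone_mor₃ : twoTermCone η f ≫ (twoTerm η).map (mappingCone.triangle f).mor₃ ≫
    ((twoTerm η).commShiftIso (1 : ℤ)).hom.app K =
      (mappingCone.triangle ((twoTerm η).map f)).mor₃ :=
  twoTermCone_comp_eq η f (mappingCone.triangle f).mor₃
    (mappingCone.triangle ((twoTerm η).map f)).mor₃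
    (fun n => mappingCone.inl_v_triangle_mor₃_f f (n + 1) n (by lia))
    (fun n => mappingCone.inr_f_triangle_mor₃_f f n)
    (fun n => mappingCone.inl_v_triangle_mor₃_f ((twoTerm η).map f) (n + 1) n (by lia))
    (fun n => mappingCone.inr_f_triangle_mor₃_f ((twoTerm η).map f) n)

lemma inr_twoTermCone : mappingCone.inr ((twoTerm η).map f) ≫ twoTermCone η f =
    (twoTerm η).map (mappingCone.inr f) :=
  mappingCone.inr_desc ((twoTerm η).map f) _ _ (δ_twoTermInl η f)

/-- `twoTerm η` sends the standard triangle of a mapping cone to a standard triangle. -/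
def twoTermTriangleIso : mappingCone.triangle ((twoTerm η).map f) ≅
    (twoTerm η).mapTriangle.obj (mappingCone.triangle f) :=
  Pretriangulated.Triangle.isoMk _ _ (Iso.refl _) (Iso.refl _) (twoTermConeIso η f)
    ((Category.comp_id _).trans (Category.id_comp _).symm)
    ((inr_twoTermCone η f).trans (Category.id_comp _).symm)
    (((congrArg (fun x => (mappingCone.triangle ((twoTerm η).map f)).mor₃ ≫ x)
      (CategoryTheory.Functor.map_id _ _)).trans
        (Category.comp_id _)).trans (twoTermCone_mor₃ η f).symm)

end Cone

end TwoTermShift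

/-! ### Descent to derived categories -/

noncomputable section TwoTermDerived

variable {R S : Type u} [Ring R] [Ring S]

/-- A cochain complex of modules is exact if every cocycle is a coboundary. -/
def IsExactComplex (K : CochainComplex (ModuleCat.{u} R) ℤ) : Prop :=
  ∀ i j k : ℤ, i + 1 = j → j + 1 = k → ∀ x : K.X j, K.d j k x = 0 → ∃ y : K.X i, K.d i j y = x

lemma isExactComplex_iff (K : CochainComplex (ModuleCat.{u} R) ℤ) :
    IsExactComplex K ↔ ∀ n, K.ExactAt n := by
  constructor
  · intro h n
    rw [HomologicalComplex.exactAt_iff' K (n - 1) n (n + 1) (by simp) (by simp),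
      ShortComplex.moduleCat_exact_iff]
    exact h _ _ _ (by lia) rfl
  · rintro h i j k rfl rfl
    have := h (i + 1)
    rw [HomologicalComplex.exactAt_iff' K i (i + 1) (i + 1 + 1) (by simp) (by simp),
      ShortComplex.moduleCat_exact_iff] at this
    exact this

lemma isExactComplex_of_iso {K L : CochainComplex (ModuleCat.{u} R) ℤ} (e : K ≅ L)
    (h : IsExactComplex K) : IsExactComplex L := by
  rw [isExactComplex_iff] at h ⊢
  exact fun n => (h n).of_iso e

open DerivedCategory in
lemma isZero_Q_obj_iff (K : CochainComplex (ModuleCat.{u} R) ℤ) :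
    Limits.IsZero (Q.obj K) ↔ ∀ n, K.ExactAt n := by
  constructor
  · intro h n
    rw [HomologicalComplex.exactAt_iff_isZero_homology]
    exact ((homologyFunctor _ n).map_isZero h).of_iso ((homologyFunctorFactors _ n).app K).symm
  · intro h
    -- On an exact complex even the zero endomorphism is a quasi-isomorphism, so zero is invertible
    -- on `Q.obj K`.
    have : QuasiIso (0 : K ⟶ K) := ⟨fun n => by
      rw [quasiIsoAt_iff_exactAt _ _ (h n)]
      exact h n⟩
    have h' : IsIso (Q.map (0 : K ⟶ K)) := inferInstance
    rw [Q.map_zero] at h'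
    exact (Limits.IsZero.iff_id_eq_zero _).2 ((cancel_mono (0 : Q.obj K ⟶ Q.obj K)).1 (by simp))

-- The cone is the third vertex of a distinguished triangle on `f`; it vanishes in the derived
-- category exactly when `f` becomes invertible there.
open DerivedCategory CochainComplex in
lemma quasiIso_iff_isExactComplex {K L : CochainComplex (ModuleCat.{u} R) ℤ} (f : K ⟶ L) :
    QuasiIso f ↔ IsExactComplex (mappingCone f) := by
  rw [isExactComplex_iff, ← isIso_Q_map_iff_quasiIso]
  have h := Pretriangulated.Triangle.isZero₃_iff_isIso₁ _ (mappingCone_triangle_distinguished f)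
  refine h.symm.trans ?_
  exact isZero_Q_obj_iff (mappingCone f)

/-- A functor between module categories maps exact pairs of linear maps to exact pairs. -/
class MapsExact (F : ModuleCat.{u} R ⥤ ModuleCat.{u} S) : Prop where
  exact : ∀ {X Y Z : ModuleCat.{u} R} (f : X ⟶ Y) (g : Y ⟶ Z), Function.Exact f g →
    Function.Exact (F.map f) (F.map g)

variable {F₀ F₁ : ModuleCat.{u} R ⥤ ModuleCat.{u} S} [F₀.Additive] [F₁.Additive]
  [MapsExact F₀] [MapsExact F₁] (η : F₀ ⟶ F₁)

lemma IsExactComplex.exists_map_d_eq (F : ModuleCat.{u} R ⥤ ModuleCat.{u} S) [F.Additive] [MapsExact F]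
    {K : CochainComplex (ModuleCat.{u} R) ℤ} (h : IsExactComplex K) {i j k : ℤ}
    (hij : i + 1 = j) (hjk : j + 1 = k) (x : F.obj (K.X j)) (hx : F.map (K.d j k) x = 0) :
    ∃ y, F.map (K.d i j) y = x :=
  (MapsExact.exact (F := F) (K.d i j) (K.d j k) (fun x => ⟨fun hx => h i j k hij hjk x hx, by
    rintro ⟨y, rfl⟩
    exact ConcreteCategory.congr_hom (K.d_comp_d i j k) y⟩) x).1 hx

/-- A cocycle (a, b) is bounded in two moves: a is lifted through the exact complex F₀ K, and then
b, corrected by ±η of that lift, is a cocycle of the exact complex F₁ K. -/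
lemma IsExactComplex.twoTerm {K : CochainComplex (ModuleCat.{u} R) ℤ} (h : IsExactComplex K) :
    IsExactComplex ((twoTerm η).obj K) := by
  rintro i _ _ rfl rfl (x : F₀.obj (K.X (i + 1 + 1)) × F₁.obj (K.X (i + 1)))
  obtain ⟨a, b⟩ := x
  intro hx
  rw [twoTerm_d_apply η K rfl] at hx
  obtain ⟨h₁, h₂⟩ := Prod.mk.inj hx
  obtain ⟨a, rfl⟩ := h.exists_map_d_eq F₀ rfl rfl _ h₁
  simp only [nat_apply, HomologicalComplex.XIsoOfEq_rfl, Iso.refl_hom, map_id_apply'] at h₂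
  obtain ⟨b', hb'⟩ := h.exists_map_d_eq F₁ rfl rfl (b + (i + 1).negOnePow • η.app _ a) (by
    rw [map_add, Units.smul_def, map_zsmul, ← h₂, Units.smul_def])
  refine ⟨(a, b'), ?_⟩
  rw [twoTerm_d_apply η K rfl, hb', Int.negOnePow_succ]
  simp only [HomologicalComplex.XIsoOfEq_rfl, Iso.refl_hom, map_id_apply', Units.smul_def,
    Units.val_neg, neg_smul, neg_add_cancel_right]
  rfl

lemma twoTerm_map_quasiIso {K L : CochainComplex (ModuleCat.{u} R) ℤ} (f : K ⟶ L)
    (hf : QuasiIso f) : QuasiIso ((twoTerm η).map f) := by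
  rw [quasiIso_iff_isExactComplex] at hf ⊢
  exact isExactComplex_of_iso (twoTermConeIso η f).symm (hf.twoTerm η)

open DerivedCategory

lemma twoTerm_inverts :
    (HomologicalComplex.quasiIso (ModuleCat.{u} R) (ComplexShape.up ℤ)).IsInvertedBy
      (twoTerm η ⋙ Q) := fun K L f hf => by
  have := twoTerm_map_quasiIso η f hf
  exact inferInstanceAs (IsIso (Q.map ((twoTerm η).map f)))

/-- The functor on derived categories induced by `twoTerm η`. -/
def twoTermDerived : DerivedCategory (ModuleCat.{u} R) ⥤ DerivedCategory (ModuleCat.{u} S) :=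
  Localization.lift (twoTerm η ⋙ Q) (twoTerm_inverts η) Q

instance : Localization.Lifting Q
    (HomologicalComplex.quasiIso (ModuleCat.{u} R) (ComplexShape.up ℤ))
    (twoTerm η ⋙ Q) (twoTermDerived η) :=
  inferInstanceAs (Localization.Lifting Q _ (twoTerm η ⋙ Q)
    (Localization.lift (twoTerm η ⋙ Q) (twoTerm_inverts η) Q))

/-- `twoTermDerived η` is induced by `twoTerm η`. -/
def twoTermDerivedFactors : Q ⋙ twoTermDerived η ≅ twoTerm η ⋙ Q :=
  Localization.Lifting.iso Q
    (HomologicalComplex.quasiIso (ModuleCat.{u} R) (ComplexShape.up ℤ)) _ _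

instance : (twoTermDerived η).CommShift ℤ :=
  Functor.commShiftOfLocalization Q
    (HomologicalComplex.quasiIso (ModuleCat.{u} R) (ComplexShape.up ℤ)) ℤ (twoTerm η ⋙ Q) _

instance : NatTrans.CommShift (twoTermDerivedFactors η).hom ℤ :=
  inferInstanceAs (NatTrans.CommShift (Localization.Lifting.iso Q
    (HomologicalComplex.quasiIso (ModuleCat.{u} R) (ComplexShape.up ℤ))
      (twoTerm η ⋙ Q) (twoTermDerived η)).hom ℤ)

instance : (twoTermDerived η).IsTriangulated where
  map_distinguished T hT := by
    -- Every distinguished triangle is isomorphic to the image of a standard cone triangle, so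
    -- `twoTermTriangleIso` suffices.
    obtain ⟨K, L, f, ⟨e⟩⟩ := (mem_distTriang_iff T).1 hT
    refine (mem_distTriang_iff _).2 ⟨_, _, (twoTerm η).map f, ⟨?_⟩⟩
    exact (twoTermDerived η).mapTriangle.mapIso e ≪≫
      (Functor.mapTriangleCompIso Q (twoTermDerived η)).symm.app _ ≪≫
      (Functor.mapTriangleIso (twoTermDerivedFactors η)).app _ ≪≫
      (Functor.mapTriangleCompIso (twoTerm η) Q).app _ ≪≫
      Q.mapTriangle.mapIso (twoTermTriangleIso η f).symm

lemma isZero_prod {A B : ModuleCat.{u} S} (hA : Limits.IsZero A) (hB : Limits.IsZero B) :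
    Limits.IsZero (ModuleCat.of S (A × B)) := by
  have := ModuleCat.subsingleton_of_isZero hA
  have := ModuleCat.subsingleton_of_isZero hB
  exact ModuleCat.isZero_of_subsingleton _

lemma twoTermDerived_bounded (X : DerivedCategory (ModuleCat.{u} R))
    (hX : TStructure.t.bounded X) : TStructure.t.bounded ((twoTermDerived η).obj X) := by
  obtain ⟨⟨a, ha⟩, ⟨b, hb⟩⟩ := hX
  -- Degree n of the total complex involves degrees n and n + 1 of `K`, so only the lower bound
  -- moves.
  refine ⟨⟨a - 1, ?_⟩, ⟨b, ?_⟩⟩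
  · obtain ⟨K, hK, ⟨e⟩⟩ := exists_iso_Q_obj_of_isGE X a
    refine ⟨(twoTerm η).obj K, (twoTermDerived η).mapIso e ≪≫ (twoTermDerivedFactors η).app K, ?_⟩
    rw [CochainComplex.isStrictlyGE_iff]
    intro i hi
    exact isZero_prod (F₀.map_isZero (K.isZero_of_isStrictlyGE a _ (by lia)))
      (F₁.map_isZero (K.isZero_of_isStrictlyGE a _ (by lia)))
  · obtain ⟨K, hK, ⟨e⟩⟩ := exists_iso_Q_obj_of_isLE X b
    refine ⟨(twoTerm η).obj K, (twoTermDerived η).mapIso e ≪≫ (twoTermDerivedFactors η).app K, ?_⟩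
    rw [CochainComplex.isStrictlyLE_iff]
    intro i hi
    exact isZero_prod (F₀.map_isZero (K.isZero_of_isStrictlyLE b _ (by lia)))
      (F₁.map_isZero (K.isZero_of_isStrictlyLE b _ (by lia)))

end TwoTermDerived

/-! ### Elementwise criteria for quasi-isomorphisms -/

noncomputable section QuasiIsoCriteria

variable {R : Type u} [Ring R] {K L : CochainComplex (ModuleCat.{u} R) ℤ}

lemma hom_d_apply (f : K ⟶ L) (i j : ℤ) (x : K.X i) :
    f.f j (K.d i j x) = L.d i j (f.f i x) :=
  (ConcreteCategory.congr_hom (f.comm i j) x).symm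

lemma d_d_apply (K : CochainComplex (ModuleCat.{u} R) ℤ) (i j k : ℤ) (x : K.X i) :
    K.d j k (K.d i j x) = 0 :=
  ConcreteCategory.congr_hom (K.d_comp_d i j k) x

open CochainComplex in
/-- A morphism of complexes that is bijective on cohomology, in terms of elements. -/
lemma quasiIso_of_elements (f : K ⟶ L)
    (hs : ∀ i j k : ℤ, i + 1 = j → j + 1 = k → ∀ y : L.X j, L.d j k y = 0 →
      ∃ (x : K.X j) (y' : L.X i), K.d j k x = 0 ∧ y = f.f j x + L.d i j y')
    (hi : ∀ i j k : ℤ, i + 1 = j → j + 1 = k → ∀ (x : K.X j) (y : L.X i), K.d j k x = 0 →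
      f.f j x = L.d i j y → ∃ x' : K.X i, x = K.d i j x') : QuasiIso f := by
  rw [quasiIso_iff_isExactComplex]
  rintro i j k hij hjk x hx
  have h₁ := ConcreteCategory.congr_hom (mappingCone.d_fst_v f j k (k + 1) hjk rfl) x
  have h₂ := ConcreteCategory.congr_hom (mappingCone.d_snd_v f j k hjk) x
  set a : K.X k := (mappingCone.fst f).1.v j k hjk x with ha
  set b : L.X j := (mappingCone.snd f).v j j (add_zero j) x with hb
  have h₁' : (mappingCone.fst f).1.v k (k + 1) rfl ((mappingCone f).d j k x) =
    -(K.d k (k + 1) a) := h₁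
  have h₂' : (mappingCone.snd f).v k k (add_zero k) ((mappingCone f).d j k x) =
    f.f k a + L.d j k b := h₂
  rw [hx, map_zero] at h₁' h₂'
  -- A cocycle (a, b) of the cone satisfies da = 0 and f a = -db. Injectivity on cohomology gives a
  -- = da', so b + f a' is a cocycle; surjectivity writes it as f c + db' with dc = 0. Then (c - a',
  -- b') has boundary (a, b).
  obtain ⟨a', ha'⟩ := hi j k (k + 1) hjk rfl a (-b) (neg_eq_zero.1 h₁'.symm) (by
    rw [map_neg]; exact eq_neg_of_add_eq_zero_left h₂'.symm)
  obtain ⟨c, b', hc, hb'⟩ := hs i j k hij hjk (b + f.f j a') (by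
    rw [map_add, ← hom_d_apply, ← ha', add_comm]; exact h₂'.symm)
  let y : (mappingCone f).X i := (mappingCone.inl f).v j i (by lia) (c - a') +
    (mappingCone.inr f).f i b'
  have hy₁ : (mappingCone.fst f).1.v i j hij y = c - a' := by
    have e₁ := ConcreteCategory.congr_hom (mappingCone.inl_v_fst_v f j i (by lia)) (c - a')
    have e₂ := ConcreteCategory.congr_hom (mappingCone.inr_f_fst_v f i j hij) b'
    refine (map_add _ _ _).trans ?_
    exact (congrArg₂ (· + ·) e₁ e₂).trans (add_zero _)
  have hy₂ : (mappingCone.snd f).v i i (add_zero i) y = b' := by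
    have e₁ := ConcreteCategory.congr_hom (mappingCone.inl_v_snd_v f j i (by lia)) (c - a')
    have e₂ := ConcreteCategory.congr_hom (mappingCone.inr_f_snd_v f i) b'
    refine (map_add _ _ _).trans ?_
    exact (congrArg₂ (· + ·) e₁ e₂).trans (zero_add _)
  refine ⟨y, ?_⟩
  have k₁ : (mappingCone.fst f).1.v j k hjk ((mappingCone f).d i j y) = a := by
    refine (ConcreteCategory.congr_hom (mappingCone.d_fst_v f i j k hij hjk) y).trans ?_
    change -(K.d j k ((mappingCone.fst f).1.v i j hij y)) = a
    rw [hy₁, map_sub, hc, ha', zero_sub, neg_neg]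
  have k₂ : (mappingCone.snd f).v j j (add_zero j) ((mappingCone f).d i j y) = b := by
    refine (ConcreteCategory.congr_hom (mappingCone.d_snd_v f i j hij) y).trans ?_
    change f.f j ((mappingCone.fst f).1.v i j hij y) +
      L.d i j ((mappingCone.snd f).v i i (add_zero i) y) = b
    rw [hy₁, hy₂, map_sub, sub_add_eq_add_sub, ← hb', add_sub_cancel_right]
  have key : ∀ z : (mappingCone f).X j,
      z = (mappingCone.inl f).v k j (by lia) ((mappingCone.fst f).1.v j k hjk z) +
        (mappingCone.inr f).f j ((mappingCone.snd f).v j j (add_zero j) z) := fun z =>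
    ConcreteCategory.congr_hom (mappingCone.id_X f j k hjk).symm z
  rw [key ((mappingCone f).d i j y), k₁, k₂, key x]

/-- A degreewise surjective morphism with exact kernel is a quasi-isomorphism. -/
lemma quasiIso_of_surjective (f : K ⟶ L) (hf : ∀ n, Function.Surjective (f.f n))
    (h : ∀ i j k : ℤ, i + 1 = j → j + 1 = k → ∀ x : K.X j, f.f j x = 0 → K.d j k x = 0 →
      ∃ x' : K.X i, f.f i x' = 0 ∧ K.d i j x' = x) : QuasiIso f := by
  refine quasiIso_of_elements f ?_ ?_
  · intro i j k hij hjk y hy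
    obtain ⟨x, rfl⟩ := hf j y
    obtain ⟨x', hx', h'⟩ := h j k (k + 1) hjk rfl (K.d j k x) (by rw [hom_d_apply, hy])
      (d_d_apply _ _ _ _ _)
    exact ⟨x - x', 0, by rw [map_sub, h', sub_self], by rw [map_sub, hx', map_zero]; simp⟩
  · intro i j k hij hjk x y hx hxy
    obtain ⟨z, rfl⟩ := hf i y
    obtain ⟨x', -, h'⟩ := h i j k hij hjk (x - K.d i j z)
      (by rw [map_sub, hxy, hom_d_apply, sub_self])
      (by rw [map_sub, hx, d_d_apply, sub_self])
    exact ⟨x' + z, by rw [map_add, h', sub_add_cancel]⟩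

/-- A degreewise injective morphism with exact cokernel is a quasi-isomorphism. -/
lemma quasiIso_of_injective (f : K ⟶ L) (hf : ∀ n, Function.Injective (f.f n))
    (h : ∀ i j k : ℤ, i + 1 = j → j + 1 = k → ∀ (y : L.X j) (x : K.X k), L.d j k y = f.f k x →
      ∃ (y' : L.X i) (x' : K.X j), y = f.f j x' + L.d i j y') : QuasiIso f := by
  refine quasiIso_of_elements f ?_ ?_
  · intro i j k hij hjk y hy
    obtain ⟨y', x', rfl⟩ := h i j k hij hjk y 0 (by rw [hy, map_zero])
    refine ⟨x', y', hf k ?_, rfl⟩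
    rw [map_add, d_d_apply, add_zero, ← hom_d_apply] at hy
    rw [hy, map_zero]
  · intro i j k hij hjk x y hx hxy
    obtain ⟨y', x', rfl⟩ := h (i - 1) i j (by lia) hij y x hxy.symm
    refine ⟨x', hf j ?_⟩
    rw [hxy, map_add, d_d_apply, add_zero, hom_d_apply]

end QuasiIsoCriteria

/-! ### Composites of two totalizations compared with the shift -/

noncomputable section TwoTermComp

variable {R S : Type u} [Ring R] [Ring S] {F₀ F₁ : ModuleCat.{u} R ⥤ ModuleCat.{u} S}
  [F₀.Additive] [F₁.Additive] (η : F₀ ⟶ F₁)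

section Components

variable (K : CochainComplex (ModuleCat.{u} R) ℤ)

/-- The first projection of the total complex. -/
def twoTermFst (n : ℤ) : ((twoTerm η).obj K).X n ⟶ F₀.obj (K.X (n + 1)) :=
  ModuleCat.ofHom (LinearMap.fst S (F₀.obj (K.X (n + 1))) (F₁.obj (K.X n)))

/-- The second projection of the total complex. -/
def twoTermSnd (n : ℤ) : ((twoTerm η).obj K).X n ⟶ F₁.obj (K.X n) :=
  ModuleCat.ofHom (LinearMap.snd S (F₀.obj (K.X (n + 1))) (F₁.obj (K.X n)))

/-- The first inclusion into the total complex. -/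
def twoTermIncl₀ (n : ℤ) : F₀.obj (K.X (n + 1)) ⟶ ((twoTerm η).obj K).X n :=
  ModuleCat.ofHom (LinearMap.inl S (F₀.obj (K.X (n + 1))) (F₁.obj (K.X n)))

/-- The second inclusion into the total complex. -/
def twoTermIncl₁ (n : ℤ) : F₁.obj (K.X n) ⟶ ((twoTerm η).obj K).X n :=
  ModuleCat.ofHom (LinearMap.inr S (F₀.obj (K.X (n + 1))) (F₁.obj (K.X n)))

lemma twoTermIncl₀_fst (n : ℤ) : twoTermIncl₀ η K n ≫ twoTermFst η K n = 𝟙 _ := rfl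
lemma twoTermIncl₀_snd (n : ℤ) : twoTermIncl₀ η K n ≫ twoTermSnd η K n = 0 := rfl
lemma twoTermIncl₁_fst (n : ℤ) : twoTermIncl₁ η K n ≫ twoTermFst η K n = 0 := rfl
lemma twoTermIncl₁_snd (n : ℤ) : twoTermIncl₁ η K n ≫ twoTermSnd η K n = 𝟙 _ := rfl

lemma twoTerm_id_X (n : ℤ) : twoTermFst η K n ≫ twoTermIncl₀ η K n +
    twoTermSnd η K n ≫ twoTermIncl₁ η K n = 𝟙 _ := by
  ext1
  refine LinearMap.ext fun (x : F₀.obj (K.X (n + 1)) × F₁.obj (K.X n)) => ?_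
  exact Prod.ext (add_zero x.1) (zero_add x.2)

lemma twoTerm_d_fst (n : ℤ) : ((twoTerm η).obj K).d n (n + 1) ≫ twoTermFst η K (n + 1) =
    twoTermFst η K n ≫ F₀.map (K.d (n + 1) (n + 1 + 1)) := by
  ext1
  refine LinearMap.ext fun (x : F₀.obj (K.X (n + 1)) × F₁.obj (K.X n)) => ?_
  exact congrArg Prod.fst (twoTerm_d_apply η K rfl x.1 x.2)

lemma twoTerm_d_snd (n : ℤ) : ((twoTerm η).obj K).d n (n + 1) ≫ twoTermSnd η K (n + 1) =
    twoTermSnd η K n ≫ F₁.map (K.d n (n + 1)) +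
      (n.negOnePow : ℤ) • twoTermFst η K n ≫ η.app (K.X (n + 1)) := by
  ext1
  refine LinearMap.ext fun (x : F₀.obj (K.X (n + 1)) × F₁.obj (K.X n)) => ?_
  refine (congrArg Prod.snd (twoTerm_d_apply η K rfl x.1 x.2)).trans ?_
  simp only [HomologicalComplex.XIsoOfEq_rfl, Iso.refl_hom, map_id_apply', Units.smul_def]
  rfl

lemma twoTerm_map_fst {K L : CochainComplex (ModuleCat.{u} R) ℤ} (f : K ⟶ L) (n : ℤ) :
    ((twoTerm η).map f).f n ≫ twoTermFst η L n = twoTermFst η K n ≫ F₀.map (f.f (n + 1)) := rfl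

lemma twoTerm_map_snd {K L : CochainComplex (ModuleCat.{u} R) ℤ} (f : K ⟶ L) (n : ℤ) :
    ((twoTerm η).map f).f n ≫ twoTermSnd η L n = twoTermSnd η K n ≫ F₁.map (f.f n) := rfl

lemma twoTermIncl₀_map {K L : CochainComplex (ModuleCat.{u} R) ℤ} (f : K ⟶ L) (n : ℤ) :
    twoTermIncl₀ η K n ≫ ((twoTerm η).map f).f n = F₀.map (f.f (n + 1)) ≫ twoTermIncl₀ η L n := by
  ext1
  exact LinearMap.ext fun (x : F₀.obj (K.X (n + 1))) => Prod.ext rfl (map_zero (F₁.map _).hom)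

lemma twoTermIncl₁_map {K L : CochainComplex (ModuleCat.{u} R) ℤ} (f : K ⟶ L) (n : ℤ) :
    twoTermIncl₁ η K n ≫ ((twoTerm η).map f).f n = F₁.map (f.f n) ≫ twoTermIncl₁ η L n := by
  ext1
  exact LinearMap.ext fun (x : F₁.obj (K.X n)) => Prod.ext (map_zero (F₀.map _).hom) rfl

variable {T : Type u} [Ring T] (G : ModuleCat.{u} S ⥤ ModuleCat.{u} T) [G.Additive]

variable {K} in
lemma map_twoTerm_ext {n : ℤ} {x y : G.obj (((twoTerm η).obj K).X n)}
    (h₀ : G.map (twoTermFst η K n) x = G.map (twoTermFst η K n) y)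
    (h₁ : G.map (twoTermSnd η K n) x = G.map (twoTermSnd η K n) y) : x = y := by
  have key : ∀ z : G.obj (((twoTerm η).obj K).X n),
      z = G.map (twoTermIncl₀ η K n) (G.map (twoTermFst η K n) z) +
        G.map (twoTermIncl₁ η K n) (G.map (twoTermSnd η K n) z) := fun z => by
    rw [map_comp_apply', map_comp_apply', ← map_add_apply', twoTerm_id_X, map_id_apply']
  rw [key x, key y, h₀, h₁]

lemma map_fst_incl₀ (n : ℤ) (x : G.obj (F₀.obj (K.X (n + 1)))) :
    G.map (twoTermFst η K n) (G.map (twoTermIncl₀ η K n) x) = x := by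
  rw [map_comp_apply', twoTermIncl₀_fst, map_id_apply']
lemma map_snd_incl₀ (n : ℤ) (x : G.obj (F₀.obj (K.X (n + 1)))) :
    G.map (twoTermSnd η K n) (G.map (twoTermIncl₀ η K n) x) = 0 := by
  rw [map_comp_apply', twoTermIncl₀_snd, map_zero_apply']
lemma map_fst_incl₁ (n : ℤ) (x : G.obj (F₁.obj (K.X n))) :
    G.map (twoTermFst η K n) (G.map (twoTermIncl₁ η K n) x) = 0 := by
  rw [map_comp_apply', twoTermIncl₁_fst, map_zero_apply']
lemma map_snd_incl₁ (n : ℤ) (x : G.obj (F₁.obj (K.X n))) :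
    G.map (twoTermSnd η K n) (G.map (twoTermIncl₁ η K n) x) = x := by
  rw [map_comp_apply', twoTermIncl₁_snd, map_id_apply']

lemma map_fst_map_d (n : ℤ) (x : G.obj (((twoTerm η).obj K).X n)) :
    G.map (twoTermFst η K (n + 1)) (G.map (((twoTerm η).obj K).d n (n + 1)) x) =
      G.map (F₀.map (K.d (n + 1) (n + 1 + 1))) (G.map (twoTermFst η K n) x) := by
  rw [map_comp_apply', twoTerm_d_fst, map_comp_apply']

lemma map_snd_map_d (n : ℤ) (x : G.obj (((twoTerm η).obj K).X n)) :
    G.map (twoTermSnd η K (n + 1)) (G.map (((twoTerm η).obj K).d n (n + 1)) x) =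
      G.map (F₁.map (K.d n (n + 1))) (G.map (twoTermSnd η K n) x) +
        (n.negOnePow : ℤ) • G.map (η.app (K.X (n + 1))) (G.map (twoTermFst η K n) x) := by
  rw [map_comp_apply', twoTerm_d_snd, map_comp_apply', map_comp_apply', map_add_apply',
    G.map_zsmul]
  rfl

end Components

variable {G₀ G₁ : ModuleCat.{u} S ⥤ ModuleCat.{u} R} [G₀.Additive] [G₁.Additive] (θ : G₀ ⟶ G₁)

lemma twoTerm_d_apply_succ (K : CochainComplex (ModuleCat.{u} R) ℤ) (n : ℤ)
    (a : F₀.obj (K.X (n + 1))) (b : F₁.obj (K.X n)) :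
    ((twoTerm η).obj K).d n (n + 1) (a, b) = (F₀.map (K.d (n + 1) (n + 1 + 1)) a,
      F₁.map (K.d n (n + 1)) b + (n.negOnePow : ℤ) • η.app _ a) := by
  rw [twoTerm_d_apply η K rfl]
  simp only [HomologicalComplex.XIsoOfEq_rfl, Iso.refl_hom, map_id_apply', Units.smul_def]
  rfl

lemma negOnePow_mul_self (n : ℤ) : (n.negOnePow : ℤ) * n.negOnePow = 1 := by
  rw [← Units.val_mul, Int.units_mul_self]; rfl

lemma negOnePow_succ' (n : ℤ) : ((n + 1).negOnePow : ℤ) = -(n.negOnePow : ℤ) := by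
  rw [Int.negOnePow_succ]; rfl

lemma negOnePow_smul_negOnePow_smul {M : Type*} [AddCommGroup M] (n : ℤ) (x : M) :
    (n.negOnePow : ℤ) • (n.negOnePow : ℤ) • x = x := by
  rw [smul_smul, negOnePow_mul_self, one_smul]

lemma shift_one_d (K : CochainComplex (ModuleCat.{u} R) ℤ) (n : ℤ) (x : K.X (n + 1)) :
    ((shiftFunctor (CochainComplex (ModuleCat.{u} R) ℤ) (1 : ℤ)).obj K).d n (n + 1) x =
      -(K.d (n + 1) (n + 1 + 1) x) := by
  rw [CochainComplex.shiftFunctor_obj_d']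
  simp only [Int.negOnePow_one, Units.smul_def, Units.val_neg, Units.val_one, neg_smul, one_smul]
  rfl

/-- Data exhibiting `X` as the cokernel of `G₀ F₀ X → G₀ F₁ X ⊕ G₁ F₀ X`, naturally in `X`. -/
structure CokernelPresentation where
  /-- The component on `G₀ F₁ X`. -/
  u : ∀ X : ModuleCat.{u} R, G₀.obj (F₁.obj X) ⟶ X
  /-- The component on `G₁ F₀ X`. -/
  w : ∀ X : ModuleCat.{u} R, G₁.obj (F₀.obj X) ⟶ X
  u_nat : ∀ {X Y : ModuleCat.{u} R} (f : X ⟶ Y) (x : G₀.obj (F₁.obj X)),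
    u Y (G₀.map (F₁.map f) x) = f (u X x)
  w_nat : ∀ {X Y : ModuleCat.{u} R} (f : X ⟶ Y) (x : G₁.obj (F₀.obj X)),
    w Y (G₁.map (F₀.map f) x) = f (w X x)
  comm : ∀ (X : ModuleCat.{u} R) (x : G₀.obj (F₀.obj X)),
    u X (G₀.map (η.app X) x) = w X (θ.app (F₀.obj X) x)
  surj : ∀ (X : ModuleCat.{u} R) (x : X), ∃ a b, u X a + w X b = x
  exact : ∀ (X : ModuleCat.{u} R) (a : G₀.obj (F₁.obj X)) (b : G₁.obj (F₀.obj X)),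
    u X a + w X b = 0 → ∃ c, a = G₀.map (η.app X) c ∧ b = -θ.app (F₀.obj X) c
  inj : ∀ (X : ModuleCat.{u} R) (c : G₀.obj (F₀.obj X)),
    G₀.map (η.app X) c = 0 → θ.app (F₀.obj X) c = 0 → c = 0
  zero : ∀ X : ModuleCat.{u} R, Subsingleton (G₁.obj (F₁.obj X))

namespace CokernelPresentation

variable {η θ} (P : CokernelPresentation η θ)

/-- The underlying linear maps of `CokernelPresentation.counit`. -/
def counitX (K : CochainComplex (ModuleCat.{u} R) ℤ) (n : ℤ) :
    ((twoTerm θ).obj ((twoTerm η).obj K)).X n ⟶ K.X (n + 1) :=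
  ModuleCat.ofHom ((n.negOnePow : ℤ) • LinearMap.coprod
    (M := G₀.obj (((twoTerm η).obj K).X (n + 1))) (M₂ := G₁.obj (((twoTerm η).obj K).X n))
    ((P.u (K.X (n + 1))).hom ∘ₗ (G₀.map (twoTermSnd η K (n + 1))).hom)
    ((P.w (K.X (n + 1))).hom ∘ₗ (G₁.map (twoTermFst η K n)).hom))

lemma counitX_apply (K : CochainComplex (ModuleCat.{u} R) ℤ) (n : ℤ)
    (a : G₀.obj (((twoTerm η).obj K).X (n + 1))) (b : G₁.obj (((twoTerm η).obj K).X n)) :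
    P.counitX K n (a, b) = (n.negOnePow : ℤ) •
      (P.u (K.X (n + 1)) (G₀.map (twoTermSnd η K (n + 1)) a) +
        P.w (K.X (n + 1)) (G₁.map (twoTermFst η K n) b)) := rfl

/-- The sign (-1)ⁿ in `counitX` accounts for the sign of the differential of the shifted complex.
The component in G₀F₀ contributes once through η and once through θ, with opposite signs, and `comm`
makes these contributions cancel. -/
lemma counitX_d (K : CochainComplex (ModuleCat.{u} R) ℤ) (n : ℤ)
    (a : G₀.obj (((twoTerm η).obj K).X (n + 1))) (b : G₁.obj (((twoTerm η).obj K).X n)) :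
    P.counitX K (n + 1) (((twoTerm θ).obj ((twoTerm η).obj K)).d n (n + 1) (a, b)) =
      -(K.d (n + 1) (n + 1 + 1) (P.counitX K n (a, b))) := by
  rw [twoTerm_d_apply_succ, counitX_apply, counitX_apply, map_snd_map_d, map_add, map_add, map_add,
    map_fst_map_d, P.u_nat, P.w_nat, map_zsmul, map_zsmul, map_zsmul, map_zsmul, P.comm,
    ← nat_apply, negOnePow_succ', map_add, neg_smul, neg_smul]
  congr 2
  abel

/-- The natural map from `twoTerm θ (twoTerm η K)` to the shift of `K`. -/
def counit : twoTerm η ⋙ twoTerm θ ⟶ shiftFunctor (CochainComplex (ModuleCat.{u} R) ℤ) (1 : ℤ) where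
  app K :=
    { f n := P.counitX K n
      comm' := by
        rintro n _ rfl
        ext1
        refine LinearMap.ext fun (x : G₀.obj (((twoTerm η).obj K).X (n + 1)) ×
          G₁.obj (((twoTerm η).obj K).X n)) => ?_
        exact (shift_one_d K n _).trans (P.counitX_d K n x.1 x.2).symm }
  naturality K L f := by
    ext n : 2
    refine LinearMap.ext fun (x : G₀.obj (((twoTerm η).obj K).X (n + 1)) ×
      G₁.obj (((twoTerm η).obj K).X n)) => ?_
    change P.counitX L n (G₀.map (((twoTerm η).map f).f (n + 1)) x.1,
      G₁.map (((twoTerm η).map f).f n) x.2) = f.f (n + 1) (P.counitX K n (x.1, x.2))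
    rw [counitX_apply, counitX_apply, map_comp_apply', map_comp_apply', twoTerm_map_fst,
      twoTerm_map_snd, ← map_comp_apply', ← map_comp_apply', P.u_nat, P.w_nat, map_zsmul, map_add]

lemma counitX_surjective (K : CochainComplex (ModuleCat.{u} R) ℤ) (n : ℤ) :
    Function.Surjective (P.counitX K n) := fun x => by
  obtain ⟨a, b, h⟩ := P.surj _ ((n.negOnePow : ℤ) • x)
  refine ⟨(G₀.map (twoTermIncl₁ η K (n + 1)) a, G₁.map (twoTermIncl₀ η K n) b), ?_⟩
  rw [counitX_apply, map_snd_incl₁, map_fst_incl₀, h, negOnePow_smul_negOnePow_smul]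

/-- By `P.exact` the components of (a, b) in G₀F₁ and G₁F₀ come from a single c in G₀F₀, and up to
sign c, placed one degree lower, is the required primitive. The remaining component of a, in G₀F₀,
then agrees with dc up to sign because `P.inj` detects this after applying η and θ; the part in G₁F₁
vanishes. -/
lemma counitX_exact (K : CochainComplex (ModuleCat.{u} R) ℤ) (i : ℤ)
    (a : G₀.obj (((twoTerm η).obj K).X (i + 1 + 1))) (b : G₁.obj (((twoTerm η).obj K).X (i + 1)))
    (h : P.counitX K (i + 1) (a, b) = 0)
    (hd : ((twoTerm θ).obj ((twoTerm η).obj K)).d (i + 1) (i + 1 + 1) (a, b) = 0) :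
    ∃ (a' : G₀.obj (((twoTerm η).obj K).X (i + 1))) (b' : G₁.obj (((twoTerm η).obj K).X i)),
      P.counitX K i (a', b') = 0 ∧
        ((twoTerm θ).obj ((twoTerm η).obj K)).d i (i + 1) (a', b') = (a, b) := by
  have h0 : P.u _ (G₀.map (twoTermSnd η K (i + 1 + 1)) a) +
        P.w _ (G₁.map (twoTermFst η K (i + 1)) b) = 0 := by
    rw [← negOnePow_smul_negOnePow_smul (i + 1) (P.u _ _ + P.w _ _), ← counitX_apply, h, smul_zero]
  obtain ⟨c, hc₁, hc₂⟩ := P.exact _ _ _ h0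
  rw [twoTerm_d_apply_succ] at hd
  obtain ⟨hd₁, hd₂⟩ := Prod.mk.inj hd
  have e₁ : G₀.map (F₁.map (K.d (i + 1 + 1) (i + 1 + 1 + 1))) (G₀.map (η.app _) c) +
      ((i + 1 + 1).negOnePow : ℤ) • G₀.map (η.app _) (G₀.map (twoTermFst η K (i + 1 + 1)) a) = 0 := by
    rw [← hc₁, ← map_snd_map_d, hd₁, map_zero]
  have e₂ : G₁.map (F₀.map (K.d (i + 1 + 1) (i + 1 + 1 + 1))) (-θ.app _ c) +
      ((i + 1).negOnePow : ℤ) • θ.app _ (G₀.map (twoTermFst η K (i + 1 + 1)) a) = 0 := by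
    rw [← hc₂, ← map_fst_map_d, nat_apply, ← map_zsmul, ← map_add, hd₂, map_zero]
  have hc : G₀.map (F₀.map (K.d (i + 1 + 1) (i + 1 + 1 + 1))) c +
      ((i + 1 + 1).negOnePow : ℤ) • G₀.map (twoTermFst η K (i + 1 + 1)) a = 0 := by
    refine P.inj _ _ ?_ ?_
    · rw [map_add, map_zsmul, ← e₁, map_comp_apply', η.naturality, ← map_comp_apply']
    · rw [map_add, map_zsmul, nat_apply, ← neg_eq_zero, ← e₂, negOnePow_succ' (i + 1), map_neg,
        neg_add, neg_smul, neg_neg]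
  refine ⟨G₀.map (twoTermIncl₀ η K (i + 1)) (((i + 1).negOnePow : ℤ) • c), 0, ?_, ?_⟩
  · rw [counitX_apply, map_snd_incl₀, map_zero, map_zero, map_zero, add_zero, smul_zero]
  · rw [twoTerm_d_apply_succ]
    refine Prod.ext ?_ ?_
    · refine map_twoTerm_ext η G₀ ?_ ?_
      · change G₀.map _ (G₀.map _ _) = G₀.map _ a
        rw [map_fst_map_d, map_fst_incl₀, map_zsmul, eq_neg_of_add_eq_zero_left hc,
          negOnePow_succ' (i + 1), neg_smul, neg_neg, negOnePow_smul_negOnePow_smul]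
      · change G₀.map _ (G₀.map _ _) = G₀.map _ a
        rw [map_snd_map_d, map_fst_incl₀, map_snd_incl₀, map_zero, zero_add, map_zsmul,
          negOnePow_smul_negOnePow_smul, hc₁]
    · refine map_twoTerm_ext η G₁ ?_ ((P.zero _).elim _ _)
      change G₁.map _ (G₁.map _ _ + _) = G₁.map _ b
      rw [map_zero, zero_add, map_zsmul, ← nat_apply, map_fst_incl₀, map_zsmul, hc₂,
        negOnePow_succ' i, neg_smul, smul_neg, negOnePow_smul_negOnePow_smul]

lemma counit_quasiIso (K : CochainComplex (ModuleCat.{u} R) ℤ) : QuasiIso (P.counit.app K) := by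
  refine quasiIso_of_surjective _ (fun n => P.counitX_surjective K n) ?_
  rintro i _ _ rfl rfl (x : G₀.obj (((twoTerm η).obj K).X (i + 1 + 1)) ×
    G₁.obj (((twoTerm η).obj K).X (i + 1))) h hd
  obtain ⟨a, b, h₁, h₂⟩ := P.counitX_exact K i x.1 x.2 h hd
  exact ⟨(a, b), h₁, h₂⟩

end CokernelPresentation

/-- Data exhibiting `X` as the kernel of `F₀ G₁ X ⊕ F₁ G₀ X → F₁ G₁ X`, naturally in `X`. -/
structure KernelPresentation where
  /-- The component in `F₀ G₁ X`. -/
  p : ∀ X : ModuleCat.{u} S, X ⟶ F₀.obj (G₁.obj X)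
  /-- The component in `F₁ G₀ X`. -/
  r : ∀ X : ModuleCat.{u} S, X ⟶ F₁.obj (G₀.obj X)
  p_nat : ∀ {X Y : ModuleCat.{u} S} (f : X ⟶ Y) (x : X), F₀.map (G₁.map f) (p X x) = p Y (f x)
  r_nat : ∀ {X Y : ModuleCat.{u} S} (f : X ⟶ Y) (x : X), F₁.map (G₀.map f) (r X x) = r Y (f x)
  comm : ∀ (X : ModuleCat.{u} S) (x : X),
    η.app (G₁.obj X) (p X x) = F₁.map (θ.app X) (r X x)
  inj : ∀ (X : ModuleCat.{u} S) (x : X), p X x = 0 → r X x = 0 → x = 0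
  exact : ∀ (X : ModuleCat.{u} S) (b : F₀.obj (G₁.obj X)) (c : F₁.obj (G₀.obj X)),
    η.app (G₁.obj X) b = F₁.map (θ.app X) c → ∃ x, p X x = b ∧ r X x = c
  surj : ∀ X : ModuleCat.{u} S, Function.Surjective (η.app (G₁.obj X))
  zero : ∀ X : ModuleCat.{u} S, Subsingleton (F₀.obj (G₀.obj X))

namespace KernelPresentation

variable {η θ} (P : KernelPresentation η θ)

/-- The underlying linear maps of `KernelPresentation.unit`. -/
def unitX (K : CochainComplex (ModuleCat.{u} S) ℤ) (n : ℤ) :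
    K.X (n + 1) ⟶ ((twoTerm η).obj ((twoTerm θ).obj K)).X n :=
  ModuleCat.ofHom ((n.negOnePow : ℤ) • LinearMap.prod
    (M₂ := F₀.obj (((twoTerm θ).obj K).X (n + 1))) (M₃ := F₁.obj (((twoTerm θ).obj K).X n))
    ((F₀.map (twoTermIncl₁ θ K (n + 1))).hom ∘ₗ (P.p (K.X (n + 1))).hom)
    (-((F₁.map (twoTermIncl₀ θ K n)).hom ∘ₗ (P.r (K.X (n + 1))).hom)))

lemma unitX_apply (K : CochainComplex (ModuleCat.{u} S) ℤ) (n : ℤ) (x : K.X (n + 1)) :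
    P.unitX K n x = ((n.negOnePow : ℤ) • F₀.map (twoTermIncl₁ θ K (n + 1)) (P.p _ x),
      (n.negOnePow : ℤ) • -F₁.map (twoTermIncl₀ θ K n) (P.r _ x)) := rfl

/-- The minus sign on the `r`-component of `unitX` makes the two images in F₁G₁ cancel by `P.comm`.
-/
lemma unitX_d (K : CochainComplex (ModuleCat.{u} S) ℤ) (n : ℤ) (x : K.X (n + 1)) :
    ((twoTerm η).obj ((twoTerm θ).obj K)).d n (n + 1) (P.unitX K n x) =
      P.unitX K (n + 1) (-(K.d (n + 1) (n + 1 + 1) x)) := by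
  rw [unitX_apply, unitX_apply, twoTerm_d_apply_succ]
  refine Prod.ext ?_ ?_
  · refine map_twoTerm_ext θ F₀ ((P.zero _).elim _ _) ?_
    change F₀.map _ (F₀.map _ _) = F₀.map _ (_ • F₀.map _ _)
    simp only [map_snd_map_d, map_zsmul, map_neg, map_snd_incl₁, map_fst_incl₁, map_zero, smul_zero,
      add_zero, P.p_nat, negOnePow_succ', neg_smul, smul_neg, neg_neg]
  · refine map_twoTerm_ext θ F₁ ?_ ?_
    · change F₁.map _ (F₁.map _ _ + _) = F₁.map _ (_ • -F₁.map _ _)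
      simp only [map_add, map_fst_map_d, map_zsmul, map_neg, map_fst_incl₀, map_fst_incl₁,
        ← nat_apply, smul_zero, map_zero, add_zero, P.r_nat, negOnePow_succ', neg_smul, smul_neg,
        neg_neg]
    · change F₁.map _ (F₁.map _ _ + _) = F₁.map _ (_ • -F₁.map _ _)
      simp only [map_add, map_snd_map_d, map_zsmul, map_neg, map_snd_incl₀, map_fst_incl₀,
        map_snd_incl₁, ← nat_apply, smul_zero, neg_zero, map_zero, zero_add, P.comm, smul_neg,
        neg_add_cancel]

/-- The natural map from the shift of `K` to `twoTerm η (twoTerm θ K)`. -/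
def unit : shiftFunctor (CochainComplex (ModuleCat.{u} S) ℤ) (1 : ℤ) ⟶ twoTerm θ ⋙ twoTerm η where
  app K :=
    { f n := P.unitX K n
      comm' := by
        rintro n _ rfl
        ext1
        refine LinearMap.ext fun (x : K.X (n + 1)) => ?_
        exact (P.unitX_d K n x).trans (congrArg _ (shift_one_d K n x).symm) }
  naturality K L f := by
    ext n : 2
    refine LinearMap.ext fun (x : K.X (n + 1)) => ?_
    change P.unitX L n (f.f (n + 1) x) = (F₀.map (((twoTerm θ).map f).f (n + 1)) (P.unitX K n x).1,
      F₁.map (((twoTerm θ).map f).f n) (P.unitX K n x).2)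
    rw [unitX_apply, unitX_apply, map_zsmul, map_zsmul, map_neg, ← P.p_nat, ← P.r_nat, map_comp_apply',
      map_comp_apply', map_comp_apply', map_comp_apply', twoTermIncl₀_map, twoTermIncl₁_map]

lemma unitX_injective (K : CochainComplex (ModuleCat.{u} S) ℤ) (n : ℤ) :
    Function.Injective (P.unitX K n) := by
  refine (injective_iff_map_eq_zero (P.unitX K n).hom).2 fun x hx => ?_
  replace hx : P.unitX K n x = 0 := hx
  rw [unitX_apply] at hx
  obtain ⟨h₁, h₂⟩ := Prod.mk.inj hx
  refine P.inj _ _ ?_ ?_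
  · rw [← map_snd_incl₁ θ K F₀ (n + 1) (P.p _ x),
      ← negOnePow_smul_negOnePow_smul n (F₀.map (twoTermIncl₁ θ K (n + 1)) (P.p _ x)), h₁,
      smul_zero, map_zero]
  · rw [← map_fst_incl₀ θ K F₁ n (P.r _ x), ← neg_neg (F₁.map (twoTermIncl₀ θ K n) (P.r _ x)),
      ← negOnePow_smul_negOnePow_smul n (-F₁.map (twoTermIncl₀ θ K n) (P.r _ x)), h₂,
      smul_zero, neg_zero, map_zero]

/-- `P.surj` yields c in F₀G₁ whose image under η is the F₁G₁-component of b. Subtracting the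
boundary of ±c removes that component, and the other two then satisfy the kernel equation of
`P.exact`, which produces x'. -/
lemma unitX_coexact (K : CochainComplex (ModuleCat.{u} S) ℤ) (i : ℤ)
    (a : F₀.obj (((twoTerm θ).obj K).X (i + 1 + 1))) (b : F₁.obj (((twoTerm θ).obj K).X (i + 1)))
    (x : K.X (i + 1 + 1 + 1))
    (h : ((twoTerm η).obj ((twoTerm θ).obj K)).d (i + 1) (i + 1 + 1) (a, b) =
      P.unitX K (i + 1 + 1) x) :
    ∃ (y : ((twoTerm η).obj ((twoTerm θ).obj K)).X i) (x' : K.X (i + 1 + 1)),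
      (a, b) = P.unitX K (i + 1) x' + ((twoTerm η).obj ((twoTerm θ).obj K)).d i (i + 1) y := by
  rw [twoTerm_d_apply_succ, unitX_apply] at h
  have h₂ := congrArg (F₁.map (twoTermSnd θ K (i + 1 + 1))) (Prod.mk.inj h).2
  rw [map_add, map_snd_map_d, map_zsmul, map_zsmul, map_neg, map_snd_incl₀, neg_zero, smul_zero,
    ← nat_apply] at h₂
  obtain ⟨c, hc⟩ := P.surj _ (F₁.map (twoTermSnd θ K (i + 1)) b)
  obtain ⟨x', hx₁, hx₂⟩ := P.exact (K.X (i + 1 + 1))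
    (((i + 1).negOnePow : ℤ) • F₀.map (twoTermSnd θ K (i + 1 + 1)) a +
      F₀.map (G₁.map (K.d (i + 1) (i + 1 + 1))) c)
    (-(((i + 1).negOnePow : ℤ) • F₁.map (twoTermFst θ K (i + 1)) b)) (by
      refine (map_add _ _ _).trans ?_
      rw [nat_apply, hc, map_neg, map_zsmul, map_zsmul]
      exact eq_neg_of_add_eq_zero_left (by rw [← h₂]; abel))
  refine ⟨(F₀.map (twoTermIncl₁ θ K (i + 1)) ((i.negOnePow : ℤ) • c), 0), x', ?_⟩
  rw [unitX_apply, twoTerm_d_apply_succ, hx₁, hx₂]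
  refine Prod.ext ?_ ?_
  · refine map_twoTerm_ext θ F₀ ((P.zero _).elim _ _) ?_
    change F₀.map _ a = F₀.map _ (_ • F₀.map _ _ + F₀.map _ (F₀.map _ _))
    rw [map_add, map_zsmul, map_snd_incl₁, map_snd_map_d, map_snd_incl₁, map_fst_incl₁, map_zero,
      smul_zero, add_zero, map_zsmul, smul_add, negOnePow_smul_negOnePow_smul, negOnePow_succ' i,
      neg_smul, neg_add_cancel_right]
  · refine map_twoTerm_ext θ F₁ ?_ ?_
    · change F₁.map _ b = F₁.map _ (_ • -F₁.map _ _ + (F₁.map _ _ + _ • _))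
      rw [map_neg, neg_neg, map_zero, zero_add, map_add, map_zsmul, map_zsmul, map_zsmul,
        map_fst_incl₀, negOnePow_smul_negOnePow_smul, map_zsmul, ← nat_apply, map_fst_incl₁, map_zero, smul_zero, add_zero]
    · change F₁.map _ b = F₁.map _ (_ • -F₁.map _ _ + (F₁.map _ _ + _ • _))
      rw [map_neg, neg_neg, map_zero, zero_add, map_add, map_zsmul, map_zsmul, map_zsmul,
        map_snd_incl₀, smul_zero, smul_zero, zero_add, map_zsmul,
        ← nat_apply, map_snd_incl₁, map_zsmul, negOnePow_smul_negOnePow_smul, hc]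

lemma unit_quasiIso (K : CochainComplex (ModuleCat.{u} S) ℤ) : QuasiIso (P.unit.app K) := by
  refine quasiIso_of_injective _ (fun n => P.unitX_injective K n) ?_
  rintro i _ _ rfl rfl (y : F₀.obj (((twoTerm θ).obj K).X (i + 1 + 1)) ×
    F₁.obj (((twoTerm θ).obj K).X (i + 1))) (x : K.X (i + 1 + 1 + 1)) h
  exact P.unitX_coexact K i y.1 y.2 x h

end KernelPresentation

end TwoTermComp

/-! ### Equivalences of bounded derived categories from the two presentations -/

noncomputable section TwoTermEquivalence

variable {R S : Type u} [Ring R] [Ring S] {F₀ F₁ : ModuleCat.{u} R ⥤ ModuleCat.{u} S}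
  [F₀.Additive] [F₁.Additive] [MapsExact F₀] [MapsExact F₁] {η : F₀ ⟶ F₁}
  {G₀ G₁ : ModuleCat.{u} S ⥤ ModuleCat.{u} R} [G₀.Additive] [G₁.Additive]
  [MapsExact G₀] [MapsExact G₁] {θ : G₀ ⟶ G₁}

open DerivedCategory

/-- The composite of the functors on derived categories is induced by the composite of the
functors on complexes. -/
def twoTermDerivedCompFactors (η : F₀ ⟶ F₁) (θ : G₀ ⟶ G₁) :
    Q ⋙ twoTermDerived η ⋙ twoTermDerived θ ≅ (twoTerm η ⋙ twoTerm θ) ⋙ Q :=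
  Functor.isoWhiskerRight (twoTermDerivedFactors η) (twoTermDerived θ) ≪≫
    Functor.isoWhiskerLeft (twoTerm η) (twoTermDerivedFactors θ)

lemma isIso_Q_map {K L : CochainComplex (ModuleCat.{u} R) ℤ} (f : K ⟶ L) (hf : QuasiIso f) :
    IsIso (Q.map f) :=
  (isIso_Q_map_iff_quasiIso _ f).2 hf

/-- `twoTerm θ (twoTerm η K)` and the shift of `K` become isomorphic in the derived category. -/
def CokernelPresentation.isoShift (P : CokernelPresentation η θ) :
    twoTermDerived η ⋙ twoTermDerived θ ≅
      shiftFunctor (DerivedCategory (ModuleCat.{u} R)) (1 : ℤ) :=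
  letI : Localization.Lifting Q (HomologicalComplex.quasiIso (ModuleCat.{u} R) (ComplexShape.up ℤ))
    ((twoTerm η ⋙ twoTerm θ) ⋙ Q) (twoTermDerived η ⋙ twoTermDerived θ) :=
    ⟨twoTermDerivedCompFactors η θ⟩
  letI : Localization.Lifting Q (HomologicalComplex.quasiIso (ModuleCat.{u} R) (ComplexShape.up ℤ))
    (shiftFunctor (CochainComplex (ModuleCat.{u} R) ℤ) (1 : ℤ) ⋙ Q)
    (shiftFunctor (DerivedCategory (ModuleCat.{u} R)) (1 : ℤ)) :=
    ⟨(Q.commShiftIso (1 : ℤ)).symm⟩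
  letI : ∀ K, IsIso ((Functor.whiskerRight P.counit Q).app K) := fun K =>
    isIso_Q_map _ (P.counit_quasiIso K)
  letI : IsIso (Functor.whiskerRight P.counit Q) := NatIso.isIso_of_isIso_app _
  Localization.liftNatIso Q (HomologicalComplex.quasiIso (ModuleCat.{u} R) (ComplexShape.up ℤ))
    ((twoTerm η ⋙ twoTerm θ) ⋙ Q) (shiftFunctor _ (1 : ℤ) ⋙ Q) _ _
    (asIso (Functor.whiskerRight P.counit Q))

/-- The shift of `K` and `twoTerm η (twoTerm θ K)` become isomorphic in the derived category. -/
def KernelPresentation.isoShift (P : KernelPresentation η θ) :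
    shiftFunctor (DerivedCategory (ModuleCat.{u} S)) (1 : ℤ) ≅
      twoTermDerived θ ⋙ twoTermDerived η :=
  letI : Localization.Lifting Q (HomologicalComplex.quasiIso (ModuleCat.{u} S) (ComplexShape.up ℤ))
    ((twoTerm θ ⋙ twoTerm η) ⋙ Q) (twoTermDerived θ ⋙ twoTermDerived η) :=
    ⟨twoTermDerivedCompFactors θ η⟩
  letI : Localization.Lifting Q (HomologicalComplex.quasiIso (ModuleCat.{u} S) (ComplexShape.up ℤ))
    (shiftFunctor (CochainComplex (ModuleCat.{u} S) ℤ) (1 : ℤ) ⋙ Q)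
    (shiftFunctor (DerivedCategory (ModuleCat.{u} S)) (1 : ℤ)) :=
    ⟨(Q.commShiftIso (1 : ℤ)).symm⟩
  letI : ∀ K, IsIso ((Functor.whiskerRight P.unit Q).app K) := fun K =>
    isIso_Q_map _ (P.unit_quasiIso K)
  letI : IsIso (Functor.whiskerRight P.unit Q) := NatIso.isIso_of_isIso_app _
  Localization.liftNatIso Q (HomologicalComplex.quasiIso (ModuleCat.{u} S) (ComplexShape.up ℤ))
    (shiftFunctor _ (1 : ℤ) ⋙ Q) ((twoTerm θ ⋙ twoTerm η) ⋙ Q) _ _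
    (asIso (Functor.whiskerRight P.unit Q))

-- No triangle identities are needed: faithfulness of both functors comes from the composites,
-- fullness of `F` then follows from that of `F ⋙ G`, and essential surjectivity from that of `G ⋙
-- F`.
omit [F₀.Additive] [F₁.Additive] [MapsExact F₀] [MapsExact F₁] [G₀.Additive] [G₁.Additive]
  [MapsExact G₀] [MapsExact G₁] in
lemma isEquivalence_of_comp_iso {C D : Type*} [Category C] [Category D] (F : C ⥤ D) (G : D ⥤ C)
    (E : C ⥤ C) (E' : D ⥤ D) [E.IsEquivalence] [E'.IsEquivalence] (e : F ⋙ G ≅ E)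
    (e' : G ⋙ F ≅ E') : F.IsEquivalence := by
  have h₁ : (F ⋙ G).IsEquivalence := Functor.isEquivalence_of_iso e.symm
  have h₂ : (G ⋙ F).IsEquivalence := Functor.isEquivalence_of_iso e'.symm
  have : F.Faithful := Functor.Faithful.of_comp F G
  have : G.Faithful := Functor.Faithful.of_comp G F
  have : F.Full := Functor.Full.of_comp_faithful F G
  have : F.EssSurj := ⟨fun Y => ⟨G.obj ((G ⋙ F).objPreimage Y), ⟨(G ⋙ F).objObjPreimageIso Y⟩⟩⟩
  exact { }

/-- The functor on bounded derived categories induced by `twoTerm η`. -/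
def twoTermBounded (η : F₀ ⟶ F₁) : Bounded (ModuleCat.{u} R) ⥤ Bounded (ModuleCat.{u} S) :=
  TStructure.t.bounded.lift (Bounded.ι ⋙ twoTermDerived η)
    (fun X => twoTermDerived_bounded η _ X.property)

instance : (twoTermBounded η).CommShift ℤ :=
  inferInstanceAs ((TStructure.t.bounded.lift (Bounded.ι ⋙ twoTermDerived η)
    (fun X => twoTermDerived_bounded η _ X.property)).CommShift ℤ)

instance : (twoTermBounded η).IsTriangulated :=
  inferInstanceAs ((TStructure.t.bounded.lift (Bounded.ι ⋙ twoTermDerived η)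
    (fun X => twoTermDerived_bounded η _ X.property)).IsTriangulated)

/-- The isomorphism of composites on derived categories restricts to the bounded ones. -/
def twoTermBoundedCompIso
    (e : twoTermDerived η ⋙ twoTermDerived θ ≅
      shiftFunctor (DerivedCategory (ModuleCat.{u} R)) (1 : ℤ)) :
    twoTermBounded η ⋙ twoTermBounded θ ≅
      shiftFunctor (Bounded (ModuleCat.{u} R)) (1 : ℤ) :=
  Functor.fullyFaithfulCancelRight Bounded.ι
    (Functor.isoWhiskerLeft Bounded.ι e ≪≫ (Bounded.ι.commShiftIso (1 : ℤ)).symm)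

theorem derivedEquivalent_of_presentations (P : CokernelPresentation η θ)
    (P' : KernelPresentation η θ) : DerivedEquivalent R S :=
  ⟨twoTermBounded η, inferInstance, inferInstance,
    isEquivalence_of_comp_iso _ (twoTermBounded θ) _ _ (twoTermBoundedCompIso P.isoShift)
      (twoTermBoundedCompIso P'.isoShift.symm)⟩

end TwoTermEquivalence

/-! ### Idempotent corners and restriction as exact functors -/

noncomputable section ExactFunctors

variable {R N S T : Type u} [Ring R] [Ring S] [Ring T]

instance (F : ModuleCat.{u} R ⥤ ModuleCat.{u} S) (G : ModuleCat.{u} S ⥤ ModuleCat.{u} T)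
    [MapsExact F] [MapsExact G] : MapsExact (F ⋙ G) where
  exact _ _ h := MapsExact.exact (F := G) _ _ (MapsExact.exact (F := F) _ _ h)

instance (f : R →+* S) : MapsExact (ModuleCat.restrictScalars.{u} f) where
  exact _ _ h := h

/-- The elements of `W` on which the idempotent `i 1` acts as the identity. -/
def Corner (i : R →ₙ+* T) (W : Type u) [AddCommGroup W] [Module T W] : Type u :=
  (LinearMap.ker (Module.toAddMonoidEnd T W (i 1) - 1).toIntLinearMap)

namespace Corner

variable (i : R →ₙ+* T) (W : Type u) [AddCommGroup W] [Module T W]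

instance : AddCommGroup (Corner i W) :=
  inferInstanceAs (AddCommGroup (LinearMap.ker (Module.toAddMonoidEnd T W (i 1) - 1).toIntLinearMap))

variable {i W}

/-- The underlying element. -/
def val (w : Corner i W) : W := Subtype.val w

lemma val_injective : Function.Injective (val (i := i) (W := W)) := Subtype.val_injective

@[ext] lemma ext {v w : Corner i W} (h : v.val = w.val) : v = w := val_injective h

/-- Constructor for elements of the corner. -/
def mk (w : W) (h : i 1 • w = w) : Corner i W := ⟨w, sub_eq_zero.2 h⟩

@[simp] lemma val_mk (w : W) (h : i 1 • w = w) : (mk w h).val = w := rfl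
lemma one_smul_val (w : Corner i W) : i 1 • w.val = w.val := sub_eq_zero.1 w.2
@[simp] lemma val_add (v w : Corner i W) : (v + w).val = v.val + w.val := rfl
@[simp] lemma val_zero : (0 : Corner i W).val = 0 := rfl
@[simp] lemma val_neg (w : Corner i W) : (-w).val = -w.val := rfl

/-- `val` as a homomorphism. -/
def valHom : Corner i W →+ W := ⟨⟨val, rfl⟩, fun _ _ => rfl⟩

@[simp] lemma val_sum {ι : Type*} (s : Finset ι) (f : ι → Corner i W) :
    (∑ j ∈ s, f j).val = ∑ j ∈ s, (f j).val := map_sum valHom f s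

instance : SMul R (Corner i W) :=
  ⟨fun r w => mk (i r • w.val) (by rw [smul_smul, ← map_mul, one_mul])⟩

@[simp] lemma val_smul (r : R) (w : Corner i W) : (r • w).val = i r • w.val := rfl

instance : Module R (Corner i W) where
  one_smul w := ext w.one_smul_val
  mul_smul r s w := ext (by simp [mul_smul])
  smul_zero r := ext (by simp)
  smul_add r v w := ext (by simp)
  add_smul r s w := ext (by simp [add_smul])
  zero_smul w := ext (by simp)

end Corner

/-- The functor sending a module to the image of the idempotent `i 1`. -/
def cornerFunctor (i : R →ₙ+* T) : ModuleCat.{u} T ⥤ ModuleCat.{u} R where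
  obj W := ModuleCat.of R (Corner i W)
  map {V W} f := ModuleCat.ofHom
    { toFun v := Corner.mk (f v.val) (by rw [← map_smul, v.one_smul_val])
      map_add' _ _ := Corner.ext (map_add f.hom _ _)
      map_smul' _ _ := Corner.ext (map_smul f.hom _ _) }

instance (i : R →ₙ+* T) : (cornerFunctor i).Additive where

instance (i : R →ₙ+* T) : MapsExact (cornerFunctor i) where
  exact {X Y Z} f g h := fun (y : Corner i Y) => by
    constructor
    · intro hy
      obtain ⟨x, hx⟩ := (h y.val).1 (congrArg Corner.val hy)
      -- Any preimage can be pushed into the corner by the idempotent, which fixes the target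
      -- element.
      refine ⟨Corner.mk (i 1 • x) (by rw [smul_smul, ← map_mul, one_mul]), Corner.ext ?_⟩
      change f (i 1 • x) = y.val
      rw [map_smul, hx, y.one_smul_val]
    · rintro ⟨x, rfl⟩
      exact Corner.ext ((h _).2 ⟨_, rfl⟩)

variable [AddCommGroup N] [Module S N] [Module Rᵐᵒᵖ N] [SMulCommClass S Rᵐᵒᵖ N]

namespace LowerTriangular

variable (R N S) in
/-- The projection to the upper left corner. -/
def fstHom : LowerTriangular R N S →+* R where
  toFun := fst
  map_one' := rfl
  map_mul' _ _ := rfl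
  map_zero' := rfl
  map_add' _ _ := rfl

variable (R N S) in
/-- The projection to the lower right corner. -/
def sndHom : LowerTriangular R N S →+* S where
  toFun := snd
  map_one' := rfl
  map_mul' _ _ := rfl
  map_zero' := rfl
  map_add' _ _ := rfl

variable (R N S) in
/-- The inclusion of the upper left corner. -/
def inlHom : R →ₙ+* LowerTriangular R N S where
  toFun r := ⟨r, 0, 0⟩
  map_mul' _ _ := by ext <;> simp
  map_zero' := rfl
  map_add' _ _ := by ext <;> simp

variable (R N S) in
/-- The inclusion of the lower right corner. -/
def inrHom : S →ₙ+* LowerTriangular R N S where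
  toFun s := ⟨0, 0, s⟩
  map_mul' _ _ := by ext <;> simp
  map_zero' := rfl
  map_add' _ _ := by ext <;> simp

variable (R N S) in
/-- The inclusion of the lower left corner. -/
def cornerHom : N →+ LowerTriangular R N S where
  toFun n := ⟨0, n, 0⟩
  map_zero' := rfl
  map_add' _ _ := by ext <;> simp

@[simp] lemma inlHom_fst (r : R) : (inlHom R N S r).fst = r := rfl
@[simp] lemma inlHom_corner (r : R) : (inlHom R N S r).corner = 0 := rfl
@[simp] lemma inlHom_snd (r : R) : (inlHom R N S r).snd = 0 := rfl
@[simp] lemma cornerHom_fst (n : N) : (cornerHom R N S n).fst = 0 := rfl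
@[simp] lemma cornerHom_corner (n : N) : (cornerHom R N S n).corner = n := rfl
@[simp] lemma cornerHom_snd (n : N) : (cornerHom R N S n).snd = 0 := rfl
@[simp] lemma inrHom_fst (s : S) : (inrHom R N S s).fst = 0 := rfl
@[simp] lemma inrHom_corner (s : S) : (inrHom R N S s).corner = 0 := rfl
@[simp] lemma inrHom_snd (s : S) : (inrHom R N S s).snd = s := rfl

lemma inl_mul_inl (r r' : R) : inlHom R N S r * inlHom R N S r' = inlHom R N S (r * r') :=
  (map_mul _ _ _).symm
lemma inr_mul_inr (s s' : S) : inrHom R N S s * inrHom R N S s' = inrHom R N S (s * s') :=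
  (map_mul _ _ _).symm
lemma inl_mul_inr (r : R) (s : S) : inlHom R N S r * inrHom R N S s = 0 := by
  ext <;> simp
lemma corner_mul_inl (n : N) (r : R) : cornerHom R N S n * inlHom R N S r =
    cornerHom R N S (MulOpposite.op r • n) := by
  ext <;> simp
lemma inr_mul_corner (s : S) (n : N) : inrHom R N S s * cornerHom R N S n =
    cornerHom R N S (s • n) := by
  ext <;> simp
lemma inl_mul_corner (r : R) (n : N) : inlHom R N S r * cornerHom R N S n = 0 := by
  ext <;> simp
lemma mul_inl (t : LowerTriangular R N S) (r : R) : t * inlHom R N S r =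
    inlHom R N S (t.fst * r) + cornerHom R N S (MulOpposite.op r • t.corner) := by
  ext <;> simp
lemma mul_inr (t : LowerTriangular R N S) (s : S) : t * inrHom R N S s =
    inrHom R N S (t.snd * s) := by
  ext <;> simp
lemma inr_mul (t : LowerTriangular R N S) (s : S) : inrHom R N S s * t =
    cornerHom R N S (s • t.corner) + inrHom R N S (s * t.snd) := by
  ext <;> simp
lemma inl_mul (t : LowerTriangular R N S) (r : R) : inlHom R N S r * t =
    inlHom R N S (r * t.fst) := by
  ext <;> simp
lemma mul_cornerHom (t : LowerTriangular R N S) (n : N) : t * cornerHom R N S n =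
    cornerHom R N S (t.snd • n) := by
  ext <;> simp
lemma cornerHom_mul (t : LowerTriangular R N S) (n : N) : cornerHom R N S n * t =
    cornerHom R N S (MulOpposite.op t.fst • n) := by
  ext <;> simp
lemma inl_add_inr : inlHom R N S 1 + inrHom R N S 1 = 1 := by
  ext <;> simp

end LowerTriangular

end ExactFunctors

/-! ### Modules induced from vector spaces, with M ⊗ V realized as triples in V -/

noncomputable section InducedModules

variable {k : Type u} [Field k]

/-- The action of a matrix on triples of vectors. -/
def matAct {V : Type u} [AddCommGroup V] [Module k V] (A : Matrix (Fin 3) (Fin 3) k)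
    (g : Fin 3 → V) : Fin 3 → V := fun i => ∑ j, A i j • g j

section MatAct

variable {V W : Type u} [AddCommGroup V] [Module k V] [AddCommGroup W] [Module k W]

lemma matAct_apply (A : Matrix (Fin 3) (Fin 3) k) (g : Fin 3 → V) (i : Fin 3) :
    matAct A g i = ∑ j, A i j • g j := rfl

lemma one_matAct (g : Fin 3 → V) : matAct (1 : Matrix (Fin 3) (Fin 3) k) g = g := by
  ext i
  simp [matAct_apply, Matrix.one_apply]

lemma mul_matAct (A B : Matrix (Fin 3) (Fin 3) k) (g : Fin 3 → V) :
    matAct (A * B) g = matAct A (matAct B g) := by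
  ext i
  simp only [matAct_apply, Matrix.mul_apply, Finset.sum_smul, Finset.smul_sum, mul_smul]
  exact Finset.sum_comm

lemma matAct_add (A : Matrix (Fin 3) (Fin 3) k) (g h : Fin 3 → V) :
    matAct A (g + h) = matAct A g + matAct A h := by
  ext i
  simp [matAct_apply, Finset.sum_add_distrib]

lemma matAct_zero (A : Matrix (Fin 3) (Fin 3) k) : matAct A (0 : Fin 3 → V) = 0 := by
  ext i
  simp [matAct_apply]

lemma add_matAct (A B : Matrix (Fin 3) (Fin 3) k) (g : Fin 3 → V) :
    matAct (A + B) g = matAct A g + matAct B g := by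
  ext i
  simp [matAct_apply, Finset.sum_add_distrib, add_smul]

lemma zero_matAct (g : Fin 3 → V) : matAct (0 : Matrix (Fin 3) (Fin 3) k) g = 0 := by
  ext i
  simp [matAct_apply]

lemma matAct_smul_const (A : Matrix (Fin 3) (Fin 3) k) (m : Fin 3 → k) (v : V) :
    matAct A (fun i => m i • v) = fun i => (A.mulVec m) i • v := by
  ext i
  simp [matAct_apply, Matrix.mulVec, dotProduct, Finset.sum_smul, mul_smul]

lemma matAct_map (f : V →ₗ[k] W) (A : Matrix (Fin 3) (Fin 3) k) (g : Fin 3 → V) (i : Fin 3) :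
    matAct A (fun i => f (g i)) i = f (matAct A g i) := by
  simp [matAct_apply]

end MatAct

variable (q : k)

/-- The coordinates of an element of `M(α)`. -/
def modMCoord {α : k} (m : ModM k α) : Fin 3 → k := m

/-- The standard basis of `M(α)`. -/
def modMBasis (α : k) (i : Fin 3) : ModM k α := Pi.single (M := fun _ => k) i 1

/-- The dual basis of `D(M(α))`. -/
def dualBasis (α : k) (i : Fin 3) : DualM k α := LinearMap.proj (R := k) (φ := fun _ => k) i

lemma dualBasis_apply (α : k) (i : Fin 3) (m : ModM k α) : dualBasis α i m = modMCoord m i := rfl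

lemma modM_ext {α : k} {m n : ModM k α} (h : ∀ i, modMCoord m i = modMCoord n i) : m = n :=
  funext h

lemma modMCoord_add {α : k} (m n : ModM k α) : modMCoord (m + n) = modMCoord m + modMCoord n := rfl
lemma modMCoord_zero {α : k} : modMCoord (0 : ModM k α) = 0 := rfl
lemma modMCoord_smul {α : k} (c : k) (m : ModM k α) : modMCoord (c • m) = c • modMCoord m := rfl

lemma modMCoord_op_smul {α : k} (c : k) (m : ModM k α) :
    modMCoord (MulOpposite.op c • m) = c • modMCoord m := by
  rw [op_smul_modM]; rfl

lemma modMCoord_basis {α : k} (i : Fin 3) :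
    modMCoord (modMBasis α i) = Pi.single i (1 : k) := rfl

lemma modMCoord_lambda_smul {α : k} (a : Lambda k q) (m : ModM k α) :
    modMCoord (a • m) = (matRep q α a).mulVec (modMCoord m) := rfl

lemma modM_eq_sum {α : k} (m : ModM k α) : m = ∑ i, modMCoord m i • modMBasis α i := by
  refine modM_ext fun i => ?_
  change modMCoord m i = (∑ j, modMCoord m j • (Pi.single j (1 : k) : Fin 3 → k)) i
  simp [Finset.sum_apply, Pi.single_apply]

lemma lambda_smul_basis {α : k} (a : Lambda k q) (j : Fin 3) :
    a • modMBasis α j = ∑ i, matRep q α a i j • modMBasis α i := by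
  rw [modM_eq_sum (a • modMBasis α j)]
  refine Finset.sum_congr rfl fun i _ => ?_
  rw [modMCoord_lambda_smul, modMCoord_basis, Matrix.mulVec_single_one]
  rfl

lemma dualM_apply_sum {α : k} (f : DualM k α) (c : Fin 3 → k) (m : Fin 3 → ModM k α) :
    f (∑ i, c i • m i) = ∑ i, c i * f (m i) := by
  let f' : ModM k α →ₗ[k] k := f
  change f' _ = ∑ i, c i * f' (m i)
  simp

lemma dualM_apply_smul_basis {α : k} (f : DualM k α) (a : Lambda k q) (j : Fin 3) :
    f (a • modMBasis α j) = ∑ i, matRep q α a i j * f (modMBasis α i) := by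
  rw [lambda_smul_basis, dualM_apply_sum]

lemma op_smul_dualBasis {α : k} (a : Lambda k q) (i : Fin 3) :
    MulOpposite.op a • dualBasis α i = ∑ j, matRep q α a i j • dualBasis α j := by
  refine dualM_ext fun m => ?_
  rw [op_smul_dualM_apply, dualBasis_apply, modMCoord_lambda_smul]
  refine Eq.trans ?_ (LinearMap.sum_apply Finset.univ
    (fun j => (matRep q α a i j • (dualBasis α j : ModM k α →ₗ[k] k))) m).symm
  rfl

lemma dualM_eq_sum {α : k} (f : DualM k α) : f = ∑ i, f (modMBasis α i) • dualBasis α i := by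
  refine dualM_ext fun m => ?_
  refine Eq.trans ?_ (LinearMap.sum_apply Finset.univ
    (fun j => (f (modMBasis α j) • (dualBasis α j : ModM k α →ₗ[k] k))) m).symm
  conv_lhs => rw [modM_eq_sum m, dualM_apply_sum]
  exact Finset.sum_congr rfl fun i _ => mul_comm _ _

variable (V : Type u) [AddCommGroup V] [Module k V]

/-- The `B`-module `B e₁ ⊗ V`. -/
@[ext] structure IndB (V : Type u) where
  /-- The component in `V`. -/
  fst : V
  /-- The component in `M ⊗ V`. -/
  snd : Fin 3 → V

/-- The `C`-module coinduced from `V`. -/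
@[ext] structure IndC (V : Type u) where
  /-- The component in `M ⊗ V`. -/
  fst : Fin 3 → V
  /-- The component in `V`. -/
  snd : V

variable {V}

namespace IndB

/-- The underlying pair. -/
def equiv : IndB V ≃ V × (Fin 3 → V) := ⟨fun x => (x.fst, x.snd), fun x => ⟨x.1, x.2⟩, fun _ => rfl,
  fun _ => rfl⟩

instance : AddCommGroup (IndB V) := equiv.addCommGroup

@[simp] lemma add_fst (x y : IndB V) : (x + y).fst = x.fst + y.fst := rfl
@[simp] lemma add_snd (x y : IndB V) : (x + y).snd = x.snd + y.snd := rfl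
@[simp] lemma zero_fst : (0 : IndB V).fst = 0 := rfl
@[simp] lemma zero_snd : (0 : IndB V).snd = 0 := rfl
@[simp] lemma neg_fst (x : IndB V) : (-x).fst = -x.fst := rfl
@[simp] lemma neg_snd (x : IndB V) : (-x).snd = -x.snd := rfl

instance : SMul (AlgB k q) (IndB V) :=
  ⟨fun b x => ⟨b.fst • x.fst, (fun i => modMCoord b.corner i • x.fst) +
    matAct (matRep q q b.snd) x.snd⟩⟩

lemma smul_fst (b : AlgB k q) (x : IndB V) : (b • x).fst = b.fst • x.fst := rfl
lemma smul_snd (b : AlgB k q) (x : IndB V) : (b • x).snd =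
    (fun i => modMCoord b.corner i • x.fst) + matAct (matRep q q b.snd) x.snd := rfl

instance : Module (AlgB k q) (IndB V) where
  one_smul x := by
    ext i
    · simp [smul_fst]
    · simp [smul_snd, modMCoord_zero, one_matAct]
  mul_smul b c x := by
    ext i
    · simp [smul_fst, mul_smul]
    · simp only [smul_fst, smul_snd, LowerTriangular.mul_corner, LowerTriangular.mul_snd, map_mul,
        mul_matAct, matAct_add, matAct_smul_const, modMCoord_add, modMCoord_op_smul,
        modMCoord_lambda_smul, Pi.add_apply, Pi.smul_apply, add_smul, smul_eq_mul, ← add_assoc,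
        mul_smul]
      rw [smul_comm]
  smul_zero b := by
    ext i
    · simp [smul_fst]
    · simp [smul_snd, matAct_zero]
  smul_add b x y := by
    ext i
    · simp [smul_fst]
    · simp only [smul_snd, add_fst, add_snd, matAct_add, Pi.add_apply, smul_add]
      abel
  add_smul b c x := by
    ext i
    · simp [smul_fst, add_smul]
    · simp only [smul_snd, LowerTriangular.add_corner, LowerTriangular.add_snd, modMCoord_add,
        map_add, add_matAct, Pi.add_apply, add_smul, add_snd]
      abel
  zero_smul x := by
    ext i
    · simp [smul_fst]
    · simp [smul_snd, modMCoord_zero, zero_matAct]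

end IndB

namespace IndC

/-- The underlying pair. -/
def equiv : IndC V ≃ (Fin 3 → V) × V := ⟨fun x => (x.fst, x.snd), fun x => ⟨x.1, x.2⟩, fun _ => rfl,
  fun _ => rfl⟩

instance : AddCommGroup (IndC V) := equiv.addCommGroup

@[simp] lemma add_fst (x y : IndC V) : (x + y).fst = x.fst + y.fst := rfl
@[simp] lemma add_snd (x y : IndC V) : (x + y).snd = x.snd + y.snd := rfl
@[simp] lemma zero_fst : (0 : IndC V).fst = 0 := rfl
@[simp] lemma zero_snd : (0 : IndC V).snd = 0 := rfl
@[simp] lemma neg_fst (x : IndC V) : (-x).fst = -x.fst := rfl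
@[simp] lemma neg_snd (x : IndC V) : (-x).snd = -x.snd := rfl

instance : SMul (AlgC k q) (IndC V) :=
  ⟨fun c x => ⟨matAct (matRep q q c.fst) x.fst,
    ∑ i, c.corner (modMBasis q i) • x.fst i + c.snd • x.snd⟩⟩

lemma smul_fst (c : AlgC k q) (x : IndC V) : (c • x).fst = matAct (matRep q q c.fst) x.fst := rfl
lemma smul_snd (c : AlgC k q) (x : IndC V) : (c • x).snd =
    ∑ i, c.corner (modMBasis q i) • x.fst i + c.snd • x.snd := rfl

lemma dual_add_apply (f g : DualM k q) (m : ModM k q) : (f + g) m = f m + g m := rfl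
lemma dual_zero_apply (m : ModM k q) : (0 : DualM k q) m = 0 := rfl

instance : Module (AlgC k q) (IndC V) where
  one_smul x := by
    ext i
    · simp [smul_fst, one_matAct]
    · simp [smul_snd, dual_zero_apply]
  mul_smul b c x := by
    ext i
    · simp [smul_fst, mul_matAct]
    · simp only [smul_fst, smul_snd, LowerTriangular.mul_corner, LowerTriangular.mul_snd,
        dual_add_apply, op_smul_dualM_apply, smul_dualM_apply, dualM_apply_smul_basis,
        matAct_apply, Finset.smul_sum, add_smul, Finset.sum_smul, Finset.sum_add_distrib, smul_add,
        mul_smul, add_assoc]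
      rw [Finset.sum_comm]
      congr 1
      refine Finset.sum_congr rfl fun i _ => Finset.sum_congr rfl fun j _ => smul_comm _ _ _
  smul_zero b := by
    ext i
    · simp [smul_fst, matAct_zero]
    · simp [smul_snd]
  smul_add b x y := by
    ext i
    · simp [smul_fst, matAct_add]
    · simp only [smul_snd, add_fst, add_snd, Pi.add_apply, smul_add, Finset.sum_add_distrib]
      abel
  add_smul b c x := by
    ext i
    · simp [smul_fst, add_matAct]
    · simp only [smul_snd, LowerTriangular.add_corner, LowerTriangular.add_snd, dual_add_apply,
        add_smul, add_snd, Finset.sum_add_distrib]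
      abel
  zero_smul x := by
    ext i
    · simp [smul_fst, zero_matAct]
    · simp [smul_snd, dual_zero_apply]

end IndC

/-- The functor `IndB`. -/
def indBFunctor : ModuleCat.{u} k ⥤ ModuleCat.{u} (AlgB k q) where
  obj V := ModuleCat.of (AlgB k q) (IndB V)
  map {V W} f := ModuleCat.ofHom
    { toFun x := ⟨f x.fst, fun i => f (x.snd i)⟩
      map_add' x y := IndB.ext (map_add f.hom _ _) (funext fun i => map_add f.hom _ _)
      map_smul' b x := IndB.ext (map_smul f.hom _ _) (funext fun i => by
        simp only [IndB.smul_snd, Pi.add_apply, map_add, map_smul, RingHom.id_apply]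
        rw [← matAct_map]) }

/-- The functor `IndC`. -/
def indCFunctor : ModuleCat.{u} k ⥤ ModuleCat.{u} (AlgC k q) where
  obj V := ModuleCat.of (AlgC k q) (IndC V)
  map {V W} f := ModuleCat.ofHom
    { toFun x := ⟨fun i => f (x.fst i), f x.snd⟩
      map_add' x y := IndC.ext (funext fun i => map_add f.hom _ _) (map_add f.hom _ _)
      map_smul' b x := IndC.ext (funext fun i => (matAct_map f.hom _ _ _).symm) (by
        simp only [IndC.smul_snd, map_add, map_sum, map_smul, RingHom.id_apply]) }

instance : (indBFunctor q).Additive where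
instance : (indCFunctor q).Additive where

instance : MapsExact (indBFunctor q) where
  exact {X Y Z} f g h := fun (y : IndB Y) => by
    constructor
    · intro hy
      obtain ⟨x, hx⟩ := (h y.fst).1 (congrArg IndB.fst hy)
      choose x' hx' using fun i => (h (y.snd i)).1 (congrFun (congrArg IndB.snd hy) i)
      exact ⟨(⟨x, x'⟩ : IndB X), IndB.ext hx (funext hx')⟩
    · rintro ⟨x, rfl⟩
      exact IndB.ext ((h _).2 ⟨_, rfl⟩) (funext fun i => (h _).2 ⟨_, rfl⟩)

instance : MapsExact (indCFunctor q) where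
  exact {X Y Z} f g h := fun (y : IndC Y) => by
    constructor
    · intro hy
      obtain ⟨x, hx⟩ := (h y.snd).1 (congrArg IndC.snd hy)
      choose x' hx' using fun i => (h (y.fst i)).1 (congrFun (congrArg IndC.fst hy) i)
      exact ⟨(⟨x', x⟩ : IndC X), IndC.ext (funext hx') hx⟩
    · rintro ⟨x, rfl⟩
      exact IndC.ext (funext fun i => (h _).2 ⟨_, rfl⟩) ((h _).2 ⟨_, rfl⟩)

end InducedModules

/-! ### The four functors and two natural transformations between `B`- and `C`-modules -/

noncomputable section Tilting

open LowerTriangular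

variable {k : Type u} [Field k] (q : k)

/-- The inclusion `k → B`. -/
abbrev iB₁ : k →ₙ+* AlgB k q := inlHom k (ModM k q) (Lambda k q)
/-- The inclusion `Λ → B`. -/
abbrev iB₂ : Lambda k q →ₙ+* AlgB k q := inrHom k (ModM k q) (Lambda k q)
/-- The inclusion `M → B`. -/
abbrev mB : ModM k q →+ AlgB k q := cornerHom k (ModM k q) (Lambda k q)
/-- The inclusion `Λ → C`. -/
abbrev iC₁ : Lambda k q →ₙ+* AlgC k q := inlHom (Lambda k q) (DualM k q) k
/-- The inclusion `k → C`. -/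
abbrev iC₂ : k →ₙ+* AlgC k q := inrHom (Lambda k q) (DualM k q) k
/-- The inclusion `DM → C`. -/
abbrev mC : DualM k q →+ AlgC k q := cornerHom (Lambda k q) (DualM k q) k

/-- Sends `W` to the `C`-module induced from `e₁ W`. -/
def tiltF₀ : ModuleCat.{u} (AlgB k q) ⥤ ModuleCat.{u} (AlgC k q) :=
  cornerFunctor (iB₁ q) ⋙ indCFunctor q
/-- Sends `W` to the `Λ`-module `e₂ W`, as a `C`-module. -/
def tiltF₁ : ModuleCat.{u} (AlgB k q) ⥤ ModuleCat.{u} (AlgC k q) :=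
  cornerFunctor (iB₂ q) ⋙ ModuleCat.restrictScalars (fstHom (Lambda k q) (DualM k q) k)
/-- Sends `L` to the `Λ`-module `e₁ L`, as a `B`-module. -/
def tiltG₀ : ModuleCat.{u} (AlgC k q) ⥤ ModuleCat.{u} (AlgB k q) :=
  cornerFunctor (iC₁ q) ⋙ ModuleCat.restrictScalars (sndHom k (ModM k q) (Lambda k q))
/-- Sends `L` to the `B`-module induced from `e₂ L`. -/
def tiltG₁ : ModuleCat.{u} (AlgC k q) ⥤ ModuleCat.{u} (AlgB k q) :=
  cornerFunctor (iC₂ q) ⋙ indBFunctor q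

instance : (tiltF₀ q).Additive := inferInstanceAs (cornerFunctor (iB₁ q) ⋙ indCFunctor q).Additive
instance : (tiltF₁ q).Additive := inferInstanceAs
  (cornerFunctor (iB₂ q) ⋙ ModuleCat.restrictScalars (fstHom (Lambda k q) (DualM k q) k)).Additive
instance : (tiltG₀ q).Additive := inferInstanceAs
  (cornerFunctor (iC₁ q) ⋙ ModuleCat.restrictScalars (sndHom k (ModM k q) (Lambda k q))).Additive
instance : (tiltG₁ q).Additive := inferInstanceAs (cornerFunctor (iC₂ q) ⋙ indBFunctor q).Additive
instance : MapsExact (tiltF₀ q) := inferInstanceAs (MapsExact (cornerFunctor (iB₁ q) ⋙ indCFunctor q))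
instance : MapsExact (tiltF₁ q) := inferInstanceAs (MapsExact
  (cornerFunctor (iB₂ q) ⋙ ModuleCat.restrictScalars (fstHom (Lambda k q) (DualM k q) k)))
instance : MapsExact (tiltG₀ q) := inferInstanceAs (MapsExact
  (cornerFunctor (iC₁ q) ⋙ ModuleCat.restrictScalars (sndHom k (ModM k q) (Lambda k q))))
instance : MapsExact (tiltG₁ q) := inferInstanceAs (MapsExact (cornerFunctor (iC₂ q) ⋙ indBFunctor q))

section

variable {W : Type u} [AddCommGroup W] [Module (AlgB k q) W]
  {L : Type u} [AddCommGroup L] [Module (AlgC k q) L]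

lemma mB_smul (c : k) (m : ModM k q) (v : W) : mB q (c • m) • v = mB q m • iB₁ q c • v := by
  rw [smul_smul, corner_mul_inl, op_smul_modM]

lemma mC_smul (c : k) (f : DualM k q) (v : L) : mC q (c • f) • v = iC₂ q c • mC q f • v := by
  rw [smul_smul, inr_mul_corner]

lemma mB_sum (c : Fin 3 → k) (m : Fin 3 → ModM k q) (v : W) :
    mB q (∑ i, c i • m i) • v = ∑ i, mB q (m i) • iB₁ q (c i) • v := by
  rw [map_sum, Finset.sum_smul]
  exact Finset.sum_congr rfl fun i _ => mB_smul q _ _ _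

lemma mC_sum (c : Fin 3 → k) (f : Fin 3 → DualM k q) (v : L) :
    mC q (∑ i, c i • f i) • v = ∑ i, iC₂ q (c i) • mC q (f i) • v := by
  rw [map_sum, Finset.sum_smul]
  exact Finset.sum_congr rfl fun i _ => mC_smul q _ _ _

variable (W) in
/-- The multiplication `M ⊗ e₁ W → e₂ W` as a `C`-linear map on the coinduced module. -/
def tiltEtaFun (x : IndC (Corner (iB₁ q) W)) : Corner (iB₂ q) W :=
  Corner.mk (∑ i, mB q (modMBasis q i) • (x.fst i).val) (by
    rw [Finset.smul_sum]
    refine Finset.sum_congr rfl fun i _ => ?_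
    rw [smul_smul, inr_mul_corner, one_smul])

lemma tiltEtaFun_val (x : IndC (Corner (iB₁ q) W)) :
    (tiltEtaFun q W x).val = ∑ i, mB q (modMBasis q i) • (x.fst i).val := rfl

lemma tiltEtaFun_add (x y : IndC (Corner (iB₁ q) W)) :
    tiltEtaFun q W (x + y) = tiltEtaFun q W x + tiltEtaFun q W y := by
  ext
  simp [tiltEtaFun_val, Finset.sum_add_distrib]

/-- If A is the matrix of a on M, then Σᵢ vᵢ ⊗ (A g)ᵢ = Σⱼ (a vⱼ) ⊗ gⱼ; the action can be moved from
the triple onto the basis of M. -/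
lemma tiltEtaFun_smul (c : AlgC k q) (x : IndC (Corner (iB₁ q) W)) :
    tiltEtaFun q W (c • x) = c.fst • tiltEtaFun q W x := by
  ext
  rw [Corner.val_smul, tiltEtaFun_val, tiltEtaFun_val, Finset.smul_sum]
  simp only [smul_smul, inr_mul_corner, lambda_smul_basis, mB_sum, IndC.smul_fst, matAct_apply,
    Corner.val_sum, Corner.val_smul, Finset.smul_sum]
  rw [Finset.sum_comm]

/-- The map `e₁ L → M ⊗ e₂ L` as a `B`-linear map to the induced module. -/
def tiltThetaFun (y : Corner (iC₁ q) L) : IndB (Corner (iC₂ q) L) :=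
  ⟨0, fun i => Corner.mk (mC q (dualBasis q i) • y.val) (by
    rw [smul_smul, inr_mul_corner, one_smul])⟩

lemma tiltThetaFun_snd_val (y : Corner (iC₁ q) L) (i : Fin 3) :
    ((tiltThetaFun q y).snd i).val = mC q (dualBasis q i) • y.val := rfl
lemma tiltThetaFun_fst (y : Corner (iC₁ q) L) : (tiltThetaFun q y).fst = 0 := rfl

lemma tiltThetaFun_add (x y : Corner (iC₁ q) L) :
    tiltThetaFun q (x + y) = tiltThetaFun q x + tiltThetaFun q y := by
  ext i
  · simp [tiltThetaFun_fst]
  · simp [tiltThetaFun_snd_val]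

/-- Dually, the right action of Λ on the dual basis is given by the rows of the matrix that acts on
M. Only `b.snd` occurs because the first component of the image is zero. -/
lemma tiltThetaFun_smul (b : AlgB k q) (y : Corner (iC₁ q) L) :
    tiltThetaFun q (b.snd • y) = b • tiltThetaFun q y := by
  ext i
  · simp [tiltThetaFun_fst, IndB.smul_fst]
  · rw [tiltThetaFun_snd_val, IndB.smul_snd]
    simp only [Pi.add_apply, tiltThetaFun_fst, smul_zero, zero_add, matAct_apply, Corner.val_sum,
      Corner.val_smul, tiltThetaFun_snd_val]
    rw [smul_smul, corner_mul_inl, op_smul_dualBasis, mC_sum]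

end

/-- The natural transformation `tiltF₀ ⟶ tiltF₁`. -/
def tiltEta : tiltF₀ q ⟶ tiltF₁ q where
  app W := ModuleCat.ofHom (X := IndC (Corner (iB₁ q) W))
    (Y := (ModuleCat.restrictScalars (fstHom (Lambda k q) (DualM k q) k)).obj
      (ModuleCat.of _ (Corner (iB₂ q) W)))
    { toFun := tiltEtaFun q W
      map_add' := tiltEtaFun_add q
      map_smul' := tiltEtaFun_smul q }
  naturality V W f := by
    ext1
    refine LinearMap.ext fun (x : IndC (Corner (iB₁ q) V)) => ?_
    refine Corner.ext (i := iB₂ q) (W := W) ?_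
    change ∑ i, mB q (modMBasis q i) • f (x.fst i).val =
      f (∑ i, mB q (modMBasis q i) • (x.fst i).val)
    simp only [map_sum, map_smul]

/-- The natural transformation `tiltG₀ ⟶ tiltG₁`. -/
def tiltTheta : tiltG₀ q ⟶ tiltG₁ q where
  app L := ModuleCat.ofHom (X := (ModuleCat.restrictScalars (sndHom k (ModM k q) (Lambda k q))).obj
      (ModuleCat.of _ (Corner (iC₁ q) L))) (Y := IndB (Corner (iC₂ q) L))
    { toFun := tiltThetaFun q
      map_add' := tiltThetaFun_add q
      map_smul' := tiltThetaFun_smul q }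
  naturality K L f := by
    ext1
    refine LinearMap.ext fun (x : Corner (iC₁ q) K) => ?_
    refine IndB.ext ?_ (funext fun i => Corner.ext (i := iC₂ q) (W := L) ?_)
    · exact (map_zero ((cornerFunctor (iC₂ q)).map f).hom).symm
    · exact (map_smul f.hom _ _).symm

end Tilting

/-! ### Actions of matrix entries on the corners of a module -/

noncomputable section CornerLemmas

open LowerTriangular

variable {R N S : Type u} [Ring R] [Ring S] [AddCommGroup N] [Module S N] [Module Rᵐᵒᵖ N]
  [SMulCommClass S Rᵐᵒᵖ N] {W : Type u} [AddCommGroup W] [Module (LowerTriangular R N S) W]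

lemma smul_val_inr (t : LowerTriangular R N S) (z : Corner (inrHom R N S) W) :
    t • z.val = inrHom R N S t.snd • z.val := by
  conv_lhs => rw [← z.one_smul_val, smul_smul, mul_inr, mul_one]

lemma smul_val_inl (t : LowerTriangular R N S) (z : Corner (inlHom R N S) W) :
    t • z.val = inlHom R N S t.fst • z.val + cornerHom R N S t.corner • z.val := by
  conv_lhs => rw [← z.one_smul_val, smul_smul, mul_inl, mul_one, MulOpposite.op_one, one_smul,
    add_smul]

lemma inl_smul_val_inr (r : R) (z : Corner (inrHom R N S) W) : inlHom R N S r • z.val = 0 := by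
  rw [smul_val_inr, inlHom_snd, map_zero, zero_smul]

lemma corner_smul_val_inr (n : N) (z : Corner (inrHom R N S) W) :
    cornerHom R N S n • z.val = 0 := by
  rw [smul_val_inr, cornerHom_snd, map_zero, zero_smul]

lemma inr_smul_val_inl (s : S) (z : Corner (inlHom R N S) W) : inrHom R N S s • z.val = 0 := by
  rw [smul_val_inl, inrHom_fst, inrHom_corner, map_zero, map_zero, zero_smul, add_zero]

lemma inr_zero_smul (w : W) : inrHom R N S 0 • w = 0 := by rw [map_zero, zero_smul]

lemma inl_zero_smul (w : W) : inlHom R N S 0 • w = 0 := by rw [map_zero, zero_smul]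

lemma inl_smul_corner_smul (r : R) (n : N) (w : W) :
    inlHom R N S r • cornerHom R N S n • w = 0 := by
  rw [smul_smul, inl_mul_corner, zero_smul]

lemma inl_smul_inr_smul (r : R) (s : S) (w : W) : inlHom R N S r • inrHom R N S s • w = 0 := by
  rw [smul_smul, inl_mul_inr, zero_smul]

lemma inl_one_smul_add (w : W) : inlHom R N S 1 • w + inrHom R N S 1 • w = w := by
  rw [← add_smul, inl_add_inr, one_smul]

end CornerLemmas

/-! ### The two exact sequences and the derived equivalence of `B` and `C` -/

noncomputable section Presentations

open LowerTriangular

variable {k : Type u} [Field k] (q : k)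

section Induced

variable {V : Type u} [AddCommGroup V] [Module k V]

lemma mB_smul_indB (m : ModM k q) (x : IndB V) :
    mB q m • x = ⟨0, fun i => modMCoord m i • x.fst⟩ := by
  ext i
  · simp [IndB.smul_fst]
  · simp [IndB.smul_snd, zero_matAct]

lemma sum_mB_smul_indB (x : Fin 3 → IndB V) :
    ∑ i, mB q (modMBasis q i) • x i = ⟨0, fun i => (x i).fst⟩ := by
  simp only [mB_smul_indB, modMCoord_basis, Fin.sum_univ_three]
  ext i
  · simp
  · fin_cases i <;> simp

lemma mC_smul_indC (f : DualM k q) (x : IndC V) :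
    mC q f • x = ⟨0, ∑ i, f (modMBasis q i) • x.fst i⟩ := by
  ext i
  · simp [IndC.smul_fst, zero_matAct]
  · simp [IndC.smul_snd]

lemma mC_dualBasis_smul_indC (i : Fin 3) (x : IndC V) :
    mC q (dualBasis q i) • x = ⟨0, x.fst i⟩ := by
  rw [mC_smul_indC]
  simp [dualBasis_apply, modMCoord_basis, Pi.single_apply]

lemma iB₁_one_smul_indB (x : IndB V) : iB₁ q 1 • x = ⟨x.fst, 0⟩ := by
  ext i
  · simp [IndB.smul_fst]
  · simp [IndB.smul_snd, zero_matAct, modMCoord_zero]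

lemma iB₂_one_smul_indB (x : IndB V) : iB₂ q 1 • x = ⟨0, x.snd⟩ := by
  ext i
  · simp [IndB.smul_fst]
  · simp [IndB.smul_snd, one_matAct, modMCoord_zero]

lemma iC₁_one_smul_indC (x : IndC V) : iC₁ q 1 • x = ⟨x.fst, 0⟩ := by
  ext i
  · simp [IndC.smul_fst, one_matAct]
  · simp [IndC.smul_snd, IndC.dual_zero_apply]

lemma iC₂_smul_indC (c : k) (x : IndC V) : iC₂ q c • x = ⟨0, c • x.snd⟩ := by
  ext i
  · simp [IndC.smul_fst, zero_matAct]
  · simp [IndC.smul_snd, IndC.dual_zero_apply]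

lemma corner_indB_snd (x : Corner (iB₁ q) (IndB V)) : x.val.snd = 0 := by
  rw [← x.one_smul_val, iB₁_one_smul_indB]

lemma corner_indB_fst (x : Corner (iB₂ q) (IndB V)) : x.val.fst = 0 := by
  rw [← x.one_smul_val, iB₂_one_smul_indB]

lemma corner_indC_snd (x : Corner (iC₁ q) (IndC V)) : x.val.snd = 0 := by
  rw [← x.one_smul_val, iC₁_one_smul_indC]

lemma corner_indC_fst (x : Corner (iC₂ q) (IndC V)) : x.val.fst = 0 := by
  rw [← x.one_smul_val, iC₂_smul_indC]

lemma corner_indB_ext {x y : Corner (iB₁ q) (IndB V)} (h : x.val.fst = y.val.fst) : x = y :=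
  Corner.ext (IndB.ext h (by rw [corner_indB_snd, corner_indB_snd]))

lemma corner_indC_ext {x y : Corner (iC₂ q) (IndC V)} (h : x.val.snd = y.val.snd) : x = y :=
  Corner.ext (IndC.ext (by rw [corner_indC_fst, corner_indC_fst]) h)

/-- The `e₁`-component of the induced module. -/
def cornerIndBMk (v : V) : Corner (iB₁ q) (IndB V) := Corner.mk ⟨v, 0⟩ (iB₁_one_smul_indB q _)

/-- The `e₂`-component of the coinduced module. -/
def cornerIndCMk (v : V) : Corner (iC₂ q) (IndC V) := Corner.mk ⟨0, v⟩ (by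
  rw [iC₂_smul_indC, one_smul])

@[simp] lemma cornerIndBMk_val (v : V) : (cornerIndBMk q v).val = ⟨v, 0⟩ := rfl
@[simp] lemma cornerIndCMk_val (v : V) : (cornerIndCMk q v).val = ⟨0, v⟩ := rfl

end Induced

variable (W : Type u) [AddCommGroup W] [Module (AlgB k q) W]
  (L : Type u) [AddCommGroup L] [Module (AlgC k q) L]

/-- `e₂ W` as a `C`-module. -/
abbrev resB : ModuleCat.{u} (AlgC k q) :=
  (ModuleCat.restrictScalars (fstHom (Lambda k q) (DualM k q) k)).obj
    (ModuleCat.of _ (Corner (iB₂ q) W))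

/-- `e₁ L` as a `B`-module. -/
abbrev resC : ModuleCat.{u} (AlgB k q) :=
  (ModuleCat.restrictScalars (sndHom k (ModM k q) (Lambda k q))).obj
    (ModuleCat.of _ (Corner (iC₁ q) L))

variable {W L}

/-- The underlying element of `W`. -/
def resBVal (x : resB q W) : W := Corner.val (i := iB₂ q) (W := W) x
/-- The underlying element of `L`. -/
def resCVal (x : resC q L) : L := Corner.val (i := iC₁ q) (W := L) x

lemma resB_ext {x y : resB q W} (h : resBVal q x = resBVal q y) : x = y :=
  Corner.ext (i := iB₂ q) (W := W) h
lemma resC_ext {x y : resC q L} (h : resCVal q x = resCVal q y) : x = y :=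
  Corner.ext (i := iC₁ q) (W := L) h

lemma resBVal_smul (c : AlgC k q) (x : resB q W) :
    resBVal q (c • x) = iB₂ q c.fst • resBVal q x := rfl
lemma resCVal_smul (b : AlgB k q) (x : resC q L) :
    resCVal q (b • x) = iC₁ q b.snd • resCVal q x := rfl
lemma iB₂_smul_resBVal (x : resB q W) : iB₂ q 1 • resBVal q x = resBVal q x :=
  Corner.one_smul_val (i := iB₂ q) (W := W) x
lemma iC₁_smul_resCVal (x : resC q L) : iC₁ q 1 • resCVal q x = resCVal q x :=
  Corner.one_smul_val (i := iC₁ q) (W := L) x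
lemma smul_resBVal (b : AlgB k q) (x : resB q W) : b • resBVal q x = iB₂ q b.snd • resBVal q x :=
  smul_val_inr (W := W) b x
lemma iC₂_smul_resCVal (c : k) (x : resC q L) : iC₂ q c • resCVal q x = 0 :=
  inr_smul_val_inl (W := L) c x

/-- Constructor for elements of `e₂ W`. -/
def resBMk (w : W) (h : iB₂ q 1 • w = w) : resB q W := Corner.mk w h
/-- Constructor for elements of `e₁ L`. -/
def resCMk (l : L) (h : iC₁ q 1 • l = l) : resC q L := Corner.mk l h
lemma resCVal_mk (w : L) (h : iC₁ q 1 • w = w) : resCVal q (resCMk q w h) = w := rfl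

/-- The inclusion of `e₂ W`. -/
def presU : resC q (resB q W) →ₗ[AlgB k q] W where
  toFun x := resBVal q (resCVal q x)
  map_add' _ _ := rfl
  map_smul' b x := by
    rw [resCVal_smul, resBVal_smul, inlHom_fst, RingHom.id_apply, smul_resBVal q b]

/-- The multiplication `B e₁ ⊗ e₁ W → W`. -/
def presW : IndB (Corner (iC₂ q) (IndC (Corner (iB₁ q) W))) →ₗ[AlgB k q] W where
  toFun x := x.fst.val.snd.val + ∑ i, mB q (modMBasis q i) • (x.snd i).val.snd.val
  map_add' x y := by
    simp only [IndB.add_fst, IndB.add_snd, Pi.add_apply, Corner.val_add, IndC.add_snd, smul_add,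
      Finset.sum_add_distrib]
    abel
  map_smul' b x := by
    have h (c : k) (y : Corner (iC₂ q) (IndC (Corner (iB₁ q) W))) :
        (c • y).val.snd.val = iB₁ q c • y.val.snd.val := by
      rw [Corner.val_smul, iC₂_smul_indC, Corner.val_smul]
    have h' (y : Fin 3 → Corner (iC₂ q) (IndC (Corner (iB₁ q) W))) :
        (∑ i, y i).val.snd.val = ∑ i, (y i).val.snd.val := by
      simp only [Fin.sum_univ_three, Corner.val_add, IndC.add_snd]
    simp only [IndB.smul_fst, IndB.smul_snd, Pi.add_apply, Corner.val_add, IndC.add_snd, h,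
      matAct_apply, h', smul_add, Finset.sum_add_distrib, RingHom.id_apply, Finset.smul_sum]
    rw [← mB_sum, ← modM_eq_sum, smul_val_inl b x.fst.val.snd, add_assoc]
    congr 2
    rw [Finset.sum_comm]
    refine Finset.sum_congr rfl fun j _ => ?_
    rw [smul_smul b, mul_cornerHom, lambda_smul_basis, mB_sum]

lemma presW_apply (x : IndB (Corner (iC₂ q) (IndC (Corner (iB₁ q) W)))) :
    presW q x = x.fst.val.snd.val + ∑ i, mB q (modMBasis q i) • (x.snd i).val.snd.val := rfl

/-- The map `L → M ⊗ e₂ L ⊕ e₂ L`. -/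
def presP : L →ₗ[AlgC k q] IndC (Corner (iB₁ q) (IndB (Corner (iC₂ q) L))) where
  toFun l := ⟨fun i => cornerIndBMk q (Corner.mk (mC q (dualBasis q i) • l) (by
      rw [smul_smul, inr_mul_corner, one_smul])),
    cornerIndBMk q (Corner.mk (iC₂ q 1 • l) (by rw [smul_smul, inr_mul_inr, one_mul]))⟩
  map_add' x y := by
    refine IndC.ext (funext fun i => corner_indB_ext q (Corner.ext ?_))
      (corner_indB_ext q (Corner.ext ?_)) <;> simp
  map_smul' c x := by
    refine IndC.ext (funext fun i => corner_indB_ext q (Corner.ext ?_))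
      (corner_indB_ext q (Corner.ext ?_))
    · rw [RingHom.id_apply, IndC.smul_fst]
      have h' (c : Fin 3 → k) (y : Fin 3 → Corner (iB₁ q) (IndB (Corner (iC₂ q) L))) :
          (∑ i, c i • y i).val.fst.val = ∑ i, iC₂ q (c i) • (y i).val.fst.val := by
        simp only [Fin.sum_univ_three, Corner.val_add, IndB.add_fst, Corner.val_smul,
          IndB.smul_fst, inlHom_fst]
      rw [matAct_apply, h']
      simp only [cornerIndBMk_val, Corner.val_mk]
      rw [← mC_sum, ← op_smul_dualBasis, smul_smul, cornerHom_mul]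
    · rw [RingHom.id_apply, IndC.smul_snd]
      have h' (c : Fin 3 → k) (r : k) (y : Fin 3 → Corner (iB₁ q) (IndB (Corner (iC₂ q) L)))
          (z : Corner (iB₁ q) (IndB (Corner (iC₂ q) L))) :
          (∑ i, c i • y i + r • z).val.fst.val =
            ∑ i, iC₂ q (c i) • (y i).val.fst.val + iC₂ q r • z.val.fst.val := by
        simp only [Fin.sum_univ_three, Corner.val_add, IndB.add_fst, Corner.val_smul,
          IndB.smul_fst, inlHom_fst]
      rw [h']
      simp only [cornerIndBMk_val, Corner.val_mk]
      rw [← mC_sum, ← dualM_eq_sum, smul_smul, smul_smul, inr_mul_inr, mul_one, inr_mul, one_smul,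
        one_mul, add_smul]

lemma presP_fst_val (l : L) (i : Fin 3) :
    ((presP q l).fst i).val.fst.val = mC q (dualBasis q i) • l := rfl
lemma presP_snd_val (l : L) : (presP q l).snd.val.fst.val = iC₂ q 1 • l := rfl

/-- The projection to `e₁ L`. -/
def presR : L →ₗ[AlgC k q] resB q (resC q L) where
  toFun l := resBMk q (resCMk q (iC₁ q 1 • l) (by rw [smul_smul, inl_mul_inl, one_mul])) (by
    refine resC_ext q ?_
    rw [resCVal_smul, resCVal_mk, smul_smul, inrHom_snd, inl_mul_inl, one_mul])
  map_add' x y := resB_ext q (resC_ext q (smul_add (iC₁ q 1) x y))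
  map_smul' c x := by
    refine resB_ext q (resC_ext q ?_)
    change iC₁ q 1 • c • x = iC₁ q c.fst • iC₁ q 1 • x
    rw [smul_smul, smul_smul, inl_mul_inl, mul_one, inl_mul, one_mul]

lemma presR_val (l : L) : resCVal q (resBVal q (presR q l)) = iC₁ q 1 • l := rfl

lemma mC_smul_inr_val (f : DualM k q) (z : Corner (iC₂ q) L) : mC q f • z.val = 0 :=
  corner_smul_val_inr (W := L) f z

lemma iC₁_one_smul_resB (x : resB q W) : iC₁ q 1 • x = x := by
  refine resB_ext q ?_
  rw [resBVal_smul, inlHom_fst, iB₂_smul_resBVal]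

lemma corner_resB_eq_zero (z : Corner (iC₂ q) (resB q W)) : z = 0 := by
  refine Corner.ext ?_
  rw [← z.one_smul_val]
  refine resB_ext q ?_
  rw [resBVal_smul, inrHom_fst, inr_zero_smul]
  rfl

lemma corner_resC_eq_zero (z : Corner (iB₁ q) (resC q L)) : z = 0 := by
  refine Corner.ext ?_
  rw [← z.one_smul_val]
  refine resC_ext q ?_
  rw [resCVal_smul, inlHom_snd, inl_zero_smul]
  rfl

/-- The tilting functors satisfy the cokernel condition. -/
def tiltCokernel : CokernelPresentation (tiltEta q) (tiltTheta q) where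
  u W := ModuleCat.ofHom (X := resC q (resB q W)) (presU q (W := W))
  w W := ModuleCat.ofHom (presW q (W := W))
  u_nat f x := rfl
  w_nat {X Y} f x := by
    change _ = f (_ + ∑ i, mB q _ • _)
    rw [map_add, map_sum]
    simp only [map_smul]
    rfl
  comm W (x : Corner (iC₁ q) (IndC (Corner (iB₁ q) W))) := by
    change ∑ i, mB q (modMBasis q i) • (x.val.fst i).val = presW q (tiltThetaFun q x)
    rw [presW_apply]
    simp only [tiltThetaFun_snd_val, tiltThetaFun_fst, mC_dualBasis_smul_indC, Corner.val_zero,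
      IndC.zero_snd, zero_add]
  surj W (x : W) := by
    refine ⟨resCMk q (L := resB q W)
        (resBMk q (iB₂ q 1 • x) (by rw [smul_smul, inr_mul_inr, one_mul])) (iC₁_one_smul_resB q _),
      (⟨cornerIndCMk q (Corner.mk (iB₁ q 1 • x) (by rw [smul_smul, inl_mul_inl, one_mul])), 0⟩ :
        IndB (Corner (iC₂ q) (IndC (Corner (iB₁ q) W)))), ?_⟩
    change iB₂ q 1 • x + (iB₁ q 1 • x +
      ∑ i, mB q (modMBasis q i) • (0 : Corner (iC₂ q) (IndC (Corner (iB₁ q) W))).val.snd.val) = x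
    simp only [Corner.val_zero, IndC.zero_snd, smul_zero, Finset.sum_const_zero, add_zero]
    rw [add_comm, inl_one_smul_add]
  exact W (a : resC q (resB q W)) (b : IndB (Corner (iC₂ q) (IndC (Corner (iB₁ q) W)))) h := by
    change resBVal q (resCVal q a) + (b.fst.val.snd.val +
      ∑ i, mB q (modMBasis q i) • (b.snd i).val.snd.val) = 0 at h
    -- Multiplying by e₁ isolates the e₁-part of the relation, since e₁ annihilates both e₂W and M ·
    -- W.
    have hb : b.fst.val.snd.val = 0 := by
      have h' := congrArg (iB₁ q 1 • ·) h
      simp only [smul_add, smul_zero, Finset.smul_sum, inl_smul_corner_smul,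
        Finset.sum_const_zero, add_zero, Corner.one_smul_val] at h'
      rwa [← iB₂_smul_resBVal, inl_smul_inr_smul, zero_add] at h'
    rw [hb, zero_add] at h
    -- What remains of b is an element of M ⊗ e₁W, which is G₀F₀W; its negative is the witness, by
    -- the sign convention of `exact`.
    refine ⟨(Corner.mk ⟨fun i => -(b.snd i).val.snd, 0⟩ (iC₁_one_smul_indC q _) :
      Corner (iC₁ q) (IndC (Corner (iB₁ q) W))), ?_, ?_⟩
    · refine resC_ext q (resB_ext q ?_)
      refine (eq_neg_of_add_eq_zero_left h).trans ?_
      change _ = ∑ i, mB q (modMBasis q i) • (-(b.snd i).val.snd).val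
      simp only [Corner.val_neg, smul_neg, Finset.sum_neg_distrib]
    · refine IndB.ext (corner_indC_ext q (Corner.ext ?_))
        (funext fun i => corner_indC_ext q (Corner.ext ?_))
      · rw [hb]
        change 0 = (-(0 : Corner (iC₂ q) (IndC (Corner (iB₁ q) W)))).val.snd.val
        simp
      · change _ = (-(mC q (dualBasis q i) •
          (⟨fun i => -(b.snd i).val.snd, 0⟩ : IndC (Corner (iB₁ q) W)))).snd.val
        rw [mC_dualBasis_smul_indC, IndC.neg_snd, neg_neg]
  inj W (c : Corner (iC₁ q) (IndC (Corner (iB₁ q) W))) _ h := by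
    refine Corner.ext (i := iC₁ q) (W := IndC (Corner (iB₁ q) W))
      (IndC.ext (funext fun i => ?_) (corner_indC_snd q c))
    have h' := congrArg (fun x : IndB (Corner (iC₂ q) (IndC (Corner (iB₁ q) W))) =>
      (x.snd i).val.snd) h
    change (mC q (dualBasis q i) • c.val).snd = 0 at h'
    rwa [mC_dualBasis_smul_indC] at h'
  zero W := by
    refine ⟨fun (a b : IndB (Corner (iC₂ q) (resB q W))) => IndB.ext ?_ (funext fun i => ?_)⟩
    · rw [corner_resB_eq_zero q (W := W) a.fst, corner_resB_eq_zero q (W := W) b.fst]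
    · rw [corner_resB_eq_zero q (W := W) (a.snd i), corner_resB_eq_zero q (W := W) (b.snd i)]

/-- The tilting functors satisfy the kernel condition. -/
def tiltKernel : KernelPresentation (tiltEta q) (tiltTheta q) where
  p L := ModuleCat.ofHom (presP q (L := L))
  r L := ModuleCat.ofHom (Y := resB q (resC q L)) (presR q (L := L))
  p_nat {X Y} f x := by
    refine IndC.ext (funext fun i => corner_indB_ext q (Corner.ext ?_))
      (corner_indB_ext q (Corner.ext ?_))
    · exact map_smul f.hom _ _
    · exact map_smul f.hom _ _
  r_nat {X Y} f x := resB_ext q (resC_ext q (map_smul f.hom _ _))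
  comm L (l : L) := by
    refine Corner.ext (i := iB₂ q) (W := IndB (Corner (iC₂ q) L)) ?_
    change ∑ i, mB q (modMBasis q i) • ((presP q l).fst i).val =
      tiltThetaFun q (Corner.mk (iC₁ q 1 • l) (by rw [smul_smul, inl_mul_inl, one_mul]))
    rw [sum_mB_smul_indB]
    refine IndB.ext rfl (funext fun i => Corner.ext ?_)
    rw [tiltThetaFun_snd_val, Corner.val_mk, smul_smul, corner_mul_inl, MulOpposite.op_one,
      one_smul, presP_fst_val]
  inj L (l : L) hp hr := by
    have h₁ : iC₂ q 1 • l = 0 :=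
      congrArg (fun x : IndC (Corner (iB₁ q) (IndB (Corner (iC₂ q) L))) => x.snd.val.fst.val) hp
    have h₂ : iC₁ q 1 • l = 0 := congrArg (fun x => resCVal q (resBVal q (W := resC q L) x)) hr
    rw [← inl_one_smul_add (R := Lambda k q) (N := DualM k q) (S := k) l]
    exact (congrArg₂ (· + ·) h₂ h₁).trans (add_zero 0)
  exact L (b : IndC (Corner (iB₁ q) (IndB (Corner (iC₂ q) L)))) (c : resB q (resC q L)) h := by
    have h' : ∑ i, mB q (modMBasis q i) • (b.fst i).val =
      tiltThetaFun q (resBVal q (W := resC q L) c) := congrArg (Corner.val (i := iB₂ q)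
        (W := IndB (Corner (iC₂ q) L))) h
    rw [sum_mB_smul_indB] at h'
    have hc (i : Fin 3) : mC q (dualBasis q i) • resCVal q (resBVal q (W := resC q L) c) =
        (b.fst i).val.fst.val :=
      congrArg (fun x : IndB (Corner (iC₂ q) L) => (x.snd i).val) h'.symm
    -- c prescribes the e₁-part of the element of L and the last entry of b its e₂-part; the other
    -- entries of b are forced by the kernel equation.
    refine ⟨resCVal q (resBVal q (W := resC q L) c) + b.snd.val.fst.val, ?_, ?_⟩
    · refine IndC.ext (funext fun i => corner_indB_ext q (Corner.ext ?_))
        (corner_indB_ext q (Corner.ext ?_))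
      · refine (presP_fst_val q _ i).trans ?_
        rw [smul_add, hc, mC_smul_inr_val, add_zero]
        rfl
      · refine (presP_snd_val q _).trans ?_
        rw [smul_add, iC₂_smul_resCVal, Corner.one_smul_val, zero_add]
        rfl
    · refine resB_ext q (resC_ext q ((presR_val q (L := L) _).trans ?_))
      rw [smul_add, iC₁_smul_resCVal, inl_smul_val_inr, add_zero]
      rfl
  surj L := fun (y : Corner (iB₂ q) (IndB (Corner (iC₂ q) L))) => by
    refine ⟨(⟨fun i => cornerIndBMk q (y.val.snd i), 0⟩ :
      IndC (Corner (iB₁ q) (IndB (Corner (iC₂ q) L)))), ?_⟩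
    refine Corner.ext (i := iB₂ q) (W := IndB (Corner (iC₂ q) L)) ?_
    change ∑ i, mB q (modMBasis q i) • (cornerIndBMk q (y.val.snd i)).val = y.val
    rw [sum_mB_smul_indB]
    exact IndB.ext (corner_indB_fst q y).symm rfl
  zero L := by
    refine ⟨fun (a b : IndC (Corner (iB₁ q) (resC q L))) => IndC.ext (funext fun i => ?_) ?_⟩
    · rw [corner_resC_eq_zero q (L := L) (a.fst i), corner_resC_eq_zero q (L := L) (b.fst i)]
    · rw [corner_resC_eq_zero q (L := L) a.snd, corner_resC_eq_zero q (L := L) b.snd]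

theorem derivedEquivalent_algB_algC : DerivedEquivalent (AlgB k q) (AlgC k q) :=
  derivedEquivalent_of_presentations (tiltCokernel q) (tiltKernel q)

end Presentations

/-! ### The basis 1, x, y, z, yx, zx of Λ and annihilators of linear elements -/

noncomputable section LambdaStructure

variable {k : Type u} [Field k] (q : k)

namespace Lambda

/-- The class of a noncommutative polynomial in `Λ`. -/
abbrev mk : FreeAlgebra k (Fin 3) →ₐ[k] Lambda k q := RingQuot.mkAlgHom k (LambdaRel k q)

variable {q} in
lemma neg_smul' (c : k) (a : Lambda k q) : -c • a = -(c • a) := neg_smul c a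

variable {q} in
lemma sub_smul' (c d : k) (a : Lambda k q) : (c - d) • a = c • a - d • a := sub_smul c d a

/-- The generator `x` of `Λ`. -/
def x : Lambda k q := mk q (genX k)
/-- The generator `y` of `Λ`. -/
def y : Lambda k q := mk q (genY k)
/-- The generator `z` of `Λ`. -/
def z : Lambda k q := mk q (genZ k)

lemma x_mul_x : x q * x q = 0 := by
  simpa [x] using RingQuot.mkAlgHom_rel k (LambdaRel.xx (q := q))
lemma y_mul_y : y q * y q = 0 := by
  simpa [y] using RingQuot.mkAlgHom_rel k (LambdaRel.yy (q := q))
lemma z_mul_z : z q * z q = 0 := by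
  simpa [z] using RingQuot.mkAlgHom_rel k (LambdaRel.zz (q := q))
lemma y_mul_z : y q * z q = 0 := by
  simpa [y, z] using RingQuot.mkAlgHom_rel k (LambdaRel.yz (q := q))
lemma x_mul_y : x q * y q = -q • (y q * x q) := by
  have h := RingQuot.mkAlgHom_rel k (LambdaRel.xy (q := q))
  simp only [map_add, map_mul, map_smul, map_zero] at h
  rw [neg_smul']
  exact eq_neg_of_add_eq_zero_left h
lemma x_mul_z : x q * z q = z q * x q := by
  have h := RingQuot.mkAlgHom_rel k (LambdaRel.xz (q := q))
  simp only [map_sub, map_mul, map_zero] at h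
  exact sub_eq_zero.1 h
lemma z_mul_y : z q * y q = z q * x q := by
  have h := RingQuot.mkAlgHom_rel k (LambdaRel.zy (q := q))
  simp only [map_sub, map_mul, map_zero] at h
  exact sub_eq_zero.1 h

lemma x_mul_y_mul_x : x q * (y q * x q) = 0 := by
  rw [← mul_assoc, x_mul_y, smul_mul_assoc, mul_assoc, x_mul_x, mul_zero, smul_zero]
lemma y_mul_y_mul_x : y q * (y q * x q) = 0 := by rw [← mul_assoc, y_mul_y, zero_mul]
lemma z_mul_y_mul_x : z q * (y q * x q) = 0 := by
  rw [← mul_assoc, z_mul_y, mul_assoc, x_mul_x, mul_zero]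
lemma x_mul_z_mul_x : x q * (z q * x q) = 0 := by
  rw [← mul_assoc, x_mul_z, mul_assoc, x_mul_x, mul_zero]
lemma y_mul_z_mul_x : y q * (z q * x q) = 0 := by rw [← mul_assoc, y_mul_z, zero_mul]
lemma z_mul_z_mul_x : z q * (z q * x q) = 0 := by rw [← mul_assoc, z_mul_z, zero_mul]

/-- The element of `Λ` with given coefficients with respect to the basis
`1, x, y, z, yx, zx`. -/
def ofCoeff : (Fin 6 → k) →ₗ[k] Lambda k q :=
  Fintype.linearCombination k ![1, x q, y q, z q, y q * x q, z q * x q]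

lemma ofCoeff_apply (c : Fin 6 → k) : ofCoeff q c =
    c 0 • (1 : Lambda k q) + c 1 • x q + c 2 • y q + c 3 • z q + c 4 • (y q * x q) +
      c 5 • (z q * x q) := by
  simp [ofCoeff, Fintype.linearCombination_apply, Fin.sum_univ_succ, add_assoc]

lemma x_mul_ofCoeff (c : Fin 6 → k) : x q * ofCoeff q c =
    ofCoeff q ![0, c 0, 0, 0, -q * c 2, c 3] := by
  simp [ofCoeff_apply, mul_add, x_mul_x, x_mul_y, x_mul_z, x_mul_y_mul_x, x_mul_z_mul_x, smul_smul,
    mul_comm, neg_smul']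
lemma y_mul_ofCoeff (c : Fin 6 → k) : y q * ofCoeff q c = ofCoeff q ![0, 0, c 0, 0, c 1, 0] := by
  simp [ofCoeff_apply, mul_add, y_mul_y, y_mul_z, y_mul_y_mul_x, y_mul_z_mul_x]
lemma z_mul_ofCoeff (c : Fin 6 → k) : z q * ofCoeff q c =
    ofCoeff q ![0, 0, 0, c 0, 0, c 1 + c 2] := by
  simp [ofCoeff_apply, mul_add, z_mul_z, z_mul_y, z_mul_y_mul_x, z_mul_z_mul_x, add_smul, add_assoc]

/-- The span of the six monomials contains 1 and is stable under left multiplication by the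
generators. -/
lemma ofCoeff_surjective : Function.Surjective (ofCoeff q) := by
  have key (a : FreeAlgebra k (Fin 3)) : ∀ c, ∃ d, mk q a * ofCoeff q c = ofCoeff q d := by
    induction a using FreeAlgebra.induction with
    | grade0 r =>
      exact fun c => ⟨r • c, by rw [AlgHom.commutes, ← Algebra.smul_def, map_smul]⟩
    | grade1 i =>
      intro c
      fin_cases i
      · exact ⟨_, x_mul_ofCoeff q c⟩
      · exact ⟨_, y_mul_ofCoeff q c⟩
      · exact ⟨_, z_mul_ofCoeff q c⟩
    | mul a b ha hb =>
      intro c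
      obtain ⟨d, hd⟩ := hb c
      obtain ⟨e, he⟩ := ha d
      exact ⟨e, by rw [map_mul, mul_assoc, hd, he]⟩
    | add a b ha hb =>
      intro c
      obtain ⟨d, hd⟩ := ha c
      obtain ⟨e, he⟩ := hb c
      exact ⟨d + e, by rw [map_add, add_mul, hd, he, map_add]⟩
  intro a
  obtain ⟨a, rfl⟩ := RingQuot.mkAlgHom_surjective k (LambdaRel k q) a
  obtain ⟨d, hd⟩ := key a ![1, 0, 0, 0, 0, 0]
  refine ⟨d, hd.symm.trans ?_⟩
  have h1 : ofCoeff q ![1, 0, 0, 0, 0, 0] = 1 := by simp [ofCoeff_apply]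
  rw [h1, mul_one]

instance : Module.Finite k (Lambda k q) := Module.Finite.of_surjective _ (ofCoeff_surjective q)

/-- The action of the generators on the coefficients. -/
def regMatrix : Fin 3 → ((Fin 6 → k) →ₗ[k] (Fin 6 → k)) :=
  ![Matrix.toLin' !![0, 0, 0, 0, 0, 0; 1, 0, 0, 0, 0, 0; 0, 0, 0, 0, 0, 0; 0, 0, 0, 0, 0, 0;
      0, 0, -q, 0, 0, 0; 0, 0, 0, 1, 0, 0],
    Matrix.toLin' !![0, 0, 0, 0, 0, 0; 0, 0, 0, 0, 0, 0; 1, 0, 0, 0, 0, 0; 0, 0, 0, 0, 0, 0;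
      0, 1, 0, 0, 0, 0; 0, 0, 0, 0, 0, 0],
    Matrix.toLin' !![0, 0, 0, 0, 0, 0; 0, 0, 0, 0, 0, 0; 0, 0, 0, 0, 0, 0; 1, 0, 0, 0, 0, 0;
      0, 0, 0, 0, 0, 0; 0, 1, 1, 0, 0, 0]]

lemma regMatrix_zero (c : Fin 6 → k) : regMatrix q 0 c = ![0, c 0, 0, 0, -q * c 2, c 3] := by
  ext i
  fin_cases i <;> simp [regMatrix, Matrix.mulVec, dotProduct, Fin.sum_univ_succ]
lemma regMatrix_one (c : Fin 6 → k) : regMatrix q 1 c = ![0, 0, c 0, 0, c 1, 0] := by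
  ext i
  fin_cases i <;> simp [regMatrix, Matrix.mulVec, dotProduct, Fin.sum_univ_succ]
lemma regMatrix_two (c : Fin 6 → k) : regMatrix q 2 c = ![0, 0, 0, c 0, 0, c 1 + c 2] := by
  ext i
  fin_cases i <;> simp [regMatrix, Matrix.mulVec, dotProduct, Fin.sum_univ_succ]

/-- The left regular representation of `Λ` in coordinates. -/
def reg : Lambda k q →ₐ[k] Module.End k (Fin 6 → k) :=
  RingQuot.liftAlgHom k
    ⟨FreeAlgebra.lift k (regMatrix q), by
      intro a b h
      refine LinearMap.ext fun c => ?_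
      induction h <;>
        simp only [genX, genY, genZ, map_mul, map_add, map_sub, map_smul, map_zero,
          FreeAlgebra.lift_ι_apply, Module.End.mul_apply, LinearMap.add_apply, LinearMap.sub_apply,
          LinearMap.smul_apply, LinearMap.zero_apply, regMatrix_zero, regMatrix_one,
          regMatrix_two] <;>
        · ext i
          fin_cases i <;> simp⟩

/-- The coefficients of an element of `Λ` with respect to the basis `1, x, y, z, yx, zx`. -/
def coeff : Lambda k q →ₗ[k] (Fin 6 → k) :=
  LinearMap.applyₗ ![1, 0, 0, 0, 0, 0] ∘ₗ (reg q).toLinearMap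

lemma coeff_x_mul (a : Lambda k q) : coeff q (x q * a) =
    ![0, coeff q a 0, 0, 0, -q * coeff q a 2, coeff q a 3] := by
  have h : reg q (x q) = regMatrix q 0 := by
    simp [reg, x, mk, genX]
  change reg q (x q * a) _ = _
  rw [map_mul, Module.End.mul_apply, h, regMatrix_zero]
  rfl
lemma coeff_y_mul (a : Lambda k q) : coeff q (y q * a) =
    ![0, 0, coeff q a 0, 0, coeff q a 1, 0] := by
  have h : reg q (y q) = regMatrix q 1 := by
    simp [reg, y, mk, genY]
  change reg q (y q * a) _ = _
  rw [map_mul, Module.End.mul_apply, h, regMatrix_one]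
  rfl
lemma coeff_z_mul (a : Lambda k q) : coeff q (z q * a) =
    ![0, 0, 0, coeff q a 0, 0, coeff q a 1 + coeff q a 2] := by
  have h : reg q (z q) = regMatrix q 2 := by
    simp [reg, z, mk, genZ]
  change reg q (z q * a) _ = _
  rw [map_mul, Module.End.mul_apply, h, regMatrix_two]
  rfl
lemma coeff_one : coeff q 1 = ![1, 0, 0, 0, 0, 0] := by
  change reg q 1 _ = _
  rw [map_one]; rfl

/-- Linear independence of the six monomials: the matrices in `reg` satisfy the relations of Λ, and
applied to the first basis vector the monomials give the six basis vectors. -/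
lemma coeff_ofCoeff (c : Fin 6 → k) : coeff q (ofCoeff q c) = c := by
  have hx : coeff q (x q) = ![0, 1, 0, 0, 0, 0] := by
    rw [← mul_one (x q), coeff_x_mul, coeff_one]; simp
  have hy : coeff q (y q) = ![0, 0, 1, 0, 0, 0] := by
    rw [← mul_one (y q), coeff_y_mul, coeff_one]; simp
  have hz : coeff q (z q) = ![0, 0, 0, 1, 0, 0] := by
    rw [← mul_one (z q), coeff_z_mul, coeff_one]; simp
  rw [ofCoeff_apply]
  simp only [map_add, map_smul, coeff_y_mul, coeff_z_mul, coeff_one, hx, hy, hz]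
  ext i
  fin_cases i <;> simp

lemma ofCoeff_coeff (a : Lambda k q) : ofCoeff q (coeff q a) = a := by
  obtain ⟨c, rfl⟩ := ofCoeff_surjective q a
  rw [coeff_ofCoeff]

variable {q} in
lemma coeff_injective {a b : Lambda k q} (h : coeff q a = coeff q b) : a = b := by
  rw [← ofCoeff_coeff q a, h, ofCoeff_coeff]

/-- The element `x - q ^ n y`. -/
def xy (n : ℕ) : Lambda k q := x q - q ^ n • y q

lemma coeff_xy_mul (n : ℕ) (a : Lambda k q) : coeff q (xy q n * a) =
    ![0, coeff q a 0, -q ^ n * coeff q a 0, 0, -q * coeff q a 2 - q ^ n * coeff q a 1,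
      coeff q a 3] := by
  rw [xy, sub_mul, smul_mul_assoc, map_sub, map_smul, coeff_x_mul, coeff_y_mul]
  ext i
  fin_cases i <;> simp

lemma xy_succ_mul_xy (n : ℕ) : xy q (n + 1) * xy q n = 0 := by
  refine coeff_injective ?_
  rw [← mul_one (xy q n), coeff_xy_mul, coeff_xy_mul, coeff_one, map_zero]
  ext i
  fin_cases i <;> simp [pow_succ, mul_comm]

/-- This identity is where q enters the obstruction: zx = zy = xz collapses aₙ to the scalar 1 - qⁿ,
which is zero for n = 0 and, for q of infinite order, for no other n. -/
lemma z_mul_xy (n : ℕ) : z q * xy q n = x q * (1 - q ^ n) • z q := by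
  rw [xy, mul_sub, mul_smul_comm, z_mul_y, mul_smul_comm, x_mul_z, sub_smul', one_smul]

-- With `xy_succ_mul_xy`, the right annihilator of aₙ₊₁ is exactly aₙΛ; hence over a projective
-- Λ-module multiplication by aₙ₊₁ followed by aₙ₊₂, and so on, is exact.
variable {q} in
lemma exists_eq_xy_mul (hq : q ≠ 0) {n : ℕ} {a : Lambda k q} (h : xy q (n + 1) * a = 0) :
    ∃ b, a = xy q n * b := by
  have h' : coeff q (xy q (n + 1) * a) = 0 := by rw [h, map_zero]
  rw [coeff_xy_mul] at h'
  have h1 := congrFun h' 1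
  have h4 := congrFun h' 4
  have h5 := congrFun h' 5
  simp at h1 h4 h5
  -- The hypothesis says a₀ = a₃ = 0 and a₂ = -qⁿa₁ for the coefficients of a. The entries of b
  -- produce the terms x - qⁿy, yx and zx respectively, using xy = -q yx and xz = zx.
  refine ⟨ofCoeff q ![coeff q a 1, 0, -q⁻¹ * coeff q a 4, coeff q a 5, 0, 0],
    coeff_injective ?_⟩
  rw [coeff_xy_mul, coeff_ofCoeff]
  ext i
  fin_cases i <;> simp [h1, h5, hq]
  have : q * (coeff q a 2 + q ^ n * coeff q a 1) = 0 := by linear_combination -h4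
  linear_combination (mul_eq_zero.1 this).resolve_left hq

variable {q} in
lemma exists_eq_x_mul (hq : q ≠ 0) {a : Lambda k q} (h : x q * a = 0) : ∃ b, a = x q * b := by
  have h' : coeff q (x q * a) = 0 := by rw [h, map_zero]
  rw [coeff_x_mul] at h'
  have h1 := congrFun h' 1
  have h4 := congrFun h' 4
  have h5 := congrFun h' 5
  simp [hq] at h1 h4 h5
  refine ⟨ofCoeff q ![coeff q a 1, 0, -q⁻¹ * coeff q a 4, coeff q a 5, 0, 0],
    coeff_injective ?_⟩
  rw [coeff_x_mul, coeff_ofCoeff]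
  ext i
  fin_cases i <;> simp [h1, h4, h5, hq]

lemma y_mul_x_ne_zero : y q * x q ≠ 0 := fun h => by
  have h' : coeff q (y q * (x q * 1)) = 0 := by rw [mul_one, h, map_zero]
  rw [coeff_y_mul, coeff_x_mul, coeff_one] at h'
  simpa using congrFun h' 4

/-- The augmentation of `Λ`. -/
def aug : Lambda k q →ₐ[k] k :=
  RingQuot.liftAlgHom k ⟨FreeAlgebra.lift k 0, by
    intro a b h
    induction h <;>
      simp only [genX, genY, genZ, map_mul, map_add, map_sub, map_smul, map_zero,
        FreeAlgebra.lift_ι_apply, Pi.zero_apply, mul_zero, smul_zero, add_zero, sub_zero]⟩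

lemma aug_x : aug q (x q) = 0 := by simp [aug, x, mk, genX]
lemma aug_y : aug q (y q) = 0 := by simp [aug, y, mk, genY]
lemma aug_z : aug q (z q) = 0 := by simp [aug, z, mk, genZ]

lemma exists_eq_of_aug_eq_zero {a : Lambda k q} (h : aug q a = 0) :
    ∃ b c d, a = b * x q + c * y q + d * z q := by
  obtain ⟨c, rfl⟩ := ofCoeff_surjective q a
  rw [ofCoeff_apply] at h ⊢
  simp only [map_add, map_smul, map_mul, map_one, aug_x, aug_y, aug_z, smul_eq_mul, mul_zero,
    mul_one, add_zero] at h
  refine ⟨c 1 • 1 + c 4 • y q + c 5 • z q, c 2 • 1, c 3 • 1, ?_⟩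
  rw [h]
  simp only [add_mul, smul_mul_assoc, one_mul, zero_smul, zero_add]
  abel

/-- All three generators annihilate yx from the left, so yx spans a simple left ideal. -/
lemma mul_y_mul_x (a : Lambda k q) : a * (y q * x q) = aug q a • (y q * x q) := by
  obtain ⟨c, rfl⟩ := ofCoeff_surjective q a
  rw [ofCoeff_apply]
  simp only [map_add, map_smul, map_mul, map_one, aug_x, aug_y, aug_z, smul_eq_mul, mul_zero,
    mul_one, add_zero, add_mul, smul_mul_assoc, mul_assoc, x_mul_y_mul_x, y_mul_y_mul_x,
    z_mul_y_mul_x, one_mul, smul_zero]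

lemma matRep_x (α : k) : matRep q α (x q) = genMatrix α 0 := by simp [matRep, x, mk, genX]
lemma matRep_y (α : k) : matRep q α (y q) = genMatrix α 1 := by simp [matRep, y, mk, genY]
lemma matRep_z (α : k) : matRep q α (z q) = genMatrix α 2 := by simp [matRep, z, mk, genZ]

end Lambda

end LambdaStructure

/-! ### General facts on delooping levels and one-dimensional simple modules -/

noncomputable section DeloopingGeneral

section

variable {k R N S : Type u} [Field k] [Ring R] [Ring S] [AddCommGroup N] [Algebra k R] [Algebra k S]
  [Module k N]

/-- The lower triangular matrix ring as a vector space. -/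
def LowerTriangular.linearEquiv : LowerTriangular R N S ≃ₗ[k] R × N × S where
  toFun t := (t.fst, t.corner, t.snd)
  invFun t := ⟨t.1, t.2.1, t.2.2⟩
  map_add' _ _ := rfl
  map_smul' _ _ := rfl

instance [Module.Finite k R] [Module.Finite k N] [Module.Finite k S] :
    Module.Finite k (LowerTriangular R N S) :=
  Module.Finite.equiv (LowerTriangular.linearEquiv (k := k)).symm

end

variable {A : Type u} [Ring A]

lemma factorsThroughProjective_zero {X Y : Type u} [AddCommGroup X] [Module A X]
    [AddCommGroup Y] [Module A Y] : FactorsThroughProjective (0 : X →ₗ[A] Y) :=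
  ⟨ModuleCat.of A PUnit.{u + 1}, 0, 0, inferInstanceAs (Module.Finite A PUnit.{u + 1}),
    inferInstanceAs (Module.Projective A PUnit.{u + 1}), by simp⟩

lemma StablyIsomorphic.of_linearEquiv {X Y : Type u} [AddCommGroup X] [Module A X]
    [AddCommGroup Y] [Module A Y] (e : X ≃ₗ[A] Y) : StablyIsomorphic A X Y :=
  ⟨e.toLinearMap, e.symm.toLinearMap, by simpa using factorsThroughProjective_zero,
    by simpa using factorsThroughProjective_zero⟩

lemma isStableSummand_of_linearEquiv {X Y : ModuleCat.{u} A} (e : X ≃ₗ[A] Y) :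
    IsStableSummand X Y :=
  ⟨ModuleCat.of A PUnit.{u + 1}, inferInstanceAs (Module.Finite A PUnit.{u + 1}),
    StablyIsomorphic.of_linearEquiv ((LinearEquiv.prodUnique (M := X) (R := A)).trans e)⟩

lemma isDeloopable_zero_of_isSyzygy {S N : ModuleCat.{u} A} (hN : Module.Finite A N)
    (h : IsSyzygy N S) : IsDeloopable 0 S :=
  ⟨N, S, S, hN, ⟨LinearEquiv.refl A S⟩, ⟨N, ⟨LinearEquiv.refl A N⟩, h⟩,
    isStableSummand_of_linearEquiv (LinearEquiv.refl A S)⟩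

/-- A projective module is zero in the stable category, hence a stable summand of Ω(0) = 0. -/
lemma isDeloopable_zero_of_projective {S : ModuleCat.{u} A} (hS : Module.Finite A S)
    (hS' : Module.Projective A S) : IsDeloopable 0 S := by
  let Z : ModuleCat.{u} A := ModuleCat.of A PUnit.{u + 1}
  refine ⟨Z, S, Z, inferInstanceAs (Module.Finite A PUnit.{u + 1}), ⟨LinearEquiv.refl A S⟩,
    ⟨Z, ⟨LinearEquiv.refl A Z⟩, Z, LinearMap.id, ⟨inferInstanceAs (Module.Finite A PUnit.{u + 1}),
      inferInstanceAs (Module.Projective A PUnit.{u + 1}), Function.surjective_id, ?_⟩, ⟨?_⟩⟩, Z,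
    inferInstanceAs (Module.Finite A PUnit.{u + 1}), 0, 0, ?_, ?_⟩
  · intro U hU
    rwa [LinearMap.ker_id, sup_bot_eq] at hU
  · exact
      { toFun z := ⟨0, rfl⟩
        invFun z := 0
        map_add' _ _ := Subtype.ext (add_zero _).symm
        map_smul' _ _ := Subtype.ext (smul_zero _).symm
        left_inv _ := rfl
        right_inv z := Subtype.ext rfl }
  · exact ⟨ModuleCat.of A (S × Z), -LinearMap.id, LinearMap.id,
      inferInstanceAs (Module.Finite A (S × PUnit.{u + 1})),
      inferInstanceAs (Module.Projective A (S × PUnit.{u + 1})), by simp⟩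
  · rw [show (0 : (S × Z) →ₗ[A] Z) ∘ₗ 0 - LinearMap.id = 0 from LinearMap.ext fun _ => rfl]
    exact factorsThroughProjective_zero

lemma delModule_eq_zero {M : ModuleCat.{u} A} (h : IsDeloopable 0 M) : delModule M = 0 :=
  le_antisymm (iInf₂_le 0 h) bot_le

lemma delModule_eq_top {M : ModuleCat.{u} A} (h : ∀ n, ¬ IsDeloopable n M) : delModule M = ⊤ :=
  iInf₂_eq_top.2 fun n hn => (h n hn).elim

lemma sddelModule_le_delModule {M : ModuleCat.{u} A} (hM : Module.Finite A M) :
    sddelModule M ≤ delModule M :=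
  iInf₂_le_of_le M hM (iInf_le _ ⟨LinearMap.id, Function.injective_id⟩)

lemma sddel_le_del : sddel A ≤ del A := by
  refine iSup₂_mono fun S hS => sddelModule_le_delModule ?_
  infer_instance

section OneDimensional

variable {k : Type u} [Field k] (χ : A →+* k)

/-- The one-dimensional module given by a character. -/
abbrev charModule : ModuleCat.{u} A := (ModuleCat.restrictScalars χ).obj (ModuleCat.of k k)

/-- `χ` as a linear map. -/
def charMap : A →ₗ[A] charModule χ where
  toFun := χ
  map_add' := map_add χ
  map_smul' a b := map_mul χ a b

variable {χ}

/-- Both modules are quotients of A by the kernel of χ: if as = 0 with χ(a) ≠ 0, then some ba - 1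
lies in that kernel, and applying it to s gives s = 0. -/
lemma nonempty_equiv_charModule (hχ : Function.Surjective χ) {S : Type u} [AddCommGroup S]
    [Module A S] [IsSimpleModule A S] {s : S} (hs : s ≠ 0) (h : ∀ a, χ a = 0 → a • s = 0) :
    Nonempty (S ≃ₗ[A] charModule χ) := by
  have hg := IsSimpleModule.toSpanSingleton_surjective A hs
  have hf : Function.Surjective (charMap χ) := hχ
  have hk : LinearMap.ker (charMap χ) = LinearMap.ker (LinearMap.toSpanSingleton A S s) := by
    refine le_antisymm (fun a ha => h a ha) fun a ha => ?_
    by_contra hne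
    replace ha : a • s = 0 := ha
    replace hne : χ a ≠ 0 := hne
    obtain ⟨b, hb⟩ := hχ (χ a)⁻¹
    have h1 := h (b * a - 1) (by rw [map_sub, map_mul, hb, map_one, inv_mul_cancel₀ hne, sub_self])
    rw [sub_smul, mul_smul, ha, smul_zero, one_smul, zero_sub, neg_eq_zero] at h1
    exact hs h1
  exact ⟨((LinearMap.quotKerEquivOfSurjective _ hg).symm.trans
    (Submodule.quotEquivOfEq _ _ hk.symm)).trans (LinearMap.quotKerEquivOfSurjective _ hf)⟩

lemma isSimpleModule_charModule (hχ : Function.Surjective χ) : IsSimpleModule A (charModule χ) := by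
  rw [isSimpleModule_iff_toSpanSingleton_surjective]
  refine ⟨inferInstanceAs (Nontrivial k), fun (s : k) (hs : s ≠ 0) (t : k) => ?_⟩
  obtain ⟨a, ha⟩ := hχ (t * s⁻¹)
  refine ⟨a, ?_⟩
  change χ a * s = t
  rw [ha, inv_mul_cancel_right₀ hs]

end OneDimensional

end DeloopingGeneral

/-! ### The algebra `C`: both simple modules have delooping level zero -/

noncomputable section DeloopingC

open LowerTriangular

variable {k : Type u} [Field k] (q : k)

/-- The character of `C` given by the vertex of `Λ`. -/
def augC : AlgC k q →+* k := (Lambda.aug q).toRingHom.comp (fstHom (Lambda k q) (DualM k q) k)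

lemma augC_apply (c : AlgC k q) : augC q c = Lambda.aug q c.fst := rfl

lemma augC_surjective : Function.Surjective (augC q) := fun r =>
  ⟨iC₁ q (algebraMap k _ r), by rw [augC_apply, inlHom_fst, AlgHom.commutes]; rfl⟩

lemma sndC_surjective : Function.Surjective (sndHom (Lambda k q) (DualM k q) k) := fun r =>
  ⟨iC₂ q r, rfl⟩

/-- If e₂S ≠ 0, any nonzero element of it works. Otherwise S is a Λ-module, and the last nonzero
layer among rad² · s, rad · s and s contains an element annihilated by x, y and z. -/
lemma exists_annihilated {S : Type u} [AddCommGroup S] [Module (AlgC k q) S] {s : S} (hs : s ≠ 0) :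
    ∃ t : S, t ≠ 0 ∧ ((∀ c : AlgC k q, c.snd = 0 → c • t = 0) ∨
      ∀ c : AlgC k q, augC q c = 0 → c • t = 0) := by
  by_cases h : ∃ s : S, iC₂ q 1 • s ≠ 0
  · obtain ⟨s, hs⟩ := h
    refine ⟨_, hs, Or.inl fun c hc => ?_⟩
    rw [smul_smul, mul_inr, hc, zero_mul, inr_zero_smul]
  push Not at h
  have hc (c : AlgC k q) (s : S) : c • s = iC₁ q c.fst • s := by
    conv_lhs => rw [← inl_one_smul_add (R := Lambda k q) (N := DualM k q) (S := k) (c • s), h,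
      add_zero, smul_smul, inl_mul, one_mul]
  have key (t : S) (ht : t ≠ 0) (hx : iC₁ q (Lambda.x q) • t = 0) (hy : iC₁ q (Lambda.y q) • t = 0)
      (hz : iC₁ q (Lambda.z q) • t = 0) : ∃ t : S, t ≠ 0 ∧
        ((∀ c : AlgC k q, c.snd = 0 → c • t = 0) ∨ ∀ c : AlgC k q, augC q c = 0 → c • t = 0) := by
    refine ⟨t, ht, Or.inr fun c hc' => ?_⟩
    obtain ⟨a, b, d, h'⟩ := Lambda.exists_eq_of_aug_eq_zero q hc'
    replace h' : c.fst = a * Lambda.x q + b * Lambda.y q + d * Lambda.z q := h'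
    rw [hc, h', map_add, map_add, map_mul, map_mul, map_mul, add_smul, add_smul, mul_smul, mul_smul,
      mul_smul, hx, hy, hz, smul_zero, smul_zero, smul_zero, add_zero, add_zero]
  have mul_eq (a b : Lambda k q) (t : S) : iC₁ q a • iC₁ q b • t = iC₁ q (a * b) • t := by
    rw [smul_smul, inl_mul_inl]
  by_cases h1 : iC₁ q (Lambda.y q * Lambda.x q) • s = 0
  swap
  · refine key _ h1 ?_ ?_ ?_
    · rw [mul_eq, Lambda.x_mul_y_mul_x, inl_zero_smul]
    · rw [mul_eq, Lambda.y_mul_y_mul_x, inl_zero_smul]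
    · rw [mul_eq, Lambda.z_mul_y_mul_x, inl_zero_smul]
  by_cases h2 : iC₁ q (Lambda.z q * Lambda.x q) • s = 0
  swap
  · refine key _ h2 ?_ ?_ ?_
    · rw [mul_eq, Lambda.x_mul_z_mul_x, inl_zero_smul]
    · rw [mul_eq, Lambda.y_mul_z_mul_x, inl_zero_smul]
    · rw [mul_eq, Lambda.z_mul_z_mul_x, inl_zero_smul]
  have h3 (c : k) : iC₁ q (c • (Lambda.y q * Lambda.x q)) • s = 0 := by
    rw [Algebra.smul_def, ← mul_eq, h1, smul_zero]
  by_cases hx : iC₁ q (Lambda.x q) • s = 0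
  swap
  · refine key _ hx ?_ ?_ ?_
    · rw [mul_eq, Lambda.x_mul_x, inl_zero_smul]
    · rw [mul_eq, h1]
    · rw [mul_eq, h2]
  by_cases hy : iC₁ q (Lambda.y q) • s = 0
  swap
  · refine key _ hy ?_ ?_ ?_
    · rw [mul_eq, Lambda.x_mul_y, h3]
    · rw [mul_eq, Lambda.y_mul_y, inl_zero_smul]
    · rw [mul_eq, Lambda.z_mul_y, h2]
  by_cases hz : iC₁ q (Lambda.z q) • s = 0
  swap
  · refine key _ hz ?_ ?_ ?_
    · rw [mul_eq, Lambda.x_mul_z, h2]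
    · rw [mul_eq, Lambda.y_mul_z, inl_zero_smul]
    · rw [mul_eq, Lambda.z_mul_z, inl_zero_smul]
  exact key s hs hx hy hz

/-- This module is C e₂: the second column of the matrix algebra is (0, k). -/
lemma projective_charModule_snd :
    Module.Projective (AlgC k q) (charModule (sndHom (Lambda k q) (DualM k q) k)) :=
  Module.Projective.of_split
    (M := AlgC k q)
    { toFun r := iC₂ q (show k from r)
      map_add' _ _ := map_add (iC₂ q) _ _
      map_smul' c r := by
        change iC₂ q (c.snd * (show k from r)) = c * iC₂ q (show k from r)
        rw [mul_inr] }
    (charMap (sndHom (Lambda k q) (DualM k q) k)) (LinearMap.ext fun _ => rfl)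

/-- The embedding of the simple module at the vertex of `Λ` into the radical of `C`. -/
def socleMap : charModule (augC q) →ₗ[AlgC k q] AlgC k q where
  toFun r := iC₁ q ((show k from r) • (Lambda.y q * Lambda.x q))
  map_add' a b := by rw [← map_add]; exact congrArg _ (add_smul _ _ _)
  map_smul' c r := by
    change iC₁ q ((augC q c * (show k from r)) • (Lambda.y q * Lambda.x q)) =
      c * iC₁ q ((show k from r) • (Lambda.y q * Lambda.x q))
    -- Products of two generators act as zero on M, so DM · yx = 0 and no corner entry appears.
    have h : MulOpposite.op ((show k from r) • (Lambda.y q * Lambda.x q)) • c.corner = 0 := by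
      refine dualM_ext fun m => ?_
      rw [op_smul_dualM_apply, IndC.dual_zero_apply]
      have hm : ((show k from r) • (Lambda.y q * Lambda.x q)) • m = 0 := by
        refine modM_ext fun i => ?_
        rw [modMCoord_lambda_smul, map_smul, map_mul, Lambda.matRep_x, Lambda.matRep_y,
          genMatrix_mul, smul_zero, Matrix.zero_mulVec]
        rfl
      rw [hm]
      exact map_zero (show ModM k q →ₗ[k] k from c.corner)
    rw [mul_inl, h, map_zero, add_zero, mul_smul_comm, Lambda.mul_y_mul_x, smul_smul, augC_apply,
      mul_comm]

lemma socleMap_apply (r : k) : socleMap q r = iC₁ q (r • (Lambda.y q * Lambda.x q)) := rfl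

lemma socleMap_injective : Function.Injective (socleMap q) := by
  refine (injective_iff_map_eq_zero (socleMap q)).2 fun (r : k) hr => ?_
  have h : r • (Lambda.y q * Lambda.x q) = 0 := congrArg LowerTriangular.fst hr
  exact (smul_eq_zero.1 h).resolve_right (Lambda.y_mul_x_ne_zero q)

lemma socleMap_mul_socleMap (r s : k) : socleMap q r * socleMap q s = 0 := by
  rw [socleMap_apply, socleMap_apply, inl_mul_inl, smul_mul_smul_comm, mul_assoc,
    Lambda.x_mul_y_mul_x, mul_zero, smul_zero, map_zero]

lemma isSyzygy_socle {S : ModuleCat.{u} (AlgC k q)} (e : S ≃ₗ[AlgC k q] charModule (augC q)) :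
    IsSyzygy (ModuleCat.of (AlgC k q) (AlgC k q ⧸ LinearMap.range (socleMap q))) S := by
  refine ⟨ModuleCat.of (AlgC k q) (AlgC k q), (LinearMap.range (socleMap q)).mkQ,
    ⟨inferInstanceAs (Module.Finite (AlgC k q) (AlgC k q)),
      inferInstanceAs (Module.Projective (AlgC k q) (AlgC k q)), Submodule.mkQ_surjective _, ?_⟩,
    ⟨(e.trans (LinearEquiv.ofInjective (socleMap q) (socleMap_injective q))).trans
      (LinearEquiv.ofEq _ _ (Submodule.ker_mkQ _).symm)⟩⟩
  intro (U : Submodule (AlgC k q) (AlgC k q)) hU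
  rw [Submodule.ker_mkQ] at hU
  obtain ⟨v, hv, w, ⟨r, rfl⟩, h⟩ := Submodule.mem_sup.1
    ((Submodule.eq_top_iff'.1 hU) (1 : AlgC k q))
  rw [Ideal.eq_top_iff_one U]
  -- With w = `socleMap q r` one has v = 1 - w and w² = 0, so 1 + w is a left inverse of v. This is
  -- why the socle piece is superfluous.
  have h1 : (1 : AlgC k q) = (1 + socleMap q r) • v := by
    have h2 : socleMap q r * socleMap q r = 0 := socleMap_mul_socleMap q r r
    rw [eq_sub_of_add_eq h, smul_eq_mul, add_mul, mul_sub, mul_sub, h2]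
    simp
  rw [h1]
  exact U.smul_mem _ hv

lemma isDeloopable_zero_of_isSimpleModule (S : ModuleCat.{u} (AlgC k q))
    (hS : IsSimpleModule (AlgC k q) S) : IsDeloopable 0 S := by
  have := IsSimpleModule.nontrivial (AlgC k q) S
  obtain ⟨s, hs⟩ := exists_ne (0 : S)
  obtain ⟨t, ht, h | h⟩ := exists_annihilated q hs
  · obtain ⟨e⟩ := nonempty_equiv_charModule (sndC_surjective q) ht h
    have := projective_charModule_snd q
    exact isDeloopable_zero_of_projective inferInstance (Module.Projective.of_equiv e.symm)
  · obtain ⟨e⟩ := nonempty_equiv_charModule (augC_surjective q) ht h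
    exact isDeloopable_zero_of_isSyzygy (inferInstanceAs (Module.Finite (AlgC k q)
      (AlgC k q ⧸ LinearMap.range (socleMap q)))) (isSyzygy_socle q e)

theorem del_algC : del (AlgC k q) = 0 := by
  refine le_antisymm (iSup₂_le fun S hS => ?_) bot_le
  rw [delModule_eq_zero (isDeloopable_zero_of_isSimpleModule q S hS)]

theorem sddel_algC : sddel (AlgC k q) = 0 :=
  le_antisymm (sddel_le_del.trans_eq (del_algC q)) bot_le

end DeloopingC

/-! ### The algebra `B`: an obstruction to delooping -/

noncomputable section DeloopingB

open LowerTriangular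

lemma exists_dualBasis (A : Type u) [Ring A] (P : Type u) [AddCommGroup P] [Module A P]
    [Module.Finite A P] [Module.Projective A P] :
    ∃ (n : ℕ) (φ : Fin n → P →ₗ[A] A) (e : Fin n → P), ∀ p, p = ∑ j, φ j p • e j := by
  obtain ⟨n, f, g, -, -, hfg⟩ := Module.Finite.exists_comp_eq_id_of_projective A P
  refine ⟨n, fun j => LinearMap.proj j ∘ₗ g, fun j => f (Pi.single j 1), fun p => ?_⟩
  conv_lhs => rw [← LinearMap.id_apply (R := A) p, ← hfg, LinearMap.comp_apply,
    ← LinearMap.sum_single_apply (fun _ => A) (g p), map_sum]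
  refine Finset.sum_congr rfl fun j _ => ?_
  have h : Pi.single j (g p j) = g p j • Pi.single (M := fun _ => A) j 1 := by
    rw [← Pi.single_smul, smul_eq_mul, mul_one]
  exact (congrArg f h).trans (map_smul f _ _)

variable {k : Type u} [Field k] (q : k)

/-- A `B`-module on which the idempotent `e₁` acts as zero. -/
def IsLower (W : Type u) [AddCommGroup W] [Module (AlgB k q) W] : Prop :=
  ∀ w : W, iB₁ q 1 • w = 0

variable {q}

section Lower

variable {W : Type u} [AddCommGroup W] [Module (AlgB k q) W]

lemma IsLower.smul_eq (h : IsLower q W) (b : AlgB k q) (w : W) : b • w = iB₂ q b.snd • w := by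
  conv_lhs => rw [← inl_one_smul_add (R := k) (N := ModM k q) (S := Lambda k q) w, h w, zero_add,
    smul_smul, mul_inr, mul_one]

lemma iB₂_smul_iB₂_smul (a b : Lambda k q) (w : W) : iB₂ q a • iB₂ q b • w = iB₂ q (a * b) • w := by
  rw [smul_smul, inr_mul_inr]

/-- Annihilator relations pass from Λ to lower projectives through dual bases: the coordinates of w
lie in `B`, but only their Λ-entries act on the lower module W. -/
lemma IsLower.exists_eq_smul [Module.Finite (AlgB k q) W] [Module.Projective (AlgB k q) W]
    (hW : IsLower q W) {a a' : Lambda k q} (h : ∀ u, a * u = 0 → ∃ v, u = a' * v) {w : W}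
    (hw : iB₂ q a • w = 0) : ∃ p : W, w = iB₂ q a' • p := by
  obtain ⟨n, φ, e, he⟩ := exists_dualBasis (AlgB k q) W
  have h' (j : Fin n) : ∃ v, (φ j w).snd = a' * v := h _ <| by
    have h1 := congrArg LowerTriangular.snd ((φ j).map_smul (iB₂ q a) w)
    rw [hw, map_zero] at h1
    exact h1.symm
  choose v hv using h'
  refine ⟨∑ j, iB₂ q (v j) • e j, ?_⟩
  conv_lhs => rw [he w]
  rw [Finset.smul_sum]
  refine Finset.sum_congr rfl fun j _ => ?_
  rw [hW.smul_eq, hv, iB₂_smul_iB₂_smul]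

/-- Maps through a projective never obstruct `HasLift`. The module Q need not be lower; it suffices
that f lands in a lower module, where only the Λ-entries aₙv of the coordinates of w count, and zaₙ
∈ xΛ. -/
lemma IsLower.exists_z_smul_eq (hq : q ≠ 0) (hW : IsLower q W) {Q : Type u} [AddCommGroup Q]
    [Module (AlgB k q) Q] [Module.Finite (AlgB k q) Q] [Module.Projective (AlgB k q) Q]
    (f : Q →ₗ[AlgB k q] W) {n : ℕ} {w : Q} (hw : iB₂ q (Lambda.xy q (n + 1)) • w = 0) :
    ∃ p : W, iB₂ q (Lambda.z q) • f w = iB₂ q (Lambda.x q) • p := by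
  obtain ⟨m, φ, e, he⟩ := exists_dualBasis (AlgB k q) Q
  have h' (j : Fin m) : ∃ v, (φ j w).snd = Lambda.xy q n * v := Lambda.exists_eq_xy_mul hq <| by
    have h1 := congrArg LowerTriangular.snd ((φ j).map_smul (iB₂ q (Lambda.xy q (n + 1))) w)
    rw [hw, map_zero] at h1
    exact h1.symm
  choose v hv using h'
  refine ⟨∑ j, iB₂ q ((1 - q ^ n) • Lambda.z q * v j) • f (e j), ?_⟩
  conv_lhs => rw [he w]
  rw [map_sum, Finset.smul_sum, Finset.smul_sum]
  refine Finset.sum_congr rfl fun j _ => ?_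
  rw [map_smul, hW.smul_eq (φ j w), hv, iB₂_smul_iB₂_smul, iB₂_smul_iB₂_smul, ← mul_assoc, ← mul_assoc,
    Lambda.z_mul_xy]

/-- There is a simple submodule at the vertex of `k`. -/
def HasTopSocle (q : k) (W : Type u) [AddCommGroup W] [Module (AlgB k q) W] : Prop :=
  ∃ s : W, s ≠ 0 ∧ iB₁ q 1 • s = s ∧ ∀ m, mB q m • s = 0

lemma HasTopSocle.of_injective (h : HasTopSocle q W) {W' : Type u} [AddCommGroup W']
    [Module (AlgB k q) W'] (f : W →ₗ[AlgB k q] W') (hf : Function.Injective f) :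
    HasTopSocle q W' := by
  obtain ⟨s, hs, h1, h2⟩ := h
  refine ⟨f s, fun h0 => hs (hf (h0.trans (map_zero f).symm)), ?_, fun m => ?_⟩
  · rw [← map_smul, h1]
  · rw [← map_smul, h2, map_zero]

lemma fst_corner_of_smul {b : AlgB k q} (h : iB₁ q 1 * b = b) : b = iB₁ q b.fst := by
  conv_lhs => rw [← h, inl_mul, one_mul]

lemma mB_mul_iB₁ (m : ModM k q) (r : k) : mB q m * iB₁ q r = mB q (r • m) := by
  rw [corner_mul_inl, op_smul_modM]

lemma modMBasis_ne_zero (i : Fin 3) : modMBasis q i ≠ 0 := fun h => by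
  have := congrFun (congrArg modMCoord h) i
  rw [modMCoord_basis] at this
  simp [modMCoord_zero] at this

/-- In a projective module no nonzero element of `e₁ P` is annihilated by `M`. -/
lemma eq_zero_of_projective [Module.Projective (AlgB k q) W] [Module.Finite (AlgB k q) W] {s : W}
    (h₁ : iB₁ q 1 • s = s) (h₂ : ∀ m, mB q m • s = 0) : s = 0 := by
  obtain ⟨n, φ, e, he⟩ := exists_dualBasis (AlgB k q) W
  rw [he s]
  refine Finset.sum_eq_zero fun j _ => ?_
  have h3 : φ j s = iB₁ q (φ j s).fst := fst_corner_of_smul (by rw [← smul_eq_mul, ← map_smul, h₁])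
  have h4 : mB q (modMBasis q 0) * φ j s = 0 := by rw [← smul_eq_mul, ← map_smul, h₂, map_zero]
  rw [h3, mB_mul_iB₁] at h4
  have h5 : (φ j s).fst • modMBasis q 0 = 0 := congrArg LowerTriangular.corner h4
  rw [(smul_eq_zero.1 h5).resolve_right (modMBasis_ne_zero 0)] at h3
  rw [h3, inl_zero_smul]

/-- Since e₁B = ke₁ with k a field, a nonzero coordinate of a vector in e₁W is invertible there and
would split off a copy of B e₁, which cannot lie in a superfluous submodule. -/
lemma isLower_of_superfluous [Module.Projective (AlgB k q) W] [Module.Finite (AlgB k q) W]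
    {K : Submodule (AlgB k q) W} (hK : ∀ U : Submodule (AlgB k q) W, U ⊔ K = ⊤ → U = ⊤) {w : W}
    (hw : w ∈ K) : iB₁ q 1 • w = 0 := by
  obtain ⟨n, φ, e, he⟩ := exists_dualBasis (AlgB k q) W
  have hv : iB₁ q 1 • w ∈ K := K.smul_mem _ hw
  have hv1 : iB₁ q 1 • (iB₁ q 1 • w) = iB₁ q 1 • w := by rw [smul_smul, inl_mul_inl, one_mul]
  generalize iB₁ q 1 • w = v at hv hv1
  rw [he v]
  refine Finset.sum_eq_zero fun j _ => ?_
  have h3 : φ j v = iB₁ q (φ j v).fst := fst_corner_of_smul (by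
    rw [← smul_eq_mul, ← map_smul, hv1])
  suffices h : (φ j v).fst = 0 by rw [h3, h, inl_zero_smul]
  by_contra hr
  let ψ : W →ₗ[AlgB k q] AlgB k q := LinearMap.toSpanSingleton _ _ (iB₁ q (φ j v).fst⁻¹) ∘ₗ φ j
  have hψ (p : W) : ψ p = φ j p * iB₁ q (φ j v).fst⁻¹ := rfl
  have hψv : ψ v = iB₁ q 1 := by rw [hψ, h3, inl_mul_inl, inlHom_fst, mul_inv_cancel₀ hr]
  have hψ1 (p : W) : ψ p * iB₁ q 1 = ψ p := by rw [hψ, mul_assoc, inl_mul_inl, mul_one]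
  -- ψ takes values in B e₁ and sends v ∈ K to e₁, so p - ψ(p)v lies in its kernel for every p.
  have htop : LinearMap.ker ψ ⊔ K = ⊤ := by
    refine Submodule.eq_top_iff'.2 fun p => Submodule.mem_sup.2
      ⟨p - ψ p • v, ?_, ψ p • v, K.smul_mem _ hv, sub_add_cancel _ _⟩
    rw [LinearMap.mem_ker, map_sub, map_smul, hψv, smul_eq_mul, hψ1, sub_self]
  have h0 : ψ v = 0 := LinearMap.mem_ker.1 ((Submodule.eq_top_iff'.1 (hK _ htop)) v)
  rw [hψv] at h0
  exact one_ne_zero (congrArg LowerTriangular.fst h0 : (1 : k) = 0)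

end Lower

section Syzygies

variable {M K : ModuleCat.{u} (AlgB k q)}

lemma IsSyzygy.isLower (h : IsSyzygy M K) : IsLower q K := by
  obtain ⟨P, π, ⟨_, _, -, hsup⟩, ⟨e⟩⟩ := h
  intro w
  refine e.injective (Subtype.ext ?_)
  rw [map_smul, map_zero]
  exact isLower_of_superfluous hsup (e w).2

/-- e₁P maps to e₁M = 0, so it lies in the superfluous kernel, which e₁ annihilates. -/
lemma isLower_of_isProjectiveCover {P : ModuleCat.{u} (AlgB k q)} {π : P →ₗ[AlgB k q] M}
    (h : IsProjectiveCover π) (hM : IsLower q M) : IsLower q P := by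
  obtain ⟨_, _, -, hsup⟩ := h
  intro p
  have hp : iB₁ q 1 • p ∈ LinearMap.ker π := by rw [LinearMap.mem_ker, map_smul, hM]
  have h1 := isLower_of_superfluous hsup hp
  rwa [smul_smul, inl_mul_inl, one_mul] at h1

lemma isLower_of_isNthSyzygy {n : ℕ} (h : IsNthSyzygy (n + 1) M K) : IsLower q K := by
  obtain ⟨L, -, hL⟩ := h
  exact hL.isLower

/-- Every `w` annihilated by `x - qⁿ y` satisfies `z w ∈ x W`. -/
def HasLift (q : k) (n : ℕ) (W : Type u) [AddCommGroup W] [Module (AlgB k q) W] : Prop :=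
  ∀ w : W, iB₂ q (Lambda.xy q n) • w = 0 →
    ∃ l : W, iB₂ q (Lambda.z q) • w = iB₂ q (Lambda.x q) • l

/-- In the lower projective P, a₁w = 0 gives w = a₀p, and za₀ = 0; so even zw = 0. -/
lemma IsSyzygy.hasLift_one (hq : q ≠ 0) (hM : IsLower q M) (h : IsSyzygy M K) :
    HasLift q 1 K := by
  obtain ⟨P, π, hπ, ⟨e⟩⟩ := h
  have hP := isLower_of_isProjectiveCover hπ hM
  obtain ⟨_, _, -, -⟩ := hπ
  intro w hw
  refine ⟨0, e.injective (Subtype.ext ?_)⟩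
  have hw' : iB₂ q (Lambda.xy q (0 + 1)) • (e w : P) = 0 := by
    rw [← Submodule.coe_smul, ← map_smul, hw, map_zero]; rfl
  obtain ⟨p, hp⟩ := hP.exists_eq_smul (fun u => Lambda.exists_eq_xy_mul hq) hw'
  rw [map_smul, Submodule.coe_smul, hp, iB₂_smul_iB₂_smul, Lambda.z_mul_xy, pow_zero, sub_self,
    zero_smul, mul_zero, inr_zero_smul, smul_zero, map_zero]
  rfl

lemma IsSyzygy.hasLift_succ (hq : q ≠ 0) (hM : IsLower q M) (h : IsSyzygy M K) {n : ℕ}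
    (hn : HasLift q n M) : HasLift q (n + 1) K := by
  obtain ⟨P, π, hπ, ⟨e⟩⟩ := h
  have hP := isLower_of_isProjectiveCover hπ hM
  obtain ⟨_, _, hsurj, -⟩ := hπ
  intro w hw
  have hw' : iB₂ q (Lambda.xy q (n + 1)) • (e w : P) = 0 := by
    rw [← Submodule.coe_smul, ← map_smul, hw, map_zero]; rfl
  obtain ⟨p, hp⟩ := hP.exists_eq_smul (fun u => Lambda.exists_eq_xy_mul hq) hw'
  have hp' : iB₂ q (Lambda.xy q n) • π p = 0 := by
    rw [← map_smul, ← hp]; exact (e w).2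
  obtain ⟨l, hl⟩ := hn _ hp'
  obtain ⟨l, rfl⟩ := hsurj l
  have hker : iB₂ q (Lambda.z q) • p - iB₂ q (Lambda.x q) • l ∈ LinearMap.ker π := by
    rw [LinearMap.mem_ker, map_sub, map_smul, map_smul, hl, sub_self]
  -- With w = aₙp, the lift in M makes zp - xl an element of the syzygy, and x(1 - qⁿ)(zp - xl) = (1
  -- - qⁿ)xzp = zw because x² = 0.
  refine ⟨iB₂ q (algebraMap k _ (1 - q ^ n)) • e.symm ⟨_, hker⟩, e.injective (Subtype.ext ?_)⟩
  rw [map_smul, map_smul, map_smul, e.apply_symm_apply, Submodule.coe_smul, Submodule.coe_smul,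
    Submodule.coe_smul, hp, smul_sub, smul_sub]
  simp only [iB₂_smul_iB₂_smul]
  rw [Lambda.z_mul_xy, ← Algebra.smul_def, ← Algebra.smul_def, mul_smul_comm, mul_smul_comm,
    Lambda.x_mul_x, smul_zero, inr_zero_smul, sub_zero]

/-- The first syzygy is spent on becoming lower, hence the index lags one behind the number of
syzygies. -/
lemma hasLift_of_isNthSyzygy (hq : q ≠ 0) {n : ℕ} (h : IsNthSyzygy (n + 2) M K) :
    HasLift q (n + 1) K := by
  induction n generalizing K with
  | zero =>
    obtain ⟨L, hL, hK⟩ := h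
    exact hK.hasLift_one hq (isLower_of_isNthSyzygy hL)
  | succ n ih =>
    obtain ⟨L, hL, hK⟩ := h
    exact hK.hasLift_succ hq (isLower_of_isNthSyzygy hL) (ih hL)

lemma lambda_x_smul_coord_two (m : ModM k q) : modMCoord (Lambda.x q • m) 2 = 0 := by
  rw [modMCoord_lambda_smul, Lambda.matRep_x]
  simp [genMatrix, Matrix.mulVec, dotProduct, Fin.sum_univ_three]

lemma lambda_z_smul_coord_two (m : ModM k q) : modMCoord (Lambda.z q • m) 2 = modMCoord m 0 := by
  rw [modMCoord_lambda_smul, Lambda.matRep_z]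
  simp [genMatrix, Matrix.mulVec, dotProduct, Fin.sum_univ_three]

lemma lambda_xy_one_smul (m : ModM k q) : Lambda.xy q 1 • m = 0 := by
  refine modM_ext fun i => ?_
  rw [modMCoord_lambda_smul, Lambda.xy, map_sub, map_smul, Lambda.matRep_x, Lambda.matRep_y]
  fin_cases i <;>
    simp [genMatrix, Matrix.mulVec, dotProduct, Fin.sum_univ_three, modMCoord_zero]

/-- Lift s to p ∈ e₁P. As M annihilates s, the element vp lies in the syzygy; it satisfies a₁(vp) =
0, while z(vp) = v''p. The image of x has no v''-coordinate, so a lift would force p = 0. -/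
lemma IsSyzygy.not_hasLift_one (h : IsSyzygy M K) (hM : HasTopSocle q M) : ¬ HasLift q 1 K := by
  obtain ⟨P, π, ⟨_, _, hsurj, -⟩, ⟨e⟩⟩ := h
  obtain ⟨s, hs, h1, h2⟩ := hM
  obtain ⟨p, hp⟩ := hsurj s
  have hp1 : π (iB₁ q 1 • p) = s := by rw [map_smul, hp, h1]
  have hp2 : iB₁ q 1 • (iB₁ q 1 • p) = iB₁ q 1 • p := by rw [smul_smul, inl_mul_inl, one_mul]
  generalize iB₁ q 1 • p = p at hp1 hp2
  intro hlift
  have hker : mB q (modMBasis q 0) • p ∈ LinearMap.ker π := by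
    rw [LinearMap.mem_ker, map_smul, hp1, h2]
  obtain ⟨l, hl⟩ := hlift (e.symm ⟨_, hker⟩) (e.injective (Subtype.ext (by
    rw [map_smul, e.apply_symm_apply, Submodule.coe_smul, smul_smul, inr_mul_corner,
      lambda_xy_one_smul, map_zero, map_zero]
    exact zero_smul (AlgB k q) p)))
  have hl' : mB q (Lambda.z q • modMBasis q 0) • p = iB₂ q (Lambda.x q) • (e l : P) := by
    rw [← inr_mul_corner, ← smul_smul, ← Submodule.coe_smul, ← map_smul, ← hl, map_smul,
      e.apply_symm_apply]
    rfl
  apply hs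
  rw [← hp1]
  suffices h0 : p = 0 by rw [h0, map_zero]
  obtain ⟨n, φ, b, hb⟩ := exists_dualBasis (AlgB k q) P
  rw [hb p]
  refine Finset.sum_eq_zero fun j _ => ?_
  have h3 : φ j p = iB₁ q (φ j p).fst := fst_corner_of_smul (by
    rw [← smul_eq_mul, ← map_smul, hp2])
  have h4 := congrArg (fun w => modMCoord (φ j w).corner 2) hl'
  simp only [map_smul] at h4
  rw [h3, smul_eq_mul, smul_eq_mul, mB_mul_iB₁, cornerHom_corner, modMCoord_smul, Pi.smul_apply,
    lambda_z_smul_coord_two, modMCoord_basis, LowerTriangular.mul_corner, inrHom_corner, smul_zero,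
    zero_add, inrHom_snd, lambda_x_smul_coord_two] at h4
  rw [h3, show (φ j p).fst = 0 by simpa using h4, inl_zero_smul]

/-- If aₙ annihilates π(p), then aₙp lies in the syzygy and aₙ₊₁ annihilates it. A lift l there
gives x((1 - qⁿ)zp - l) = 0; the right annihilator of x is xΛ, so projecting to M yields (1 -
qⁿ)zπ(p) ∈ xM, and 1 - qⁿ is invertible. -/
lemma IsSyzygy.not_hasLift_succ (hq : q ≠ 0) (h : IsSyzygy M K) (hM : IsLower q M) {n : ℕ}
    (hqn : q ^ n ≠ 1) (hn : ¬ HasLift q n M) : ¬ HasLift q (n + 1) K := by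
  obtain ⟨P, π, hπ, ⟨e⟩⟩ := h
  have hP := isLower_of_isProjectiveCover hπ hM
  obtain ⟨_, _, hsurj, -⟩ := hπ
  intro hlift
  refine hn fun w hw => ?_
  obtain ⟨p, rfl⟩ := hsurj w
  have hker : iB₂ q (Lambda.xy q n) • p ∈ LinearMap.ker π := by
    rw [LinearMap.mem_ker, map_smul, hw]
  obtain ⟨l, hl⟩ := hlift (e.symm ⟨_, hker⟩) (e.injective (Subtype.ext (by
    rw [map_smul, e.apply_symm_apply, Submodule.coe_smul, iB₂_smul_iB₂_smul,
      Lambda.xy_succ_mul_xy, inr_zero_smul, map_zero]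
    rfl)))
  have hl' : iB₂ q (Lambda.x q) • (iB₂ q ((1 - q ^ n) • Lambda.z q) • p - (e l : P)) = 0 := by
    rw [smul_sub, iB₂_smul_iB₂_smul, ← Lambda.z_mul_xy, ← Submodule.coe_smul, ← map_smul e, ← hl,
      map_smul e, e.apply_symm_apply, Submodule.coe_smul, iB₂_smul_iB₂_smul, sub_self]
  obtain ⟨p', hp'⟩ := hP.exists_eq_smul (fun u => Lambda.exists_eq_x_mul hq) hl'
  have hπl : π (e l : P) = 0 := (e l).2
  have h1 := congrArg π hp'
  rw [map_sub, hπl, sub_zero, map_smul π, map_smul π] at h1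
  refine ⟨iB₂ q (algebraMap k _ (1 - q ^ n)⁻¹) • π p', ?_⟩
  rw [iB₂_smul_iB₂_smul, ← Algebra.commutes, ← iB₂_smul_iB₂_smul, ← h1, iB₂_smul_iB₂_smul,
    ← Algebra.smul_def, smul_smul, inv_mul_cancel₀ (sub_ne_zero.2 (Ne.symm hqn)), one_smul]

lemma not_hasLift_of_isNthSyzygy (hq : q ≠ 0) (hqn : ∀ n : ℕ, 1 ≤ n → q ^ n ≠ 1)
    (hM : HasTopSocle q M) {n : ℕ} (h : IsNthSyzygy (n + 1) M K) : ¬ HasLift q (n + 1) K := by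
  induction n generalizing K with
  | zero =>
    obtain ⟨L, ⟨e⟩, hK⟩ := h
    exact hK.not_hasLift_one (hM.of_injective e.symm.toLinearMap e.symm.injective)
  | succ n ih =>
    obtain ⟨L, hL, hK⟩ := h
    exact hK.not_hasLift_succ hq (isLower_of_isNthSyzygy hL) (hqn _ (Nat.succ_pos n)) (ih hL)

end Syzygies

/-- Only one half of the stable isomorphism is needed: the identity of X factors through Y up to a
map through a finitely generated projective. -/
lemma IsStableSummand.exists_eq_add {A : Type u} [Ring A] {X Y : ModuleCat.{u} A}
    (h : IsStableSummand X Y) : ∃ (a : X →ₗ[A] Y) (b : Y →ₗ[A] X) (Q : ModuleCat.{u} A)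
      (g : X →ₗ[A] Q) (f : Q →ₗ[A] X), Module.Finite A Q ∧ Module.Projective A Q ∧
        ∀ x, x = b (a x) - f (g x) := by
  obtain ⟨Z, -, a, b, ⟨Q, g, f, hQ, hQ', h⟩, -⟩ := h
  refine ⟨a ∘ₗ LinearMap.inl A X Z, LinearMap.fst A X Z ∘ₗ b, Q, g ∘ₗ LinearMap.inl A X Z,
    LinearMap.fst A X Z ∘ₗ f, hQ, hQ', fun x => ?_⟩
  have h1 := congrArg Prod.fst (LinearMap.congr_fun h (x, 0))
  change (b (a (x, 0))).1 - x = (f (g (x, 0))).1 at h1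
  change x = (b (a (x, 0))).1 - (f (g (x, 0))).1
  rw [← h1, sub_sub_cancel]

lemma not_isDeloopable (hq : q ≠ 0) (hqn : ∀ n : ℕ, 1 ≤ n → q ^ n ≠ 1)
    {M : ModuleCat.{u} (AlgB k q)} (hM : HasTopSocle q M) (n : ℕ) : ¬ IsDeloopable n M := by
  rintro ⟨N, X, Y, -, hX, hY, hXY⟩
  obtain ⟨a, b, Q, g, f, _, _, h⟩ := hXY.exists_eq_add
  cases n with
  | zero =>
    obtain ⟨e⟩ := hX
    obtain ⟨s, hs, h1, h2⟩ := hM.of_injective e.symm.toLinearMap e.symm.injective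
    have ha : a s = 0 := by
      rw [← h1, map_smul, isLower_of_isNthSyzygy hY]
    -- In level 0 neither route can carry s: e₁ annihilates the syzygy Y, and in a projective M
    -- annihilates no nonzero element of the e₁-part.
    have hg : g s = 0 := eq_zero_of_projective (q := q) (by rw [← map_smul, h1])
      fun m => by rw [← map_smul, h2, map_zero]
    apply hs
    rw [h s, ha, hg, map_zero, map_zero, sub_zero]
  | succ n =>
    -- In positive level, X would inherit `HasLift` from Y, the correction through Q being harmless.
    refine not_hasLift_of_isNthSyzygy hq hqn hM hX fun w hw => ?_
    obtain ⟨l, hl⟩ := hasLift_of_isNthSyzygy hq hY (a w) (by rw [← map_smul, hw, map_zero])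
    obtain ⟨l', hl'⟩ := (isLower_of_isNthSyzygy hX).exists_z_smul_eq hq f (w := g w) (n := n)
      (by rw [← map_smul, hw, map_zero])
    refine ⟨b l - l', ?_⟩
    conv_lhs => rw [h w]
    rw [smul_sub, smul_sub, ← map_smul, hl, map_smul, hl']

variable (q)

/-- The simple `B`-module at the vertex of `k`. -/
abbrev topSimple : ModuleCat.{u} (AlgB k q) := charModule (fstHom k (ModM k q) (Lambda k q))

lemma isSimpleModule_topSimple : IsSimpleModule (AlgB k q) (topSimple q) :=
  isSimpleModule_charModule fun r => ⟨iB₁ q r, rfl⟩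

lemma hasTopSocle_topSimple : HasTopSocle q (topSimple q) :=
  ⟨(1 : k), one_ne_zero (α := k), one_mul (1 : k), fun _ => zero_mul (1 : k)⟩

variable {q}

/-- The obstruction refers only to a simple submodule at this vertex, so it persists in every module
into which the simple embeds. -/
lemma sddelModule_topSimple (hq : q ≠ 0) (hqn : ∀ n : ℕ, 1 ≤ n → q ^ n ≠ 1) :
    sddelModule (topSimple q) = ⊤ := by
  refine iInf₂_eq_top.2 fun N _ => iInf_eq_top.2 fun ⟨f, hf⟩ => ?_
  exact delModule_eq_top fun n =>
    not_isDeloopable hq hqn ((hasTopSocle_topSimple q).of_injective f hf) n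

theorem sddel_algB (hq : q ≠ 0) (hqn : ∀ n : ℕ, 1 ≤ n → q ^ n ≠ 1) : sddel (AlgB k q) = ⊤ :=
  top_le_iff.1 ((sddelModule_topSimple hq hqn).ge.trans
    (le_iSup₂_of_le (topSimple q) (isSimpleModule_topSimple q) le_rfl))

theorem del_algB (hq : q ≠ 0) (hqn : ∀ n : ℕ, 1 ≤ n → q ^ n ≠ 1) : del (AlgB k q) = ⊤ :=
  top_le_iff.1 ((sddel_algB hq hqn).ge.trans sddel_le_del)

end DeloopingB
end DeloopingLevel

/-! ### Assembly of the theorem -/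

theorem algB_algC_properties (k : Type u) [Field k] (q : k) (hq : q ≠ 0)
    (hqn : ∀ n : ℕ, 1 ≤ n → q ^ n ≠ 1) :
    Module.Finite k (DeloopingLevel.AlgB k q) ∧ Module.Finite k (DeloopingLevel.AlgC k q) ∧
      DeloopingLevel.DerivedEquivalent (DeloopingLevel.AlgB k q) (DeloopingLevel.AlgC k q) ∧
      DeloopingLevel.del (DeloopingLevel.AlgB k q) = ⊤ ∧
      DeloopingLevel.sddel (DeloopingLevel.AlgB k q) = ⊤ ∧
      DeloopingLevel.del (DeloopingLevel.AlgC k q) = 0 ∧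
      DeloopingLevel.sddel (DeloopingLevel.AlgC k q) = 0 :=
  ⟨inferInstance, inferInstance, DeloopingLevel.derivedEquivalent_algB_algC q,
    DeloopingLevel.del_algB hq hqn, DeloopingLevel.sddel_algB hq hqn, DeloopingLevel.del_algC q,
    DeloopingLevel.sddel_algC q⟩

theorem exists_field_not_root_of_unity :
    ∃ (k : Type u) (_ : Field k) (q : k), q ≠ 0 ∧ ∀ n : ℕ, 1 ≤ n → q ^ n ≠ 1 := by
  -- The element 2 ∈ ℚ has infinite multiplicative order; `ULift` places the field in an arbitrary
  -- universe.
  refine ⟨ULift.{u} ℚ, inferInstance, ⟨2⟩, fun h => ?_, fun n hn h => ?_⟩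
  · have := congrArg ULift.down h
    norm_num at this
  · have h' : (2 : ℚ) ^ n = 1 := congrArg ULift.down h
    exact (one_lt_pow₀ (one_lt_two : (1 : ℚ) < 2) (by lia)).ne' h'

theorem theorem1p1 :
    -- the explicit pair of algebras, for every field `k` and `q ∈ kˣ` of infinite order
    (∀ (k : Type u) [Field k] (q : k), q ≠ 0 → (∀ n : ℕ, 1 ≤ n → q ^ n ≠ 1) →
      Module.Finite k (DeloopingLevel.AlgB k q) ∧ Module.Finite k (DeloopingLevel.AlgC k q) ∧
      DeloopingLevel.DerivedEquivalent (DeloopingLevel.AlgB k q) (DeloopingLevel.AlgC k q) ∧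
      DeloopingLevel.del (DeloopingLevel.AlgB k q) = ⊤ ∧
      DeloopingLevel.sddel (DeloopingLevel.AlgB k q) = ⊤ ∧
      DeloopingLevel.del (DeloopingLevel.AlgC k q) = 0 ∧
      DeloopingLevel.sddel (DeloopingLevel.AlgC k q) = 0) ∧
    -- existence
    (∃ (k : Type u) (_ : Field k) (B C : Type u) (_ : Ring B) (_ : Ring C)
      (_ : Algebra k B) (_ : Algebra k C),
      Module.Finite k B ∧ Module.Finite k C ∧ DeloopingLevel.DerivedEquivalent B C ∧
      DeloopingLevel.del B = ⊤ ∧ DeloopingLevel.sddel B = ⊤ ∧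
      DeloopingLevel.del C = 0 ∧ DeloopingLevel.sddel C = 0) ∧
    -- finiteness of the delooping level is not a derived invariant
    (¬ ∀ (k : Type u) [Field k] (A A' : Type u) [Ring A] [Ring A'] [Algebra k A] [Algebra k A']
      [Module.Finite k A] [Module.Finite k A'], DeloopingLevel.DerivedEquivalent A A' →
      (DeloopingLevel.del A < ⊤ ↔ DeloopingLevel.del A' < ⊤)) ∧
    -- finiteness of the sub-derived delooping level is not a derived invariant
    (¬ ∀ (k : Type u) [Field k] (A A' : Type u) [Ring A] [Ring A'] [Algebra k A] [Algebra k A']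
      [Module.Finite k A] [Module.Finite k A'], DeloopingLevel.DerivedEquivalent A A' →
      (DeloopingLevel.sddel A < ⊤ ↔ DeloopingLevel.sddel A' < ⊤)) := by
  refine ⟨algB_algC_properties, ?_, fun h => ?_, fun h => ?_⟩
  all_goals
    obtain ⟨k, _, q, hq, hqn⟩ := exists_field_not_root_of_unity.{u}
    obtain ⟨hB, hC, hD, hdB, hsB, hdC, hsC⟩ := algB_algC_properties k q hq hqn
  · exact ⟨k, _, _, _, _, _, _, _, hB, hC, hD, hdB, hsB, hdC, hsC⟩
  · have := (h k _ _ hD).2 (by rw [hdC]; exact ENat.natCast_lt_top 0)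
    exact this.ne hdB
  · have := (h k _ _ hD).2 (by rw [hsC]; exact ENat.natCast_lt_top 0)
    exact this.ne hsB
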